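/- **Setting.** All of $m,n,k(m,n)$ below are positive integers. A data stream $\sigma=(a_1,\dots,a_m)$ of length $m$ over the alphabet $[n]=\{1,\dots,n\}$ has element indicators $\chi_i(j)=1$ iff $a_i=j$ (and $\chi_i(j)=0$ otherwise), and $\chi(j)=(\chi_1(j),\dots,\chi_m(j))\in\{0,1\}^m$ for $j\in[n]$. A data stream problem $\mathcal P$ is a family of functions $f_{m,n}:[n]^m\to\mathbb R$; we write $\mathcal P(\sigma)=f_{m,n}(\sigma)$. A clause over $m$ variables is a function $\{0,1\}^m\to\{0,1\}$ of the form $y_1\vee\dots\vee y_m$, where each $y_i$ is a variable $x_j$, a negated variable $\neg x_j$, or a constant $0$ or $1$. An $\mathrm{AM}_{\epsilon,\delta}(S,W)$ streaming algorithm for $f:[n]^m\to\mathbb R$ is a probabilistic algorithm $\mathcal A^r$ that has oracle access to a common random string $r$, may toss private random coins, and has sequential one-pass access to the input stream $\sigma$ and to a proof stream $\omega\in\{0,1\}^*$. It always halts, uses at most $S$ bits of space, and outputs a number or $\bot$. For every $\sigma\in[n]^m$, with probability at least $1-\delta/2$ over $r$ there is a nonempty set $\mathcal W_\sigma(r)$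 of proof streams of length at most $W$ such that, over the private coins, 1. (completeness) $\Pr\big[\,|\mathcal A^r(\sigma,\omega)-f(\sigma)|\le\epsilon|f(\sigma)|\,\big]>1-\delta/2$ for every $\omega\in\mathcal W_\sigma(r)$; 2. (soundness) $\Pr[\mathcal A^r(\sigma,\omega)=\bot]>1-\delta/2$ for every $\omega\notin\mathcal W_\sigma(r)$. Its randomness complexity is the length of $r$ plus the number of private coin tosses. **Theorem.** Let $0\le\epsilon<1/2$. Let $\mathcal P$ be a data stream problem such that for all $m,n$ there are $k=k(m,n)$ clauses $C_1,\dots,C_k$ over $m$ variables and a function $\psi:\{0,1\}^k\to\mathbb Z$ such that for every data stream $\sigma$ of length $m$ over $[n]$, $$(1-\epsilon)\,\mathcal P(\sigma)\;\le\;\sum_{j=1}^n\psi\big(C_1(\chi(j)),\dots,C_k(\chi(j))\big)\;\le\;(1+\epsilon)\,\mathcal P(\sigma).$$ Suppose that $|\psi(x)|<B$ for every $x\in\{0,1\}^k$, where $B=B(m,n)$ is bounded by a polynomial in $m,n$, and that $\psi$ and $C_1,\dots,C_k$ are known to the verifier (it can query the values of $\psi$ and the literals of the clauses). Then there are a single explicit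 algorithm (one fixed program, for all parameters) and a constant $K$ such that for all $m,n$, every $0<\delta\le1$ and all $s,w\in\mathbb N$ with $s\cdot w\ge n$, the algorithm, given the parameters $m,n,k,s,w,\lceil1/\delta\rceil$, is an $\mathrm{AM}_{\epsilon,\delta}(S,W)$ streaming algorithm for $\mathcal P$ on streams of length $m$ over $[n]$, where $$S\le s\,k\cdot\Lambda,\qquad W\le w\,k\cdot\Lambda,\qquad \Lambda=K\log^K(m+n+1/\delta),$$ and its randomness complexity is at most $\Lambda$. -/

import Mathlib

namespace AMStream

/-! ### Data streams, element indicators, clauses -/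

/-- A data stream of length `m` over the alphabet `[n]`. -/
abbrev Stream (m n : ℕ) := Fin m → Fin n

/-- A data stream problem: a real-valued function for every length and every alphabet size. -/
abbrev StreamProblem := ∀ m n : ℕ, Stream m n → ℝ

/-- The element indicator `χ(j) = (χ₁(j), …, χₘ(j))` of `σ`, where `χᵢ(j) = 1` iff `aᵢ = j`. -/
def indicator {m n : ℕ} (σ : Stream m n) (j : Fin n) : Fin m → Bool :=
  fun i => decide (σ i = j)

/-- A literal over the variables `x₁, …, xₘ`: a variable, a negated variable, or a constant. -/
inductive Literal (m : ℕ) where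
  | pos (j : Fin m)
  | neg (j : Fin m)
  | const (b : Bool)

/-- The value of a literal under an assignment. -/
def Literal.value {m : ℕ} : Literal m → (Fin m → Bool) → Bool
  | .pos j, x => x j
  | .neg j, x => !(x j)
  | .const b, _ => b

/-- A clause over `m` variables: a disjunction `y₁ ∨ … ∨ yₘ` of `m` literals. -/
abbrev Clause (m : ℕ) := Fin m → Literal m

/-- The Boolean function computed by a clause. -/
def Clause.value {m : ℕ} (c : Clause m) (x : Fin m → Bool) : Bool :=
  decide (∃ i, (c i).value x = true)

/-! ### The machine model

A random access machine whose memory cells and scratch values are natural numbers, charged by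
their bit lengths. Time is not bounded. A program is one finite object; everything that varies
with the input reaches it through read-only numerical parameters, through oracles for the clauses,
for `ψ` and for the common random string, and through the two one-way streams and the private
coins. -/

/-- The numerical parameters that the verifier knows: the stream length `m`, the alphabet size
`n`, the number `k` of clauses, the trade-off parameters `s` and `w`, and `⌈1/δ⌉`. -/
inductive Param where
  | length
  | alphabet
  | clauses
  | s
  | w
  | invError

/-- Arithmetic operations on natural numbers. `sub` is truncated subtraction, `lt` is `0` or
`1`, and division by `0` gives `0`. -/
inductive BinOp where
  | add
  | sub
  | mul
  | div
  | mod
  | lt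

/-- The meaning of the arithmetic operations. -/
def BinOp.value : BinOp → ℕ → ℕ → ℕ
  | .add, a, b => a + b
  | .sub, a, b => a - b
  | .mul, a, b => a * b
  | .div, a, b => a / b
  | .mod, a, b => a % b
  | .lt, a, b => if a < b then 1 else 0

/-- Expressions: constants, parameters, memory access, arithmetic, and queries to the oracles. -/
inductive Exp where
  | const (v : ℕ)
  | param (p : Param)
  | load (addr : Exp)
  | op (o : BinOp) (e₁ e₂ : Exp)
  | common (i : Exp)
  | literal (t i : Exp)
  | psiPos (x : Exp)
  | psiNeg (x : Exp)

/-- What a program can query without having to store it. -/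
structure Env where
  /-- numerical parameters -/
  param : Param → ℕ
  /-- the `i`-th bit of the common random string -/
  common : ℕ → ℕ
  /-- the code of the `i`-th literal of the `t`-th clause -/
  literal : ℕ → ℕ → ℕ
  /-- the value of `ψ` at the point whose coordinates are the binary digits of the argument -/
  psi : ℕ → ℤ

/-- Memory: finitely many cells are nonzero. -/
abbrev Mem := ℕ →₀ ℕ

/-- The number of bits in memory: each nonzero cell is charged for its address and content. -/
def Mem.bits (μ : Mem) : ℕ := μ.sum fun a v => Nat.size a + Nat.size v

/-- The value of an expression. -/
def Exp.value (E : Env) (μ : Mem) : Exp → ℕ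
  | .const v => v
  | .param p => E.param p
  | .load a => μ (a.value E μ)
  | .op o e₁ e₂ => o.value (e₁.value E μ) (e₂.value E μ)
  | .common i => E.common (i.value E μ)
  | .literal t i => E.literal (t.value E μ) (i.value E μ)
  | .psiPos x => (E.psi (x.value E μ)).toNat
  | .psiNeg x => (-E.psi (x.value E μ)).toNat

/-- The scratch space charged for evaluating an expression: the bit lengths of the values of all
its subexpressions (itself included). -/
def Exp.bits (E : Env) (μ : Mem) : Exp → ℕ
  | .const v => Nat.size v
  | .param p => Nat.size (E.param p)
  | .load a => a.bits E μ + Nat.size (Exp.value E μ (.load a))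
  | .op o e₁ e₂ => e₁.bits E μ + e₂.bits E μ + Nat.size (Exp.value E μ (.op o e₁ e₂))
  | .common i => i.bits E μ + Nat.size (Exp.value E μ (.common i))
  | .literal t i => t.bits E μ + i.bits E μ + Nat.size (Exp.value E μ (.literal t i))
  | .psiPos x => x.bits E μ + Nat.size (Exp.value E μ (.psiPos x))
  | .psiNeg x => x.bits E μ + Nat.size (Exp.value E μ (.psiNeg x))

/-- Programs. -/
inductive Prog where
  | skip
  /-- write the value of the second expression to the address given by the first -/
  | store (addr val : Exp)
  /-- read the next symbol of the input stream into a cell -/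
  | readInput (addr : Exp)
  /-- read the next bit of the proof stream into a cell -/
  | readProof (addr : Exp)
  /-- toss a private coin into a cell -/
  | toss (addr : Exp)
  | seq (c₁ c₂ : Prog)
  /-- a condition is true when it is nonzero -/
  | ite (b : Exp) (c₁ c₂ : Prog)
  | loop (b : Exp) (c : Prog)

/-- A machine state: memory, and the unread parts of the input stream, of the proof stream and of
the private random coins. -/
structure State where
  mem : Mem
  input : List ℕ
  proof : List Bool
  coins : List Bool

/-- Write `v` to the memory cell `a`. -/
noncomputable def State.write (st : State) (a v : ℕ) : State :=
  { st with mem := Finsupp.update st.mem a v }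

/-- The result of reading an input stream: `0` at its end, and otherwise its first element (the
elements are coded by `1, …, n`). -/
def inputSymbol : List ℕ → ℕ
  | [] => 0
  | a :: _ => a

/-- The result of reading a proof stream: `0` at its end, and otherwise `1` plus its first bit. -/
def proofSymbol : List Bool → ℕ
  | [] => 0
  | b :: _ => 1 + b.toNat

/-- `Runs E S c st st'`: the program `c`, started in `st`, halts in `st'`, and throughout the run
memory and scratch space together never exceed `S` bits. The coins in a state are all that may be
tossed: a further toss is not possible. -/
inductive Runs (E : Env) (S : ℕ) : Prog → State → State → Prop
  | skip (st : State) (h : st.mem.bits ≤ S) : Runs E S .skip st st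
  | store (a e : Exp) (st st' : State)
      (h : st.mem.bits + a.bits E st.mem + e.bits E st.mem ≤ S)
      (hst : st' = st.write (a.value E st.mem) (e.value E st.mem)) (h' : st'.mem.bits ≤ S) :
      Runs E S (.store a e) st st'
  | readInput (a : Exp) (st st' : State)
      (h : st.mem.bits + a.bits E st.mem + Nat.size (inputSymbol st.input) ≤ S)
      (hst : st' =
        { st.write (a.value E st.mem) (inputSymbol st.input) with input := st.input.tail })
      (h' : st'.mem.bits ≤ S) :
      Runs E S (.readInput a) st st'
  | readProof (a : Exp) (st st' : State)
      (h : st.mem.bits + a.bits E st.mem + Nat.size (proofSymbol st.proof) ≤ S)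
      (hst : st' =
        { st.write (a.value E st.mem) (proofSymbol st.proof) with proof := st.proof.tail })
      (h' : st'.mem.bits ≤ S) :
      Runs E S (.readProof a) st st'
  | toss (a : Exp) (b : Bool) (l : List Bool) (st st' : State) (hc : st.coins = b :: l)
      (h : st.mem.bits + a.bits E st.mem + Nat.size b.toNat ≤ S)
      (hst : st' = { st.write (a.value E st.mem) b.toNat with coins := l })
      (h' : st'.mem.bits ≤ S) :
      Runs E S (.toss a) st st'
  | seq (c₁ c₂ : Prog) (st st₁ st₂ : State) (h₁ : Runs E S c₁ st st₁)
      (h₂ : Runs E S c₂ st₁ st₂) : Runs E S (.seq c₁ c₂) st st₂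
  | iteTrue (b : Exp) (c₁ c₂ : Prog) (st st' : State) (h : st.mem.bits + b.bits E st.mem ≤ S)
      (hb : b.value E st.mem ≠ 0) (h₁ : Runs E S c₁ st st') : Runs E S (.ite b c₁ c₂) st st'
  | iteFalse (b : Exp) (c₁ c₂ : Prog) (st st' : State) (h : st.mem.bits + b.bits E st.mem ≤ S)
      (hb : b.value E st.mem = 0) (h₂ : Runs E S c₂ st st') : Runs E S (.ite b c₁ c₂) st st'
  | loopTrue (b : Exp) (c : Prog) (st st₁ st₂ : State) (h : st.mem.bits + b.bits E st.mem ≤ S)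
      (hb : b.value E st.mem ≠ 0) (h₁ : Runs E S c st st₁)
      (h₂ : Runs E S (.loop b c) st₁ st₂) : Runs E S (.loop b c) st st₂
  | loopFalse (b : Exp) (c : Prog) (st : State) (h : st.mem.bits + b.bits E st.mem ≤ S)
      (hb : b.value E st.mem = 0) : Runs E S (.loop b c) st st

/-- The output in a halting state: `⊥` (here `none`) if cell `0` holds `0`, and otherwise the
rational number `(u - v) / (d + 1)`, where `u`, `v`, `d` are the contents of cells `1`, `2`, `3`. -/
def State.output (st : State) : Option ℚ :=
  if st.mem 0 = 0 then none
  else some ((((st.mem 1 : ℕ) : ℚ) - ((st.mem 2 : ℕ) : ℚ)) / (((st.mem 3 : ℕ) : ℚ) + 1))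

/-! ### The environment and the initial state of a verifier -/

/-- The code of a literal. -/
def Literal.code {m : ℕ} : Literal m → ℕ
  | .const false => 0
  | .const true => 1
  | .pos j => 2 * (j : ℕ) + 2
  | .neg j => 2 * (j : ℕ) + 3

/-- The parameters given to the verifier. -/
noncomputable def params (m n k s w : ℕ) (δ : ℝ) : Param → ℕ
  | .length => m
  | .alphabet => n
  | .clauses => k
  | .s => s
  | .w => w
  | .invError => ⌈1 / δ⌉₊

/-- The environment of a verifier that knows the parameters `p`, the clauses `C` and the function
`ψ`, with common random string `r`. Clauses, literals and bits are numbered from `0`, and queries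
out of range return `0`. -/
def env {m k ρ : ℕ} (p : Param → ℕ) (C : Fin k → Clause m) (ψ : (Fin k → Bool) → ℤ)
    (r : Fin ρ → Bool) : Env where
  param := p
  common i := if h : i < ρ then (r ⟨i, h⟩).toNat else 0
  literal t i :=
    if ht : t < k then if hi : i < m then (C ⟨t, ht⟩ ⟨i, hi⟩).code else 0 else 0
  psi x := ψ fun t => x.testBit t

/-- The initial state: empty memory, the input stream `σ`, the proof stream `ω`, private coins
`coins`. -/
noncomputable def start {m n c : ℕ} (σ : Stream m n) (ω : List Bool) (coins : Fin c → Bool) :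
    State where
  mem := 0
  input := List.ofFn fun i => (σ i : ℕ) + 1
  proof := ω
  coins := List.ofFn coins

/-! ### AM streaming algorithms -/

/-- The probability of an event under the uniform distribution on a finite type. -/
noncomputable def prob {α : Type} [Fintype α] (A : α → Prop) : ℝ :=
  (Set.ncard {a | A a} : ℝ) / (Fintype.card α : ℝ)

/-- A verifier: a program, and the numbers of common random bits and of private coins it uses. -/
structure Verifier where
  prog : Prog
  commonBits : (Param → ℕ) → ℕ
  privateBits : (Param → ℕ) → ℕ

/-- The randomness complexity of a verifier. -/
def Verifier.randomness (V : Verifier) (p : Param → ℕ) : ℕ := V.commonBits p + V.privateBits p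

/-- `V`, run with parameters `p`, clauses `C` and function `ψ`, outputs `o` on input stream `σ`,
proof stream `ω`, common random string `r` and private coins `c`, within space `S`. -/
def Verifier.Outputs {m n k : ℕ} (V : Verifier) (p : Param → ℕ) (C : Fin k → Clause m)
    (ψ : (Fin k → Bool) → ℤ) (S : ℕ) (σ : Stream m n) (ω : List Bool)
    (r : Fin (V.commonBits p) → Bool) (c : Fin (V.privateBits p) → Bool) (o : Option ℚ) : Prop :=
  ∃ st : State, Runs (env p C ψ r) S V.prog (start σ ω c) st ∧ st.output = o

/-- `V` is an `AM_{ε,δ}(S, W)` streaming algorithm for `f` on streams of length `m` over `[n]`. -/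
structure Verifier.IsAM {m n k : ℕ} (V : Verifier) (p : Param → ℕ) (C : Fin k → Clause m)
    (ψ : (Fin k → Bool) → ℤ) (f : Stream m n → ℝ) (ε δ : ℝ) (S W : ℕ) : Prop where
  /-- On all inputs, proofs and random choices the algorithm halts and uses at most `S` bits. -/
  space : ∀ (σ : Stream m n) ω r c, ∃ o, V.Outputs p C ψ S σ ω r c o
  /-- For every stream, with probability at least `1 - δ/2` over the common random string, there
  is a nonempty set of proofs of length at most `W` that satisfies completeness and soundness. -/
  correct : ∀ σ : Stream m n, 1 - δ / 2 ≤ prob fun r =>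
    ∃ Ω : Set (List Bool), Ω.Nonempty ∧ (∀ ω ∈ Ω, ω.length ≤ W) ∧
      (∀ ω ∈ Ω, 1 - δ / 2 < prob fun c =>
        ∃ v : ℚ, V.Outputs p C ψ S σ ω r c (some v) ∧ |(v : ℝ) - f σ| ≤ ε * |f σ|) ∧
      (∀ ω, ω ∉ Ω → 1 - δ / 2 < prob fun c => V.Outputs p C ψ S σ ω r c none)

/-- The polylogarithmic quantity `K · log(m + n + 1/δ) ^ K`. -/
noncomputable def polylog (K m n : ℕ) (δ : ℝ) : ℝ :=
  (K : ℝ) * Real.log ((m : ℝ) + (n : ℝ) + 1 / δ) ^ K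

end AMStream

/-! The theorem is proved by algebraization with a verifier that keeps its point of evaluation
secret. Put letter `j` into column `j % s'` and row `j / s'` of a grid with `s' = min s n` columns
and `n / s' + 1` rows. Over a prime field, replace the indicator of a row by its Lagrange basis
polynomial. Inside each column the summand becomes a polynomial in the row variable, and adding the
columns gives one univariate polynomial `Grid.total` whose values at the row numbers add up to the
required sum over the alphabet (`sum_eval_total`). The proof stream lists the coefficients of this
polynomial. While reading it, the verifier accumulates its value at a secret random point `z` and
the sum of its values at the rows. The value of the true polynomial at `z` comes from the input
stream, through accumulators that are linear in the arriving letters (`Grid.eval_count_eq`). A wrong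
polynomial agrees with the true one at few points (`card_eval_eq_le`).

A clause is a disjunction of `m` literals, and its exact arithmetization would have degree about `m`
times the number of rows. The common random string lowers this degree. It provides
polylogarithmically many tests, each selecting the positions that lie in random affine hyperplanes
over the field with two elements. By a second moment argument (`card_not_isolates_le`), a nonempty
set of satisfied positions meets some test in exactly one element, with high probability. The
product over the tests of one minus the number of selected satisfied literals is then `0` for a
satisfied clause and `1` for an unsatisfied one (`eval_clauseNot`). With `k` clauses the degree is
about `k` times the number of rows, up to polylogarithmic factors. There is one accumulator for
every column, clause and test, hence about `s * k` of them.

The prime exceeds a fixed power of the input size, which makes the error of the random point small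
and lets the integer answer be recovered from its residue (`signedLift_val`). The union bound over
the clauses needs `k` to be at most polynomial in the input size. If `k ≥ m`, the stream itself fits
into the space bound, and a deterministic verifier stores it and accepts only the empty proof.

The machine model charges every bit, scratch space included. Programs are therefore assembled from a
term language whose loops reduce modulo a given number at every step. A fixed compiler
(`Room.runs_compile`) turns bounds on bit lengths into space bounds. The two protocols are verified
with Hoare triples over abstract configurations (`Setting.randomized`, `Setting.deterministic`), and
`exists_isAM` combines execution with probability. -/

namespace AMStream

/-! ### Bit lengths -/

theorem size_mul_le (a b : ℕ) : Nat.size (a * b) ≤ Nat.size a + Nat.size b := by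
  rw [Nat.size_le, pow_add]
  exact Nat.mul_lt_mul'' (Nat.lt_size_self a) (Nat.lt_size_self b)

theorem size_add_le (a b : ℕ) : Nat.size (a + b) ≤ Nat.size a + Nat.size b + 1 := by
  rw [Nat.size_le, pow_succ, pow_add]
  have ha := Nat.lt_size_self a
  have hb := Nat.lt_size_self b
  nlinarith [Nat.one_le_two_pow (n := Nat.size a), Nat.one_le_two_pow (n := Nat.size b)]

theorem size_one_eq : Nat.size 1 = 1 := Nat.size_one

theorem BinOp.size_value_le (o : BinOp) (a b : ℕ) :
    Nat.size (o.value a b) ≤ Nat.size a + Nat.size b + 1 := by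
  cases o with
  | add => exact size_add_le a b
  | sub => exact (Nat.size_le_size (Nat.sub_le a b)).trans (by omega)
  | mul => exact (size_mul_le a b).trans (by omega)
  | div => exact (Nat.size_le_size (Nat.div_le_self a b)).trans (by omega)
  | mod => exact (Nat.size_le_size (Nat.mod_le a b)).trans (by omega)
  | lt =>
    refine (Nat.size_le_size (n := 1) ?_).trans (by rw [size_one_eq]; omega)
    simp only [BinOp.value]; split_ifs <;> omega

/-! ### A term language with modular sums and products -/

/-- Terms over variables and one array. `fold o v q x N b` starts with `v` and, for
`x = 0, …, N - 1`, combines the accumulator with `b` by `o`; all results are reduced modulo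
`max q 1`. -/
inductive Term where
  | const (v : ℕ)
  | var (x : ℕ)
  | param (p : Param) (h : p ≠ .w)
  | arr (i : Term)
  | op (o : BinOp) (a b : Term)
  | common (i : Term)
  | literal (t i : Term)
  | psiPos (x : Term)
  | psiNeg (x : Term)
  | fold (o : BinOp) (v : ℕ) (q : Term) (x : ℕ) (N b : Term)

/-- The value of a modular fold. -/
def foldVal (o : BinOp) (v q : ℕ) (f : ℕ → ℕ) : ℕ → ℕ
  | 0 => v % (q - 1 + 1)
  | j + 1 => o.value (foldVal o v q f j) (f j) % (q - 1 + 1)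

/-- With truncated subtraction `q - 1 + 1` is the larger of `q` and `1`, so the modulus is positive
even for `q = 0`. -/
theorem foldVal_lt (o : BinOp) (v q : ℕ) (f : ℕ → ℕ) (j : ℕ) : foldVal o v q f j < q - 1 + 1 := by
  cases j <;> exact Nat.mod_lt _ (Nat.succ_pos _)

/-- The cell of a variable. -/
abbrev varCell (x : ℕ) : ℕ := 3 * x + 4
/-- The cell of an intermediate result. -/
abbrev tmpCell (d : ℕ) : ℕ := 3 * d + 5
/-- The cell of an array entry. -/
abbrev arrCell (i : ℕ) : ℕ := 3 * i + 6

/-- Reading a fixed cell. -/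
abbrev cell (a : ℕ) : Exp := .load (.const a)

namespace Term

/-- The value of a term. -/
def eval (E : Env) (A : ℕ → ℕ) : Term → (ℕ → ℕ) → ℕ
  | const v, _ => v
  | var x, ρ => ρ x
  | param p _, _ => E.param p
  | arr i, ρ => A (eval E A i ρ)
  | op o a b, ρ => o.value (eval E A a ρ) (eval E A b ρ)
  | common i, ρ => E.common (eval E A i ρ)
  | literal t i, ρ => E.literal (eval E A t ρ) (eval E A i ρ)
  | psiPos x, ρ => (E.psi (eval E A x ρ)).toNat
  | psiNeg x, ρ => (-E.psi (eval E A x ρ)).toNat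
  | fold o v q x N b, ρ =>
    foldVal o v (eval E A q ρ) (fun j => eval E A b (Function.update ρ x j)) (eval E A N ρ)

/-- A program that computes a term into the cell `tmpCell d` and restores all cells other than
the cells `tmpCell d'` with `d ≤ d'`. -/
def compile : Term → ℕ → Prog
  | const v, d => .store (.const (tmpCell d)) (.const v)
  | var x, d => .store (.const (tmpCell d)) (cell (varCell x))
  | param p _, d => .store (.const (tmpCell d)) (.param p)
  | arr i, d => .seq (compile i d) (.store (.const (tmpCell d))
      (.load (.op .add (.op .mul (.const 3) (cell (tmpCell d))) (.const 6))))
  | op o a b, d => .seq (compile a d) (.seq (compile b (d + 1))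
      (.store (.const (tmpCell d)) (.op o (cell (tmpCell d)) (cell (tmpCell (d + 1))))))
  | common i, d => .seq (compile i d)
      (.store (.const (tmpCell d)) (.common (cell (tmpCell d))))
  | literal t i, d => .seq (compile t d) (.seq (compile i (d + 1))
      (.store (.const (tmpCell d)) (.literal (cell (tmpCell d)) (cell (tmpCell (d + 1))))))
  | psiPos x, d => .seq (compile x d)
      (.store (.const (tmpCell d)) (.psiPos (cell (tmpCell d))))
  | psiNeg x, d => .seq (compile x d)
      (.store (.const (tmpCell d)) (.psiNeg (cell (tmpCell d))))
  | fold o v q x N b, d =>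
    .seq (compile q d) <|
    .seq (.store (.const (tmpCell d))
      (.op .add (.op .sub (cell (tmpCell d)) (.const 1)) (.const 1))) <|
    .seq (compile N (d + 1)) <|
    .seq (.store (.const (tmpCell (d + 2))) (cell (varCell x))) <|
    .seq (.store (.const (tmpCell (d + 3))) (.op .mod (.const v) (cell (tmpCell d)))) <|
    .seq (.store (.const (varCell x)) (.const 0)) <|
    .seq (.loop (.op .lt (cell (varCell x)) (cell (tmpCell (d + 1)))) <|
      .seq (compile b (d + 4)) <|
      .seq (.store (.const (tmpCell (d + 3)))
        (.op .mod (.op o (cell (tmpCell (d + 3))) (cell (tmpCell (d + 4)))) (cell (tmpCell d)))) <|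
      .store (.const (varCell x)) (.op .add (cell (varCell x)) (.const 1))) <|
    .seq (.store (.const (varCell x)) (cell (tmpCell (d + 2)))) <|
    .store (.const (tmpCell d)) (cell (tmpCell (d + 3)))

/-- A strict upper bound for the fixed cells that `compile` uses. -/
def top : Term → ℕ → ℕ
  | const _, d => 3 * d + 6
  | var x, d => max (3 * x + 5) (3 * d + 6)
  | param _ _, d => 3 * d + 6
  | arr i, d => i.top d
  | op _ a b, d => max (a.top d) (b.top (d + 1))
  | common i, d => i.top d
  | literal t i, d => max (t.top d) (i.top (d + 1))
  | psiPos x, d => x.top d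
  | psiNeg x, d => x.top d
  | fold _ _ q x N b, d => max (max (q.top d) (N.top (d + 1))) (max (b.top (d + 4)) (3 * x + 5))

/-- Every compiled term writes its result to `tmpCell d`, whose successor is `3 * d + 6`. -/
theorem le_top (T : Term) : ∀ d, 3 * d + 6 ≤ T.top d := by
  induction T with
  | const | param => intro d; simp [top]
  | var x => intro d; simp [top]
  | arr i ih | common i ih | psiPos i ih | psiNeg i ih => intro d; exact ih d
  | op o a b iha ihb | literal a b iha ihb => intro d; exact (iha d).trans (le_max_left _ _)
  | fold o v q x N b ihq ihN ihb =>
    intro d; exact (ihq d).trans ((le_max_left _ _).trans (le_max_left _ _))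

/-- The weight of a term: the factor between the bit lengths of what it depends on and the bit
lengths of its intermediate results. -/
def wt : Term → ℕ
  | const v => Nat.size v + 1
  | var _ => 1
  | param _ _ => 1
  | arr i => i.wt + 1
  | op _ a b => a.wt + b.wt + 1
  | common i => i.wt + 1
  | literal t i => t.wt + i.wt + 1
  | psiPos x => x.wt + 1
  | psiNeg x => x.wt + 1
  | fold _ v q _ N b => q.wt + N.wt * (b.wt + 1) + Nat.size v + 1

theorem wt_pos (T : Term) : 1 ≤ T.wt := by cases T <;> simp [wt]

end Term

/-- The parameters other than `w`, and the results of all queries, have bit length at most `g`. -/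
structure Env.Le (E : Env) (g : ℕ) : Prop where
  param : ∀ p, p ≠ .w → Nat.size (E.param p) ≤ g
  common : ∀ i, Nat.size (E.common i) ≤ g
  literal : ∀ t i, Nat.size (E.literal t i) ≤ g
  psiPos : ∀ x, Nat.size (E.psi x).toNat ≤ g
  psiNeg : ∀ x, Nat.size (-E.psi x).toNat ≤ g

theorem Env.Le.mono {E : Env} {g g' : ℕ} (h : E.Le g) (hg : g ≤ g') : E.Le g' :=
  ⟨fun p hp => (h.param p hp).trans hg, fun i => (h.common i).trans hg,
    fun t i => (h.literal t i).trans hg, fun x => (h.psiPos x).trans hg,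
    fun x => (h.psiNeg x).trans hg⟩

/-- Reduction after every step keeps the accumulator no longer than the modulus, however many
iterations there are. This is why sums over exponentially many points cost little space. -/
theorem size_foldVal_le (o : BinOp) (v q : ℕ) (f : ℕ → ℕ) (j : ℕ) :
    Nat.size (foldVal o v q f j) ≤ Nat.size q + 1 := by
  refine (Nat.size_le_size (foldVal_lt o v q f j).le).trans ?_
  rcases Nat.eq_zero_or_pos q with rfl | hq
  · simp
  · rw [Nat.sub_add_cancel hq]; omega

theorem size_update_le {ρ : ℕ → ℕ} {g : ℕ} (hρ : ∀ x, Nat.size (ρ x) ≤ g) {x v : ℕ}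
    (hv : Nat.size v ≤ g) (y : ℕ) : Nat.size (Function.update ρ x v y) ≤ g := by
  by_cases h : y = x
  · subst h; simpa using hv
  · simpa [Function.update_of_ne h] using hρ y

/-- Weights add up along arithmetic operations, while query results are bounded by `g` outright. The
value of a fold is bounded by its modulus, whatever the body. -/
theorem Term.size_eval_le {E : Env} {A : ℕ → ℕ} (T : Term) : ∀ {g : ℕ} {ρ : ℕ → ℕ}, 1 ≤ g → E.Le g →
    (∀ i, Nat.size (A i) ≤ g) → (∀ x, Nat.size (ρ x) ≤ g) → Nat.size (T.eval E A ρ) ≤ T.wt * g := by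
  induction T with
  | const v => intro g ρ hg hE hA hρ; simp only [eval, wt]; nlinarith
  | var x => intro g ρ hg hE hA hρ; simpa [eval, wt] using hρ x
  | param p h => intro g ρ hg hE hA hρ; simpa [eval, wt] using hE.param p h
  | arr i ih => intro g ρ hg hE hA hρ; have := hA (i.eval E A ρ); simp only [eval, wt]; nlinarith
  | op o a b iha ihb =>
    intro g ρ hg hE hA hρ
    have h1 := iha hg hE hA hρ
    have h2 := ihb hg hE hA hρ
    have := o.size_value_le (a.eval E A ρ) (b.eval E A ρ)
    simp only [eval, wt]; nlinarith
  | common i ih =>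
    intro g ρ hg hE hA hρ; have := hE.common (i.eval E A ρ); simp only [eval, wt]; nlinarith
  | literal t i _ _ =>
    intro g ρ hg hE hA hρ
    have := hE.literal (t.eval E A ρ) (i.eval E A ρ); simp only [eval, wt]; nlinarith
  | psiPos i ih =>
    intro g ρ hg hE hA hρ; have := hE.psiPos (i.eval E A ρ); simp only [eval, wt]; nlinarith
  | psiNeg i ih =>
    intro g ρ hg hE hA hρ; have := hE.psiNeg (i.eval E A ρ); simp only [eval, wt]; nlinarith
  | fold o v q x N b ihq ihN ihb =>
    intro g ρ hg hE hA hρ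
    have h1 := ihq hg hE hA hρ
    have := size_foldVal_le o v (q.eval E A ρ)
      (fun j => eval E A b (Function.update ρ x j)) (N.eval E A ρ)
    simp only [eval, wt]
    nlinarith [Nat.zero_le (N.wt * (b.wt + 1)), Nat.zero_le (v.size)]

/-! ### Space -/

/-- Every cell `a` holds a value of bit length at most `f a`. -/
def Fit (f : ℕ → ℕ) (μ : Mem) : Prop := ∀ a, Nat.size (μ a) ≤ f a

/-- Within `S` bits there is room for a memory of profile `f`, in which the cells below `Z` may
hold values of bit length `γ`, together with scratch space for any constant-size expression. -/
structure Room (S Z γ : ℕ) (f : ℕ → ℕ) : Prop where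
  bits : ∀ μ : Mem, Fit f μ → μ.bits + (20 * γ + 20) ≤ S
  low : ∀ a, a < Z → γ ≤ f a
  addr : Nat.size Z ≤ γ

theorem Fit.update {f : ℕ → ℕ} {μ : Mem} (h : Fit f μ) {a v : ℕ} (hv : Nat.size v ≤ f a) :
    Fit f (μ.update a v) := by
  intro b
  by_cases hb : b = a
  · subst hb; simpa using hv
  · rw [Finsupp.coe_update, Function.update_of_ne hb]; exact h b

theorem update_same (μ : Mem) (a v : ℕ) : (μ.update a v) a = v := by simp

theorem update_ne (μ : Mem) {a b : ℕ} (v : ℕ) (h : b ≠ a) : (μ.update a v) b = μ b := by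
  rw [Finsupp.coe_update, Function.update_of_ne h]

/-! ### Execution of compiled terms within a space bound -/

section
variable {E : Env} {S Z γ : ℕ} {f : ℕ → ℕ}

theorem Room.size_addr (hR : Room S Z γ f) {a : ℕ} (ha : a < Z) : Nat.size a ≤ γ :=
  (Nat.size_le_size ha.le).trans hR.addr

/-- `Room` reserves `20 * γ + 20` bits of scratch. The address takes at most `γ` of them and leaves
`19 * γ + 20` for the expression. -/
theorem Room.runs_store (hR : Room S Z γ f) {μ : Mem} (hμ : Fit f μ) {a v : ℕ} {e : Exp}
    (ha : a < Z) (hv : e.value E μ = v) (hvs : Nat.size v ≤ γ)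
    (he : e.bits E μ ≤ 19 * γ + 20) (i : List ℕ) (p c : List Bool) :
    Runs E S (.store (.const a) e) ⟨μ, i, p, c⟩ ⟨μ.update a v, i, p, c⟩ ∧
      Fit f (μ.update a v) := by
  have hfit : Fit f (μ.update a v) := hμ.update (hvs.trans (hR.low a ha))
  refine ⟨.store _ _ _ _ ?_ ?_ ?_, hfit⟩
  · have h1 := hR.bits μ hμ
    have h2 := hR.size_addr ha
    simp only [Exp.bits]; omega
  · simp [State.write, Exp.value, hv]
  · have h1 := hR.bits _ hfit
    simp only; omega

/-- Time is free, so an invariant indexed by the number of completed rounds suffices. The induction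
is on the number of rounds that remain. -/
theorem runs_loop {b : Exp} {c : Prog} {N : ℕ} (I : ℕ → State → Prop)
    (hb : ∀ j ≤ N, ∀ st, I j st → st.mem.bits + b.bits E st.mem ≤ S ∧
      (b.value E st.mem ≠ 0 ↔ j < N))
    (hc : ∀ j < N, ∀ st, I j st → ∃ st', Runs E S c st st' ∧ I (j + 1) st') :
    ∀ st, I 0 st → ∃ st', Runs E S (.loop b c) st st' ∧ I N st' := by
  have key : ∀ i j, i + j = N → ∀ st, I j st →
      ∃ st', Runs E S (.loop b c) st st' ∧ I N st' := by
    intro i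
    induction i with
    | zero =>
      intro j hj st hst
      obtain rfl : j = N := by omega
      obtain ⟨h1, h2⟩ := hb j le_rfl st hst
      exact ⟨st, .loopFalse _ _ _ h1 (by_contra fun h => absurd (h2.1 h) (lt_irrefl _)), hst⟩
    | succ i ih =>
      intro j hj st hst
      obtain ⟨h1, h2⟩ := hb j (by omega) st hst
      obtain ⟨st1, hr, h3⟩ := hc j (by omega) st hst
      obtain ⟨st2, hr2, h4⟩ := ih (j + 1) (by omega) st1 h3
      exact ⟨st2, .loopTrue _ _ _ _ _ h1 (h2.2 (by omega)) hr hr2, h4⟩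
  exact key N 0 (by omega)

theorem bits_cell (E : Env) (μ : Mem) (a : ℕ) :
    (cell a).bits E μ = Nat.size a + Nat.size (μ a) := rfl

theorem value_cell (E : Env) (μ : Mem) (a : ℕ) : (cell a).value E μ = μ a := rfl

theorem BinOp.bits_op (E : Env) (μ : Mem) (o : BinOp) (e₁ e₂ : Exp) :
    (Exp.op o e₁ e₂).bits E μ ≤ e₁.bits E μ + e₂.bits E μ +
      (Nat.size (e₁.value E μ) + Nat.size (e₂.value E μ) + 1) := by
  have := o.size_value_le (e₁.value E μ) (e₂.value E μ)
  simp only [Exp.bits, Exp.value]; omega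

/-- Running a compiled term. -/
theorem Room.runs_compile (hR : Room S Z γ f) (T : Term) : ∀ (d g : ℕ) (μ : Mem) (ρ A : ℕ → ℕ),
    1 ≤ g → E.Le g → Fit f μ → (∀ x, μ (varCell x) = ρ x) → (∀ i, μ (arrCell i) = A i) →
    (∀ x, Nat.size (ρ x) ≤ g) → (∀ i, Nat.size (A i) ≤ g) → T.wt * g ≤ γ → T.top d ≤ Z →
    ∀ (i : List ℕ) (p c : List Bool),
    ∃ μ', Runs E S (T.compile d) ⟨μ, i, p, c⟩ ⟨μ', i, p, c⟩ ∧ Fit f μ' ∧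
      μ' (tmpCell d) = T.eval E A ρ ∧ ∀ a, (∀ d', d ≤ d' → a ≠ tmpCell d') → μ' a = μ a := by
  induction T with
  | const v =>
    intro d g μ ρ A hg hE hμ hv hA hρg hAg hw ht i p c
    simp only [Term.wt, Term.top] at hw ht
    have hs : Nat.size v ≤ γ := by nlinarith
    obtain ⟨h1, h2⟩ := hR.runs_store (E := E) hμ (a := tmpCell d) (v := v) (e := .const v)
      (by simp only [tmpCell]; omega) rfl hs (by simp only [Exp.bits]; omega) i p c
    exact ⟨_, h1, h2, by simp [Term.eval], fun a ha => update_ne _ _ (ha d le_rfl)⟩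
  | var x =>
    intro d g μ ρ A hg hE hμ hv hA hρg hAg hw ht i p c
    simp only [Term.wt, Term.top] at hw ht
    have hs : Nat.size (ρ x) ≤ γ := (hρg x).trans (by omega)
    have hx : varCell x < Z := by simp only [varCell]; omega
    obtain ⟨h1, h2⟩ := hR.runs_store (E := E) hμ (a := tmpCell d) (v := ρ x) (e := cell (varCell x))
      (by simp only [tmpCell]; omega) (hv x) hs
      (by have := hR.size_addr hx; rw [bits_cell, hv]; omega) i p c
    exact ⟨_, h1, h2, by simp [Term.eval], fun a ha => update_ne _ _ (ha d le_rfl)⟩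
  | param q h =>
    intro d g μ ρ A hg hE hμ hv hA hρg hAg hw ht i p c
    simp only [Term.wt, Term.top] at hw ht
    have hs : Nat.size (E.param q) ≤ γ := (hE.param q h).trans (by omega)
    obtain ⟨h1, h2⟩ := hR.runs_store (E := E) hμ (a := tmpCell d) (v := E.param q) (e := .param q)
      (by simp only [tmpCell]; omega) rfl hs (by simp only [Exp.bits]; omega) i p c
    exact ⟨_, h1, h2, by simp [Term.eval], fun a ha => update_ne _ _ (ha d le_rfl)⟩
  | arr T ih =>
    intro d g μ ρ A hg hE hμ hv hA hρg hAg hw ht i p c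
    have hwT : T.wt * g ≤ γ := le_trans (by simp only [Term.wt]; nlinarith) hw
    have hgγ : g ≤ γ := le_trans (by simp only [Term.wt]; nlinarith) hw
    have htop := T.le_top d
    simp only [Term.top] at ht
    obtain ⟨μ1, r1, f1, e1, k1⟩ := ih d g μ ρ A hg hE hμ hv hA hρg hAg hwT ht i p c
    have hT := (T.size_eval_le hg hE hAg hρg).trans hwT
    have hd : tmpCell d < Z := by simp only [tmpCell]; omega
    -- Array cells are divisible by 3 and temporaries are 2 modulo 3, so computing the index leaves
    -- the array intact.
    have hval : μ1 (3 * T.eval E A ρ + 6) = A (T.eval E A ρ) := by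
      rw [k1 _ (fun d' _ => by simp only [tmpCell]; omega)]; exact hA _
    obtain ⟨h1, h2⟩ := hR.runs_store (E := E) f1 (a := tmpCell d) (v := A (T.eval E A ρ))
      (e := .load (.op .add (.op .mul (.const 3) (cell (tmpCell d))) (.const 6)))
      hd (by simpa [Exp.value, BinOp.value, e1] using hval) ((hAg _).trans hgγ)
      (by
        have h3 := hR.size_addr hd
        have h4 := hAg (T.eval E A ρ)
        have h5 := size_mul_le 3 (T.eval E A ρ)
        have h6 := size_add_le (3 * T.eval E A ρ) 6
        have h7 : Nat.size 3 = 2 := by decide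
        have h8 : Nat.size 6 = 3 := by decide
        simp only [Exp.bits, Exp.value, BinOp.value, e1, hval, h7, h8] at *
        omega) i p c
    exact ⟨_, .seq _ _ _ _ _ r1 h1, h2, by simp [Term.eval], fun a ha => by
      rw [update_ne _ _ (ha d le_rfl), k1 a ha]⟩
  | op o T₁ T₂ ih₁ ih₂ =>
    intro d g μ ρ A hg hE hμ hv hA hρg hAg hw ht i p c
    simp only [Term.top, max_le_iff] at ht
    have hw1 : T₁.wt * g ≤ γ := le_trans (by simp only [Term.wt]; nlinarith) hw
    have hw2 : T₂.wt * g ≤ γ := le_trans (by simp only [Term.wt]; nlinarith) hw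
    have ht1 := T₁.le_top d
    have ht2 := T₂.le_top (d + 1)
    obtain ⟨μ1, r1, f1, e1, k1⟩ := ih₁ d g μ ρ A hg hE hμ hv hA hρg hAg hw1 ht.1 i p c
    obtain ⟨μ2, r2, f2, e2, k2⟩ := ih₂ (d + 1) g μ1 ρ A hg hE f1
      (fun x => by rw [k1 _ (fun d' _ => by simp only [varCell, tmpCell]; omega), hv])
      (fun x => by rw [k1 _ (fun d' _ => by simp only [arrCell, tmpCell]; omega), hA])
      hρg hAg hw2 ht.2 i p c
    have e1' : μ2 (tmpCell d) = T₁.eval E A ρ := by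
      rw [k2 _ (fun d' _ => by simp only [tmpCell]; omega), e1]
    have s1 := (T₁.size_eval_le hg hE hAg hρg).trans hw1
    have s2 := (T₂.size_eval_le hg hE hAg hρg).trans hw2
    have s3 := ((Term.op o T₁ T₂).size_eval_le hg hE hAg hρg).trans hw
    have hd : tmpCell d < Z := by simp only [tmpCell]; omega
    have hd1 : tmpCell (d + 1) < Z := by simp only [tmpCell]; omega
    obtain ⟨h1, h2⟩ := hR.runs_store (E := E) f2 (a := tmpCell d) (v := (Term.op o T₁ T₂).eval E A ρ)
      (e := .op o (cell (tmpCell d)) (cell (tmpCell (d + 1)))) hd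
      (by simp only [Exp.value, e1', e2]; rfl) s3
      (by
        have h3 := hR.size_addr hd
        have h4 := hR.size_addr hd1
        refine (BinOp.bits_op _ _ _ _ _).trans ?_
        rw [bits_cell, bits_cell, value_cell, value_cell, e1', e2]; omega) i p c
    exact ⟨_, .seq _ _ _ _ _ r1 (.seq _ _ _ _ _ r2 h1), h2, by simp, fun a ha => by
      rw [update_ne _ _ (ha d le_rfl), k2 a (fun d' hd' => ha d' (by omega)), k1 a ha]⟩
  | common T ih =>
    intro d g μ ρ A hg hE hμ hv hA hρg hAg hw ht i p c
    have hwT : T.wt * g ≤ γ := le_trans (by simp only [Term.wt]; nlinarith) hw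
    have hgγ : g ≤ γ := le_trans (by simp only [Term.wt]; nlinarith) hw
    have htop := T.le_top d
    simp only [Term.top] at ht
    obtain ⟨μ1, r1, f1, e1, k1⟩ := ih d g μ ρ A hg hE hμ hv hA hρg hAg hwT ht i p c
    have hT := (T.size_eval_le hg hE hAg hρg).trans hwT
    have hd : tmpCell d < Z := by simp only [tmpCell]; omega
    have hs := (hE.common (T.eval E A ρ)).trans hgγ
    obtain ⟨h1, h2⟩ := hR.runs_store (E := E) f1 (a := tmpCell d) (v := (Term.common T).eval E A ρ)
      (e := .common (cell (tmpCell d))) hd (by simp [Exp.value, Term.eval, e1]) hs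
      (by
        have h3 := hR.size_addr hd
        simp only [Exp.bits, Exp.value, e1]; omega) i p c
    exact ⟨_, .seq _ _ _ _ _ r1 h1, h2, by simp, fun a ha => by
      rw [update_ne _ _ (ha d le_rfl), k1 a ha]⟩
  | literal T₁ T₂ ih₁ ih₂ =>
    intro d g μ ρ A hg hE hμ hv hA hρg hAg hw ht i p c
    simp only [Term.top, max_le_iff] at ht
    have hw1 : T₁.wt * g ≤ γ := le_trans (by simp only [Term.wt]; nlinarith) hw
    have hw2 : T₂.wt * g ≤ γ := le_trans (by simp only [Term.wt]; nlinarith) hw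
    have ht1 := T₁.le_top d
    have ht2 := T₂.le_top (d + 1)
    obtain ⟨μ1, r1, f1, e1, k1⟩ := ih₁ d g μ ρ A hg hE hμ hv hA hρg hAg hw1 ht.1 i p c
    obtain ⟨μ2, r2, f2, e2, k2⟩ := ih₂ (d + 1) g μ1 ρ A hg hE f1
      (fun x => by rw [k1 _ (fun d' _ => by simp only [varCell, tmpCell]; omega), hv])
      (fun x => by rw [k1 _ (fun d' _ => by simp only [arrCell, tmpCell]; omega), hA])
      hρg hAg hw2 ht.2 i p c
    have e1' : μ2 (tmpCell d) = T₁.eval E A ρ := by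
      rw [k2 _ (fun d' _ => by simp only [tmpCell]; omega), e1]
    have s1 := (T₁.size_eval_le hg hE hAg hρg).trans hw1
    have s2 := (T₂.size_eval_le hg hE hAg hρg).trans hw2
    have s3 := ((Term.literal T₁ T₂).size_eval_le hg hE hAg hρg).trans hw
    have hd : tmpCell d < Z := by simp only [tmpCell]; omega
    have hd1 : tmpCell (d + 1) < Z := by simp only [tmpCell]; omega
    obtain ⟨h1, h2⟩ := hR.runs_store (E := E) f2 (a := tmpCell d)
      (v := (Term.literal T₁ T₂).eval E A ρ)
      (e := .literal (cell (tmpCell d)) (cell (tmpCell (d + 1)))) hd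
      (by simp only [Exp.value, e1', e2]; rfl) s3
      (by
        have h3 := hR.size_addr hd
        have h4 := hR.size_addr hd1
        simp only [Term.eval] at s3
        simp only [Exp.bits, Exp.value, e1', e2]; omega) i p c
    exact ⟨_, .seq _ _ _ _ _ r1 (.seq _ _ _ _ _ r2 h1), h2, by simp, fun a ha => by
      rw [update_ne _ _ (ha d le_rfl), k2 a (fun d' hd' => ha d' (by omega)), k1 a ha]⟩
  | psiPos T ih =>
    intro d g μ ρ A hg hE hμ hv hA hρg hAg hw ht i p c
    have hwT : T.wt * g ≤ γ := le_trans (by simp only [Term.wt]; nlinarith) hw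
    have hgγ : g ≤ γ := le_trans (by simp only [Term.wt]; nlinarith) hw
    have htop := T.le_top d
    simp only [Term.top] at ht
    obtain ⟨μ1, r1, f1, e1, k1⟩ := ih d g μ ρ A hg hE hμ hv hA hρg hAg hwT ht i p c
    have hT := (T.size_eval_le hg hE hAg hρg).trans hwT
    have hd : tmpCell d < Z := by simp only [tmpCell]; omega
    have hs := (hE.psiPos (T.eval E A ρ)).trans hgγ
    obtain ⟨h1, h2⟩ := hR.runs_store (E := E) f1 (a := tmpCell d) (v := (Term.psiPos T).eval E A ρ)
      (e := .psiPos (cell (tmpCell d))) hd (by simp [Exp.value, Term.eval, e1]) hs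
      (by
        have h3 := hR.size_addr hd
        simp only [Exp.bits, Exp.value, e1]; omega) i p c
    exact ⟨_, .seq _ _ _ _ _ r1 h1, h2, by simp, fun a ha => by
      rw [update_ne _ _ (ha d le_rfl), k1 a ha]⟩
  | psiNeg T ih =>
    intro d g μ ρ A hg hE hμ hv hA hρg hAg hw ht i p c
    have hwT : T.wt * g ≤ γ := le_trans (by simp only [Term.wt]; nlinarith) hw
    have hgγ : g ≤ γ := le_trans (by simp only [Term.wt]; nlinarith) hw
    have htop := T.le_top d
    simp only [Term.top] at ht
    obtain ⟨μ1, r1, f1, e1, k1⟩ := ih d g μ ρ A hg hE hμ hv hA hρg hAg hwT ht i p c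
    have hT := (T.size_eval_le hg hE hAg hρg).trans hwT
    have hd : tmpCell d < Z := by simp only [tmpCell]; omega
    have hs := (hE.psiNeg (T.eval E A ρ)).trans hgγ
    obtain ⟨h1, h2⟩ := hR.runs_store (E := E) f1 (a := tmpCell d) (v := (Term.psiNeg T).eval E A ρ)
      (e := .psiNeg (cell (tmpCell d))) hd (by simp [Exp.value, Term.eval, e1]) hs
      (by
        have h3 := hR.size_addr hd
        simp only [Exp.bits, Exp.value, e1]; omega) i p c
    exact ⟨_, .seq _ _ _ _ _ r1 h1, h2, by simp, fun a ha => by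
      rw [update_ne _ _ (ha d le_rfl), k1 a ha]⟩
  | fold o v q x N b ihq ihN ihb =>
    intro d g μ ρ A hg hE hμ hv hA hρg hAg hw ht i p c
    simp only [Term.top, max_le_iff] at ht
    obtain ⟨⟨htq, htN⟩, htb, htx⟩ := ht
    have htb' := b.le_top (d + 4)
    have pN := N.wt_pos
    simp only [Term.wt] at hw
    -- The weight of a fold is multiplied out to expose `b.wt * (N.wt * g)`: inside the loop the
    -- counter may be as long as the limit, so the body runs with the size bound `N.wt * g`.
    have hw' : q.wt * g + b.wt * (N.wt * g) + N.wt * g + Nat.size v * g + g ≤ γ :=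
      le_trans (le_of_eq (by ring)) hw
    have hvg : Nat.size v ≤ Nat.size v * g := Nat.le_mul_of_pos_right _ hg
    have hwq : q.wt * g ≤ γ := by omega
    have hwq1 : q.wt * g + 1 + Nat.size v ≤ γ := by omega
    have hwN : N.wt * g ≤ γ := by omega
    have hwb : b.wt * (N.wt * g) ≤ γ := by omega
    have hgN : g ≤ N.wt * g := Nat.le_mul_of_pos_left _ pN
    have z0 : tmpCell d < Z := by simp only [tmpCell]; omega
    have z1 : tmpCell (d + 1) < Z := by simp only [tmpCell]; omega
    have z2 : tmpCell (d + 2) < Z := by simp only [tmpCell]; omega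
    have z3 : tmpCell (d + 3) < Z := by simp only [tmpCell]; omega
    have z4 : tmpCell (d + 4) < Z := by simp only [tmpCell]; omega
    have zx : varCell x < Z := by simp only [varCell]; omega
    have a0 := hR.size_addr z0
    have a1 := hR.size_addr z1
    have a2 := hR.size_addr z2
    have a3 := hR.size_addr z3
    have a4 := hR.size_addr z4
    have ax := hR.size_addr zx
    have n1 : Nat.size 1 = 1 := size_one_eq
    have n0 : Nat.size 0 = 0 := Nat.size_zero
    -- modulus
    obtain ⟨μ1, r1, f1, e1, k1⟩ := ihq d g μ ρ A hg hE hμ hv hA hρg hAg hwq htq i p c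
    have sq := (q.size_eval_le hg hE hAg hρg)
    set Q := q.eval E A ρ with hQ
    have sQ : Nat.size (Q - 1 + 1) ≤ γ := by
      have := size_foldVal_le .add 0 Q (fun _ => 1) 0
      rcases Nat.eq_zero_or_pos Q with h | h
      · rw [h]; simp [n1]; omega
      · rw [Nat.sub_add_cancel h]; omega
    have sQ' : Nat.size (Q - 1) ≤ γ := (Nat.size_le_size (by omega)).trans sQ
    obtain ⟨r2, f2⟩ := hR.runs_store (E := E) f1 (a := tmpCell d) (v := Q - 1 + 1)
      (e := .op .add (.op .sub (cell (tmpCell d)) (.const 1)) (.const 1)) z0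
      (by simp [Exp.value, e1, BinOp.value]) sQ
      (by simp only [Exp.bits, Exp.value, BinOp.value, e1, n1]; omega) i p c
    -- limit
    obtain ⟨μ3, r3, f3, e3, k3⟩ := ihN (d + 1) g _ ρ A hg hE f2
      (fun y => by
        rw [update_ne _ _ (by simp only [varCell, tmpCell]; omega),
          k1 _ (fun d' _ => by simp only [varCell, tmpCell]; omega), hv])
      (fun y => by
        rw [update_ne _ _ (by simp only [arrCell, tmpCell]; omega),
          k1 _ (fun d' _ => by simp only [arrCell, tmpCell]; omega), hA])
      hρg hAg hwN htN i p c
    have sN := (N.size_eval_le hg hE hAg hρg)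
    set L := N.eval E A ρ with hL
    have q3 : μ3 (tmpCell d) = Q - 1 + 1 := by
      rw [k3 _ (fun d' _ => by simp only [tmpCell]; omega), update_same]
    have k3' : ∀ a, (∀ d', d ≤ d' → a ≠ tmpCell d') → μ3 a = μ a := fun a ha => by
      rw [k3 a (fun d' hd' => ha d' (by omega)), update_ne _ _ (ha d le_rfl), k1 a ha]
    have v3 : μ3 (varCell x) = ρ x := by
      rw [k3' _ (fun d' _ => by simp only [varCell, tmpCell]; omega), hv]
    have sx : Nat.size (ρ x) ≤ γ := (hρg x).trans (hgN.trans hwN)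
    -- The old value of the loop variable is saved, because folds may be nested and the variable
    -- must be restored at the end.
    obtain ⟨r4, f4⟩ := hR.runs_store (E := E) f3 (a := tmpCell (d + 2)) (v := ρ x)
      (e := cell (varCell x)) z2 v3 sx (by rw [bits_cell, v3]; omega) i p c
    have q4 : (μ3.update (tmpCell (d + 2)) (ρ x)) (tmpCell d) = Q - 1 + 1 := by
      rw [update_ne _ _ (by simp only [tmpCell]; omega), q3]
    have sv : Nat.size (v % (Q - 1 + 1)) ≤ γ :=
      (Nat.size_le_size (Nat.mod_le _ _)).trans (by omega)
    obtain ⟨r5, f5⟩ := hR.runs_store (E := E) f4 (a := tmpCell (d + 3)) (v := v % (Q - 1 + 1))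
      (e := .op .mod (.const v) (cell (tmpCell d))) z3
      (by simp only [Exp.value, q4]; rfl) sv
      (by
        refine (BinOp.bits_op _ _ _ _ _).trans ?_
        simp only [Exp.bits, Exp.value, q4]; omega) i p c
    obtain ⟨r6, f6⟩ := hR.runs_store (E := E) f5 (a := varCell x) (v := 0)
      (e := .const 0) zx rfl (by simp) (by simp only [Exp.bits, n0]; omega) i p c
    set F : ℕ → ℕ := fun j => b.eval E A (Function.update ρ x j) with hF
    -- Temporaries `d` to `d + 3` hold the modulus, the limit, the saved variable and the
    -- accumulator. The body works from `d + 4` on.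
    let I : ℕ → State → Prop := fun j st => ∃ ν : Mem, st = ⟨ν, i, p, c⟩ ∧ Fit f ν ∧
      ν (tmpCell d) = Q - 1 + 1 ∧ ν (tmpCell (d + 1)) = L ∧ ν (tmpCell (d + 2)) = ρ x ∧
      ν (tmpCell (d + 3)) = foldVal o v Q F j ∧ ν (varCell x) = j ∧
      ∀ a, (∀ d', d ≤ d' → a ≠ tmpCell d') → a ≠ varCell x → ν a = μ a
    have hcond : ∀ j ≤ L, ∀ st, I j st →
        st.mem.bits + (Exp.op .lt (cell (varCell x)) (cell (tmpCell (d + 1)))).bits E st.mem ≤ S ∧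
        ((Exp.op .lt (cell (varCell x)) (cell (tmpCell (d + 1)))).value E st.mem ≠ 0 ↔ j < L) := by
      rintro j hj st ⟨ν, rfl, hf, g0, g1, g2, g3, gx, gk⟩
      refine ⟨?_, ?_⟩
      · have hb := hR.bits ν hf
        have := BinOp.bits_op E ν .lt (cell (varCell x)) (cell (tmpCell (d + 1)))
        rw [bits_cell, bits_cell, value_cell, value_cell, gx, g1] at this
        have hsj := Nat.size_le_size hj
        simp only; omega
      · simp [Exp.value, gx, g1, BinOp.value]
    have hbody : ∀ j < L, ∀ st, I j st → ∃ st', Runs E S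
        (.seq (b.compile (d + 4)) <|
          .seq (.store (.const (tmpCell (d + 3)))
            (.op .mod (.op o (cell (tmpCell (d + 3))) (cell (tmpCell (d + 4))))
              (cell (tmpCell d)))) <|
          .store (.const (varCell x)) (.op .add (cell (varCell x)) (.const 1))) st st' ∧
        I (j + 1) st' := by
      rintro j hj st ⟨ν, rfl, hf, g0, g1, g2, g3, gx, gk⟩
      have hsj : Nat.size j ≤ N.wt * g := (Nat.size_le_size hj.le).trans sN
      have hρ' : ∀ y, Nat.size (Function.update ρ x j y) ≤ N.wt * g :=
        size_update_le (fun y => (hρg y).trans hgN) hsj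
      have hA' : ∀ y, Nat.size (A y) ≤ N.wt * g := fun y => (hAg y).trans hgN
      -- The induction hypothesis is used with the enlarged bound `N.wt * g`, which also covers the
      -- counter.
      obtain ⟨ν1, t1, c1, w1, m1⟩ := ihb (d + 4) (N.wt * g) ν (Function.update ρ x j) A
        (hg.trans hgN) (hE.mono hgN) hf
        (fun y => by
          by_cases hy : y = x
          · subst hy; simp [gx]
          · rw [gk _ (fun d' _ => by simp only [varCell, tmpCell]; omega)
              (by simp only [varCell]; omega), hv, Function.update_of_ne hy])
        (fun y => by
          rw [gk _ (fun d' _ => by simp only [arrCell, tmpCell]; omega)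
              (by simp only [varCell, arrCell]; omega), hA])
        hρ' hA' hwb htb i p c
      have sF : Nat.size (F j) ≤ γ :=
        (b.size_eval_le (hg.trans hgN) (hE.mono hgN) hA' hρ').trans hwb
      have sv1 : ∀ j, Nat.size (foldVal o v Q F j) ≤ γ := fun j =>
        (size_foldVal_le o v Q F j).trans (by omega)
      have y0 : ν1 (tmpCell d) = Q - 1 + 1 := by
        rw [m1 _ (fun d' _ => by simp only [tmpCell]; omega), g0]
      have y1 : ν1 (tmpCell (d + 1)) = L := by
        rw [m1 _ (fun d' _ => by simp only [tmpCell]; omega), g1]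
      have y2 : ν1 (tmpCell (d + 2)) = ρ x := by
        rw [m1 _ (fun d' _ => by simp only [tmpCell]; omega), g2]
      have y3 : ν1 (tmpCell (d + 3)) = foldVal o v Q F j := by
        rw [m1 _ (fun d' _ => by simp only [tmpCell]; omega), g3]
      have yx : ν1 (varCell x) = j := by
        rw [m1 _ (fun d' _ => by simp only [varCell, tmpCell]; omega), gx]
      obtain ⟨t2, c2⟩ := hR.runs_store (E := E) c1 (a := tmpCell (d + 3))
        (v := foldVal o v Q F (j + 1))
        (e := .op .mod (.op o (cell (tmpCell (d + 3))) (cell (tmpCell (d + 4))))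
              (cell (tmpCell d))) z3 (by simp only [Exp.value, y3, w1, y0]; rfl) (sv1 _)
        (by
          have u1 := sv1 j
          have u2 := sv1 (j + 1)
          have u3 := o.size_value_le (foldVal o v Q F j) (F j)
          simp only [foldVal] at u2
          simp only [hF] at u1 u2 u3 sF
          simp only [Exp.bits, Exp.value, y3, w1, y0, hF]
          simp only [BinOp.value] at *
          omega) i p c
      have yx2 : (ν1.update (tmpCell (d + 3)) (foldVal o v Q F (j + 1))) (varCell x) = j := by
        rw [update_ne _ _ (by simp only [varCell, tmpCell]; omega), yx]
      have hsj1 : Nat.size (j + 1) ≤ γ := (Nat.size_le_size hj).trans (sN.trans hwN)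
      obtain ⟨t3, c3⟩ := hR.runs_store (E := E) c2 (a := varCell x) (v := j + 1)
        (e := .op .add (cell (varCell x)) (.const 1)) zx
        (by simp only [Exp.value, yx2]; rfl) hsj1
        (by simp only [Exp.bits, Exp.value, yx2, n1, BinOp.value]; omega) i p c
      refine ⟨_, .seq _ _ _ _ _ t1 (.seq _ _ _ _ _ t2 t3), _, rfl, c3, ?_, ?_, ?_, ?_, ?_, ?_⟩
      · rw [update_ne _ _ (by simp only [varCell, tmpCell]; omega),
          update_ne _ _ (by simp only [tmpCell]; omega), y0]
      · rw [update_ne _ _ (by simp only [varCell, tmpCell]; omega),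
          update_ne _ _ (by simp only [tmpCell]; omega), y1]
      · rw [update_ne _ _ (by simp only [varCell, tmpCell]; omega),
          update_ne _ _ (by simp only [tmpCell]; omega), y2]
      · rw [update_ne _ _ (by simp only [varCell, tmpCell]; omega), update_same]
      · rw [update_same]
      · intro a ha hax
        rw [update_ne _ _ hax, update_ne _ _ (ha _ (by omega)),
          m1 a (fun d' hd' => ha d' (by omega)), gk a ha hax]
    obtain ⟨st7, r7, ν, rfl, hf, g0, g1, g2, g3, gx, gk⟩ := runs_loop I hcond hbody _
      ⟨_, rfl, f6, by
        rw [update_ne _ _ (by simp only [varCell, tmpCell]; omega),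
          update_ne _ _ (by simp only [tmpCell]; omega), q4], by
        rw [update_ne _ _ (by simp only [varCell, tmpCell]; omega),
          update_ne _ _ (by simp only [tmpCell]; omega),
          update_ne _ _ (by simp only [tmpCell]; omega), e3], by
        rw [update_ne _ _ (by simp only [varCell, tmpCell]; omega),
          update_ne _ _ (by simp only [tmpCell]; omega), update_same], by
        rw [update_ne _ _ (by simp only [varCell, tmpCell]; omega), update_same]; rfl, by
        rw [update_same], fun a ha hax => by
        rw [update_ne _ _ hax, update_ne _ _ (ha _ (by omega)), update_ne _ _ (ha _ (by omega)),
          k3' a ha]⟩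
    obtain ⟨r8, f8⟩ := hR.runs_store (E := E) hf (a := varCell x) (v := ρ x)
      (e := cell (tmpCell (d + 2))) zx g2 sx (by rw [bits_cell, g2]; omega) i p c
    have sv1 : Nat.size (foldVal o v Q F L) ≤ γ := (size_foldVal_le o v Q F L).trans (by omega)
    have g3' : (ν.update (varCell x) (ρ x)) (tmpCell (d + 3)) = foldVal o v Q F L := by
      rw [update_ne _ _ (by simp only [varCell, tmpCell]; omega), g3]
    obtain ⟨r9, f9⟩ := hR.runs_store (E := E) f8 (a := tmpCell d) (v := foldVal o v Q F L)
      (e := cell (tmpCell (d + 3))) z0 g3' sv1 (by rw [bits_cell, g3']; omega) i p c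
    refine ⟨_, .seq _ _ _ _ _ r1 <| .seq _ _ _ _ _ r2 <| .seq _ _ _ _ _ r3 <|
      .seq _ _ _ _ _ r4 <| .seq _ _ _ _ _ r5 <| .seq _ _ _ _ _ r6 <| .seq _ _ _ _ _ r7 <|
      .seq _ _ _ _ _ r8 r9, f9, update_same _ _ _, fun a ha => ?_⟩
    rw [update_ne _ _ (ha d le_rfl)]
    by_cases hax : a = varCell x
    · subst hax; rw [update_same, hv]
    · rw [update_ne _ _ hax, gk a ha hax]

end

end AMStream
namespace AMStream

/-! ### Commands on abstract configurations -/

/-- What a program with variables, an array and output cells can see of a state. -/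
structure Cfg where
  vars : ℕ → ℕ
  arr : ℕ → ℕ
  out : ℕ → ℕ
  input : List ℕ
  proof : List Bool
  coins : List Bool

/-- The state `st` represents the configuration `c`, whose variables and array entries have bit
length at most `g`. -/
structure Rel (f : ℕ → ℕ) (g : ℕ) (st : State) (c : Cfg) : Prop where
  fit : Fit f st.mem
  vars : ∀ x, st.mem (varCell x) = c.vars x
  arr : ∀ i, st.mem (arrCell i) = c.arr i
  out : ∀ i < 4, st.mem i = c.out i
  input : st.input = c.input
  proof : st.proof = c.proof
  coins : st.coins = c.coins
  vars_le : ∀ x, Nat.size (c.vars x) ≤ g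
  arr_le : ∀ i, Nat.size (c.arr i) ≤ g

/-- The program `p` leads from states representing `c` to states representing `c'`. -/
def Steps (f : ℕ → ℕ) (g : ℕ) (E : Env) (S : ℕ) (p : Prog) (c c' : Cfg) : Prop :=
  ∀ st, Rel f g st c → ∃ st', Runs E S p st st' ∧ Rel f g st' c'

/-- The standing assumptions on the resource bounds. -/
structure Resources (E : Env) (S Z γ : ℕ) (f : ℕ → ℕ) (g : ℕ) : Prop where
  room : Room S Z γ f
  env : E.Le g
  one_le : 1 ≤ g
  le : g ≤ γ
  large : 200 ≤ Z

/-- The term can be computed within the resource bounds. -/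
structure Term.Ok (T : Term) (Z γ g : ℕ) : Prop where
  wt : T.wt * g ≤ γ
  top₀ : T.top 0 ≤ Z
  top₁ : T.top 1 ≤ Z

/-- `x := T` -/
def assign (x : ℕ) (T : Term) : Prog :=
  .seq (T.compile 0) (.store (.const (varCell x)) (cell (tmpCell 0)))

/-- `array[I] := T` -/
def setArr (I T : Term) : Prog :=
  .seq (I.compile 0) (.seq (T.compile 1)
    (.store (.op .add (.op .mul (.const 3) (cell (tmpCell 0))) (.const 6)) (cell (tmpCell 1))))

/-- `output[i] := T` -/
def setOut (i : ℕ) (T : Term) : Prog :=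
  .seq (T.compile 0) (.store (.const i) (cell (tmpCell 0)))

/-- `for x = 0, …, y - 1 do c` -/
def forTo (x y : ℕ) (c : Prog) : Prog :=
  .seq (assign x (.const 0))
    (.loop (.op .lt (cell (varCell x)) (cell (varCell y)))
      (.seq c (.store (.const (varCell x)) (.op .add (cell (varCell x)) (.const 1)))))

/-- `if T ≠ 0 then c₁ else c₂` -/
def ifThen (T : Term) (c₁ c₂ : Prog) : Prog :=
  .seq (T.compile 0) (.ite (cell (tmpCell 0)) c₁ c₂)

section
variable {E : Env} {S Z γ g : ℕ} {f : ℕ → ℕ}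

theorem Steps.seq {p q : Prog} {c c' c'' : Cfg} (h₁ : Steps f g E S p c c')
    (h₂ : Steps f g E S q c' c'') : Steps f g E S (.seq p q) c c'' := by
  intro st hst
  obtain ⟨st1, r1, h1⟩ := h₁ st hst
  obtain ⟨st2, r2, h2⟩ := h₂ st1 h1
  exact ⟨st2, .seq _ _ _ _ _ r1 r2, h2⟩

/-- The last clause protects the temporaries below `d`: an index can wait in temporary `0` while a
value is computed from temporary `1` on. -/
protected theorem Resources.compile (hR : Resources E S Z γ f g) {T : Term} (hT : T.wt * g ≤ γ) {d : ℕ}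
    (ht : T.top d ≤ Z) {st : State} {c : Cfg} (h : Rel f g st c) :
    ∃ μ, Runs E S (T.compile d) st { st with mem := μ } ∧ Rel f g { st with mem := μ } c ∧
      μ (tmpCell d) = T.eval E c.arr c.vars ∧ ∀ d' < d, μ (tmpCell d') = st.mem (tmpCell d') := by
  obtain ⟨μ, i, p, l⟩ := st
  obtain ⟨μ', r, f', e, k⟩ := hR.room.runs_compile T d g μ c.vars c.arr hR.one_le hR.env h.fit h.vars
    h.arr h.vars_le h.arr_le hT ht i p l
  refine ⟨μ', r, ⟨f', fun x => ?_, fun x => ?_, fun x hx => ?_, h.input, h.proof, h.coins,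
    h.vars_le, h.arr_le⟩, e, fun d' hd' => ?_⟩
  · rw [← h.vars x]; exact k _ (fun d' _ => by simp only [varCell, tmpCell]; omega)
  · rw [← h.arr x]; exact k _ (fun d' _ => by simp only [arrCell, tmpCell]; omega)
  · rw [← h.out x hx]; exact k _ (fun d' _ => by simp only [tmpCell]; omega)
  · exact k _ (fun d' _ => by simp only [tmpCell]; omega)

protected theorem Resources.eval_size (hR : Resources E S Z γ f g) {T : Term} (hT : T.wt * g ≤ γ)
    {st : State} {c : Cfg} (h : Rel f g st c) : Nat.size (T.eval E c.arr c.vars) ≤ γ :=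
  (T.size_eval_le hR.one_le hR.env h.arr_le h.vars_le).trans hT

theorem Rel.setVar {st : State} {c : Cfg} (h : Rel f g st c) {x v : ℕ} (hv : Nat.size v ≤ g)
    (hf : Nat.size v ≤ f (varCell x)) :
    Rel f g { st with mem := st.mem.update (varCell x) v }
      { c with vars := Function.update c.vars x v } := by
  refine ⟨h.fit.update hf, fun y => ?_, fun y => ?_, fun y hy => ?_, h.input, h.proof, h.coins,
    size_update_le h.vars_le hv, h.arr_le⟩
  · by_cases hy : y = x
    · subst hy; simp
    · simp only [Function.update_of_ne hy, ← h.vars y]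
      exact update_ne _ _ (by simp only [varCell]; omega)
  · rw [← h.arr y]; exact update_ne _ _ (by simp only [varCell, arrCell]; omega)
  · rw [← h.out y hy]; exact update_ne _ _ (by simp only [varCell]; omega)

protected theorem Resources.setVar_fit (hR : Resources E S Z γ f g) {x v : ℕ} (hx : varCell x < Z)
    (hv : Nat.size v ≤ g) : Nat.size v ≤ f (varCell x) :=
  hv.trans (hR.le.trans (hR.room.low _ hx))

protected theorem Resources.assign (hR : Resources E S Z γ f g) {T : Term} (hT : T.Ok Z γ g) {x : ℕ}
    (hx : varCell x < Z) (c : Cfg) (hv : Nat.size (T.eval E c.arr c.vars) ≤ g) :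
    Steps f g E S (assign x T) c
      { c with vars := Function.update c.vars x (T.eval E c.arr c.vars) } := by
  intro st h
  obtain ⟨μ, r, h1, e, -⟩ := hR.compile hT.wt hT.top₀ h
  have h0 : tmpCell 0 < Z := lt_of_lt_of_le (by simp) ((T.le_top 0).trans hT.top₀)
  obtain ⟨r2, -⟩ := hR.room.runs_store (E := E) h1.fit hx (e := cell (tmpCell 0)) e
    (hv.trans hR.le) (by
      have := hR.room.size_addr h0
      have := hR.le
      simp only [bits_cell, e]; omega) st.input st.proof st.coins
  exact ⟨_, .seq _ _ _ _ _ r r2, h1.setVar hv (hR.setVar_fit hx hv)⟩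

/-- The array reaches beyond the region of `γ`-bit cells, so the new entry must also respect the
tighter profile `f` at its own address. -/
protected theorem Resources.setArr (hR : Resources E S Z γ f g) {I T : Term} (hI : I.Ok Z γ g)
    (hT : T.Ok Z γ g) (c : Cfg) (hv : Nat.size (T.eval E c.arr c.vars) ≤ g)
    (hf : Nat.size (T.eval E c.arr c.vars) ≤ f (arrCell (I.eval E c.arr c.vars))) :
    Steps f g E S (setArr I T) c
      { c with arr := Function.update c.arr (I.eval E c.arr c.vars) (T.eval E c.arr c.vars) } := by
  intro st h
  obtain ⟨μ, r, h1, e, -⟩ := hR.compile hI.wt hI.top₀ h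
  obtain ⟨μ', r', h1', e', k'⟩ := hR.compile hT.wt hT.top₁ h1
  have h0 : tmpCell 1 < Z := lt_of_lt_of_le (by simp) ((T.le_top 1).trans hT.top₁)
  have h00 : tmpCell 0 < Z := lt_of_lt_of_le (by simp) ((I.le_top 0).trans hI.top₀)
  have e0 : μ' (tmpCell 0) = I.eval E c.arr c.vars := by rw [k' 0 (by omega)]; exact e
  have hfit := h1'.fit.update hf
  refine ⟨⟨μ'.update (arrCell (I.eval E c.arr c.vars)) (T.eval E c.arr c.vars), st.input, st.proof,
    st.coins⟩, .seq _ _ _ _ _ r (.seq _ _ _ _ _ r'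
    (.store _ _ _ _ ?_ ?_ ?_)), ⟨hfit, fun y => ?_, fun y => ?_, fun y hy => ?_, h.input, h.proof,
      h.coins, h.vars_le, size_update_le h.arr_le hv⟩⟩
  · have hb := hR.room.bits _ h1'.fit
    have b0 := hR.room.size_addr h0
    have b00 := hR.room.size_addr h00
    have b1 := hR.eval_size hI.wt h
    have b2 := hv.trans hR.le
    have h5 := size_mul_le 3 (I.eval E c.arr c.vars)
    have h6 := size_add_le (3 * I.eval E c.arr c.vars) 6
    have h7 : Nat.size 3 = 2 := by decide
    have h8 : Nat.size 6 = 3 := by decide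
    simp only [Exp.bits, Exp.value, BinOp.value, e0, e', h7, h8] at *
    omega
  · simp only [State.write, Exp.value, BinOp.value, e0, e']
  · have hb := hR.room.bits _ hfit
    simp only at hb ⊢; omega
  · rw [← h1'.vars y]; exact update_ne _ _ (by simp only [varCell, arrCell]; omega)
  · by_cases hy : y = I.eval E c.arr c.vars
    · subst hy; simp
    · simp only [Function.update_of_ne hy, ← h1'.arr y]
      exact update_ne _ _ (by simp only [arrCell]; omega)
  · rw [← h1'.out y hy]; exact update_ne _ _ (by simp only [arrCell]; omega)

protected theorem Resources.setOut (hR : Resources E S Z γ f g) {T : Term} (hT : T.Ok Z γ g) {i : ℕ}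
    (hi : i < 4) (c : Cfg) :
    Steps f g E S (setOut i T) c
      { c with out := Function.update c.out i (T.eval E c.arr c.vars) } := by
  intro st h
  obtain ⟨μ, r, h1, e, -⟩ := hR.compile hT.wt hT.top₀ h
  have h0 : tmpCell 0 < Z := lt_of_lt_of_le (by simp) ((T.le_top 0).trans hT.top₀)
  have hv := hR.eval_size hT.wt h
  obtain ⟨r2, f2⟩ := hR.room.runs_store (E := E) h1.fit (a := i)
    (lt_trans (hi.trans (by simp)) h0) (e := cell (tmpCell 0)) e hv (by
      have := hR.room.size_addr h0
      simp only [bits_cell, e]; omega) st.input st.proof st.coins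
  refine ⟨_, .seq _ _ _ _ _ r r2, ⟨f2, fun y => ?_, fun y => ?_, fun y hy => ?_, h.input, h.proof,
    h.coins, h.vars_le, h.arr_le⟩⟩
  · rw [← h1.vars y]; exact update_ne _ _ (by simp only [varCell]; omega)
  · rw [← h1.arr y]; exact update_ne _ _ (by simp only [arrCell]; omega)
  · by_cases hyi : y = i
    · subst hyi; simp
    · simp only [Function.update_of_ne hyi, ← h1.out y hy]
      exact update_ne _ _ hyi

protected theorem Resources.readInput (hR : Resources E S Z γ f g) {x : ℕ} (hx : varCell x < Z) (c : Cfg)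
    (hv : Nat.size (inputSymbol c.input) ≤ g) :
    Steps f g E S (.readInput (.const (varCell x))) c
      { c with vars := Function.update c.vars x (inputSymbol c.input), input := c.input.tail } := by
  intro st h
  have h2 := h.setVar (x := x) hv (hR.setVar_fit hx hv)
  refine ⟨_, .readInput _ _ _ ?_ rfl ?_, ?_⟩
  · have hb := hR.room.bits _ h.fit
    have := hR.room.size_addr hx
    have := hR.le
    rw [h.input]; simp only [Exp.bits]; omega
  · have hb := hR.room.bits _ h2.fit
    simp only [State.write, Exp.value, h.input] at hb ⊢; omega
  · simp only [State.write, Exp.value, h.input]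
    exact ⟨h2.fit, h2.vars, h2.arr, h2.out, rfl, h2.proof, h2.coins, h2.vars_le, h2.arr_le⟩

theorem size_proofSymbol_le (l : List Bool) : Nat.size (proofSymbol l) ≤ 2 := by
  rcases l with _ | ⟨_ | _, _⟩ <;> (simp [proofSymbol]; try decide)

protected theorem Resources.readProof (hR : Resources E S Z γ f g) {x : ℕ} (hx : varCell x < Z) (hg : 2 ≤ g)
    (c : Cfg) :
    Steps f g E S (.readProof (.const (varCell x))) c
      { c with vars := Function.update c.vars x (proofSymbol c.proof), proof := c.proof.tail } := by
  intro st h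
  have hv := (size_proofSymbol_le c.proof).trans hg
  have h2 := h.setVar (x := x) hv (hR.setVar_fit hx hv)
  refine ⟨_, .readProof _ _ _ ?_ rfl ?_, ?_⟩
  · have hb := hR.room.bits _ h.fit
    have := hR.room.size_addr hx
    have := hR.le
    rw [h.proof]; simp only [Exp.bits]; omega
  · have hb := hR.room.bits _ h2.fit
    simp only [State.write, Exp.value, h.proof] at hb ⊢; omega
  · simp only [State.write, Exp.value, h.proof]
    exact ⟨h2.fit, h2.vars, h2.arr, h2.out, h2.input, rfl, h2.coins, h2.vars_le, h2.arr_le⟩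

protected theorem Resources.toss (hR : Resources E S Z γ f g) {x : ℕ} (hx : varCell x < Z)
    (c : Cfg) {b : Bool} {l : List Bool} (hl : c.coins = b :: l) :
    Steps f g E S (.toss (.const (varCell x))) c
      { c with vars := Function.update c.vars x b.toNat, coins := l } := by
  intro st h
  have hv : Nat.size b.toNat ≤ g := le_trans (by cases b <;> simp) hR.one_le
  have h2 := h.setVar (x := x) hv (hR.setVar_fit hx hv)
  refine ⟨_, .toss _ b l _ _ (h.coins.trans hl) ?_ rfl ?_, ?_⟩
  · have hb := hR.room.bits _ h.fit
    have := hR.room.size_addr hx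
    have := hR.le
    simp only [Exp.bits]; omega
  · have hb := hR.room.bits _ h2.fit
    simp only [State.write, Exp.value] at hb ⊢; omega
  · exact ⟨h2.fit, h2.vars, h2.arr, h2.out, h2.input, h2.proof, rfl, h2.vars_le, h2.arr_le⟩

protected theorem Resources.ifThen (hR : Resources E S Z γ f g) {T : Term} (hT : T.Ok Z γ g) {p q : Prog}
    {c : Cfg} {R : State → Prop}
    (h₁ : T.eval E c.arr c.vars ≠ 0 → ∀ st, Rel f g st c → ∃ st', Runs E S p st st' ∧ R st')
    (h₂ : T.eval E c.arr c.vars = 0 → ∀ st, Rel f g st c → ∃ st', Runs E S q st st' ∧ R st')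
    {st : State} (h : Rel f g st c) : ∃ st', Runs E S (ifThen T p q) st st' ∧ R st' := by
  obtain ⟨μ, r, h1, e, -⟩ := hR.compile hT.wt hT.top₀ h
  have h0 : tmpCell 0 < Z := lt_of_lt_of_le (by simp) ((T.le_top 0).trans hT.top₀)
  have hb := hR.room.bits _ h1.fit
  have hs : μ.bits + (cell (tmpCell 0)).bits E μ ≤ S := by
    have := hR.room.size_addr h0
    have := hR.eval_size hT.wt h
    simp only [bits_cell, e] at *; omega
  by_cases he : T.eval E c.arr c.vars = 0
  · obtain ⟨st', r', h'⟩ := h₂ he _ h1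
    exact ⟨st', .seq _ _ _ _ _ r (.iteFalse _ _ _ _ _ hs (by simpa [Exp.value, e] using he) r'), h'⟩
  · obtain ⟨st', r', h'⟩ := h₁ he _ h1
    exact ⟨st', .seq _ _ _ _ _ r (.iteTrue _ _ _ _ _ hs (by simpa [Exp.value, e] using he) r'), h'⟩

end

end AMStream
namespace AMStream

/-! ### Isolation by random affine hyperplanes -/

/-- The coefficient of the `g`-th entry of a row in the parity check of `i`; the last entry is an
offset. -/
def coef (l g i : ℕ) : ℕ := if g < l then i / 2 ^ g % 2 else 1

/-- The parity check of `i` by a row. -/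
def parity (l : ℕ) (row : ℕ → ℕ) (i : ℕ) : ℕ :=
  ∑ g ∈ Finset.range (l + 1), row g * coef l g i

/-- The position `i` survives the first `j % (l + 1)` rows of the block `j / (l + 1)`. -/
def Survives (l : ℕ) (r : ℕ → ℕ) (j i : ℕ) : Prop :=
  ∀ q < j % (l + 1), parity l (fun h => r (j / (l + 1) * (l * (l + 1)) + q * (l + 1) + h)) i % 2 = 0

instance (l : ℕ) (r : ℕ → ℕ) (j i : ℕ) : Decidable (Survives l r j i) :=
  inferInstanceAs (Decidable (∀ q < _, _))

section isolation
variable {l : ℕ}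

/-- The sign of the parity check of `i` by a row of bits. -/
noncomputable def rowSign (row : Fin (l + 1) → Bool) (i : ℕ) : ℝ :=
  ∏ g : Fin (l + 1), (-1) ^ ((row g).toNat * coef l g i)

/-- The sum factors over the coordinates, and the offset coordinate contributes `1 + (-1) = 0`. Thus
each parity check is unbiased, even for `i = 0`. -/
theorem sum_rowSign (i : ℕ) : ∑ row : Fin (l + 1) → Bool, rowSign row i = 0 := by
  have := Finset.prod_univ_sum (fun _ : Fin (l + 1) => (Finset.univ : Finset Bool))
    (fun g b => (-1 : ℝ) ^ (b.toNat * coef l g i))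
  rw [Fintype.piFinset_univ] at this
  unfold rowSign
  rw [← this]
  refine Finset.prod_eq_zero (Finset.mem_univ (Fin.last l)) ?_
  simp [coef]

theorem exists_testBit_ne {i j : ℕ} (hi : i < 2 ^ l) (hj : j < 2 ^ l) (hij : i ≠ j) :
    ∃ g < l, i / 2 ^ g % 2 ≠ j / 2 ^ g % 2 := by
  by_contra! h
  refine hij (Nat.eq_of_testBit_eq fun g => ?_)
  rcases lt_or_ge g l with hg | hg
  · rw [Nat.testBit_eq_decide_div_mod_eq, Nat.testBit_eq_decide_div_mod_eq, h g hg]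
  · rw [Nat.testBit_lt_two_pow (hi.trans_le (Nat.pow_le_pow_right (by norm_num) hg)),
      Nat.testBit_lt_two_pow (hj.trans_le (Nat.pow_le_pow_right (by norm_num) hg))]

/-- In the product of two signs the offset cancels, but at a binary digit where `i` and `j` differ
the factor is `1 + (-1) = 0`. -/
theorem sum_rowSign_mul {i j : ℕ} (hi : i < 2 ^ l) (hj : j < 2 ^ l) (hij : i ≠ j) :
    ∑ row : Fin (l + 1) → Bool, rowSign row i * rowSign row j = 0 := by
  have := Finset.prod_univ_sum (fun _ : Fin (l + 1) => (Finset.univ : Finset Bool))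
    (fun g b => (-1 : ℝ) ^ (b.toNat * coef l g i) * (-1 : ℝ) ^ (b.toNat * coef l g j))
  rw [Fintype.piFinset_univ] at this
  unfold rowSign
  simp_rw [← Finset.prod_mul_distrib]
  rw [← this]
  obtain ⟨g, hg, hne⟩ := exists_testBit_ne hi hj hij
  refine Finset.prod_eq_zero (Finset.mem_univ (⟨g, by omega⟩ : Fin (l + 1))) ?_
  have h1 : i / 2 ^ g % 2 = 0 ∨ i / 2 ^ g % 2 = 1 := by omega
  have h2 : j / 2 ^ g % 2 = 0 ∨ j / 2 ^ g % 2 = 1 := by omega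
  rcases h1 with h1 | h1 <;> rcases h2 with h2 | h2 <;> simp_all [coef]

/-- The indicator of `i` passing the parity check of a row. -/
noncomputable def rowInd (row : Fin (l + 1) → Bool) (i : ℕ) : ℝ := (1 + rowSign row i) / 2

/-- A row of bits as a sequence of numbers. -/
def bitSeq {N : ℕ} (r : Fin N → Bool) (i : ℕ) : ℕ := if h : i < N then (r ⟨i, h⟩).toNat else 0

theorem parity_bitSeq (row : Fin (l + 1) → Bool) (i : ℕ) :
    parity l (bitSeq row) i = ∑ g : Fin (l + 1), (row g).toNat * coef l g i := by
  rw [parity, Finset.sum_range]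
  exact Finset.sum_congr rfl fun g _ => by
    simp only [bitSeq, g.2, dif_pos, Fin.eta]

theorem rowInd_eq (row : Fin (l + 1) → Bool) (i : ℕ) :
    rowInd row i = if parity l (bitSeq row) i % 2 = 0 then 1 else 0 := by
  rw [rowInd, rowSign, Finset.prod_pow_eq_pow_sum, ← parity_bitSeq]
  rcases Nat.mod_two_eq_zero_or_one (parity l (bitSeq row) i) with h | h
  · rw [if_pos h, (Nat.even_iff.2 h).neg_one_pow]; norm_num
  · rw [if_neg (by omega), (Nat.odd_iff.2 h).neg_one_pow]; norm_num

theorem sum_rowInd (i : ℕ) :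
    ∑ row : Fin (l + 1) → Bool, rowInd row i = 2 ^ (l + 1) * (1 / 2 : ℝ) := by
  simp only [rowInd, ← Finset.sum_div, Finset.sum_add_distrib, sum_rowSign]
  simp; ring

/-- This is pairwise independence of the parity checks: the three character sums in the expanded
product vanish. -/
theorem sum_rowInd_mul {i j : ℕ} (hi : i < 2 ^ l) (hj : j < 2 ^ l) (hij : i ≠ j) :
    ∑ row : Fin (l + 1) → Bool, rowInd row i * rowInd row j = 2 ^ (l + 1) * (1 / 4 : ℝ) := by
  have h : ∀ row : Fin (l + 1) → Bool, rowInd row i * rowInd row j =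
      (1 + rowSign row i + rowSign row j + rowSign row i * rowSign row j) / 4 := by
    intro row; simp only [rowInd]; ring
  simp only [h, ← Finset.sum_div, Finset.sum_add_distrib, sum_rowSign, sum_rowSign_mul hi hj hij]
  simp; ring

/-- A block of random bits. -/
abbrev Block (l : ℕ) := Fin l → Fin (l + 1) → Bool

/-- The indicator of `i` passing the first `v` parity checks of a block. -/
noncomputable def blockInd (v : ℕ) (u : Block l) (i : ℕ) : ℝ :=
  ∏ q : Fin l, if (q : ℕ) < v then rowInd (u q) i else 1

/-- The position `i` passes the first `v` parity checks of a block. -/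
def Passes (v : ℕ) (u : Block l) (i : ℕ) : Prop :=
  ∀ q : Fin l, (q : ℕ) < v → parity l (bitSeq (u q)) i % 2 = 0

instance (v : ℕ) (u : Block l) (i : ℕ) : Decidable (Passes v u i) :=
  inferInstanceAs (Decidable (∀ _ : Fin l, _))

theorem blockInd_eq (v : ℕ) (u : Block l) (i : ℕ) :
    blockInd v u i = if Passes v u i then 1 else 0 := by
  have : blockInd v u i = ∏ q : Fin l,
      if ((q : ℕ) < v → parity l (bitSeq (u q)) i % 2 = 0) then (1 : ℝ) else 0 := by
    refine Finset.prod_congr rfl fun q _ => ?_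
    rw [rowInd_eq]
    by_cases h : (q : ℕ) < v <;> simp [h]
  rw [this, Finset.prod_ite_zero, Finset.prod_const_one]
  by_cases hp : Passes v u i
  · rw [if_pos hp, if_pos fun q _ => hp q]
  · rw [if_neg hp, if_neg fun h => hp fun q => h q (Finset.mem_univ q)]

/-- Here `a` counts the rows of bits and `b` is the survival probability for one active row;
inactive rows are unconstrained. -/
theorem prod_const_ite {v : ℕ} (hv : v ≤ l) (a b : ℝ) :
    ∏ q : Fin l, (if (q : ℕ) < v then a * b else a) = a ^ l * b ^ v := by
  have h : ∀ q : Fin l, (if (q : ℕ) < v then a * b else a) = a * (if (q : ℕ) < v then b else 1) := by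
    intro q; split_ifs <;> ring
  simp only [h, Finset.prod_mul_distrib, Finset.prod_const, Finset.card_univ, Fintype.card_fin]
  congr 1
  rw [Finset.prod_ite, Finset.prod_const_one, mul_one, Finset.prod_const]
  congr 1
  rw [Fin.card_filter_val_lt, min_eq_right hv]

/-- The number of blocks. -/
noncomputable def blockCount (l : ℕ) : ℝ := (2 ^ (l + 1)) ^ l

theorem card_block : (Fintype.card (Block l) : ℝ) = blockCount l := by
  simp [blockCount]

theorem sum_blockInd {v : ℕ} (hv : v ≤ l) (i : ℕ) :
    ∑ u : Block l, blockInd v u i = blockCount l * (1 / 2) ^ v := by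
  have := Finset.prod_univ_sum (fun _ : Fin l => (Finset.univ : Finset (Fin (l + 1) → Bool)))
    (fun q row => if (q : ℕ) < v then rowInd row i else 1)
  rw [Fintype.piFinset_univ] at this
  unfold blockInd
  rw [← this, blockCount, ← prod_const_ite hv]
  refine Finset.prod_congr rfl fun q _ => ?_
  split_ifs
  · exact sum_rowInd i
  · simp

/-- The rows of a block are independent, so two distinct positions survive `v` rows together with
probability `4 ^ (-v)`. -/
theorem sum_blockInd_mul {v : ℕ} (hv : v ≤ l) {i j : ℕ} (hi : i < 2 ^ l) (hj : j < 2 ^ l)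
    (hij : i ≠ j) :
    ∑ u : Block l, blockInd v u i * blockInd v u j = blockCount l * (1 / 4) ^ v := by
  have := Finset.prod_univ_sum (fun _ : Fin l => (Finset.univ : Finset (Fin (l + 1) → Bool)))
    (fun q row => (if (q : ℕ) < v then rowInd row i else 1) *
      (if (q : ℕ) < v then rowInd row j else 1))
  rw [Fintype.piFinset_univ] at this
  unfold blockInd
  simp_rw [← Finset.prod_mul_distrib]
  rw [← this, blockCount, ← prod_const_ite hv]
  refine Finset.prod_congr rfl fun q _ => ?_
  split_ifs
  · exact sum_rowInd_mul hi hj hij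
  · simp

/-- A block isolates an element of `Y` at some level. -/
def Isolates (u : Block l) (Y : Finset ℕ) : Prop :=
  ∃ v ≤ l, (Y.filter (Passes v u)).card = 1

/-- At a level where about a quarter to a half of an element is expected to survive, the first two
moments force exactly one survivor with probability at least `1 / 8`. Pairwise independence is
enough for this. -/
theorem card_not_isolates_le {Y : Finset ℕ} (hne : Y.Nonempty) (hY : ∀ i ∈ Y, i < 2 ^ l)
    (hcard : 2 * Y.card < 2 ^ l) :
    ((Set.ncard {u : Block l | ¬ Isolates u Y} : ℕ) : ℝ) ≤ 7 / 8 * blockCount l := by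
  classical
  -- With this level `2 ^ (v - 1) ≤ 2 * Y.card < 2 ^ v`, so the expected number of survivors lies
  -- between `1 / 4` and `1 / 2`.
  set v := Nat.size (2 * Y.card) with hv
  have hvl : v ≤ l := Nat.size_le.2 hcard
  have hup : 2 * Y.card < 2 ^ v := Nat.lt_size_self _
  have hpos : 0 < Y.card := hne.card_pos
  have hv1 : 0 < v := Nat.size_pos.2 (by omega)
  have hlo : 2 ^ (v - 1) ≤ 2 * Y.card := Nat.lt_size.1 (by omega)
  have hlo' : 2 ^ v ≤ 4 * Y.card := by
    have : 2 ^ v = 2 * 2 ^ (v - 1) := by rw [← pow_succ']; congr 1; omega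
    omega
  set X : Block l → ℝ := fun u => ∑ i ∈ Y, blockInd v u i with hX
  have hXe : ∀ u, X u = ((Y.filter (Passes v u)).card : ℝ) := by
    intro u
    simp only [hX, blockInd_eq, Finset.sum_boole]
  have h1 : ∑ u, X u = Y.card * (blockCount l * (1 / 2) ^ v) := by
    simp only [hX]
    rw [Finset.sum_comm]
    simp [sum_blockInd hvl]
  -- The second moment splits into the diagonal, where an indicator is its own square, and the pairs
  -- of distinct positions.
  have h2 : ∑ u, X u * X u = Y.card * (blockCount l * (1 / 2) ^ v) +
      Y.card * (Y.card - 1) * (blockCount l * (1 / 4) ^ v) := by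
    have : ∀ u, X u * X u = ∑ i ∈ Y, ∑ j ∈ Y, blockInd v u i * blockInd v u j := by
      intro u; simp only [hX, Finset.sum_mul_sum]
    simp only [this]
    rw [Finset.sum_comm]
    have hi : ∀ i ∈ Y, ∑ u : Block l, ∑ j ∈ Y, blockInd v u i * blockInd v u j =
        blockCount l * (1 / 2) ^ v + (Y.card - 1) * (blockCount l * (1 / 4) ^ v) := by
      intro i hi
      rw [Finset.sum_comm, ← Finset.add_sum_erase _ _ hi]
      congr 1
      · rw [← sum_blockInd hvl i]
        refine Finset.sum_congr rfl fun u _ => ?_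
        rw [blockInd_eq]; split_ifs <;> simp
      · rw [Finset.sum_congr rfl (g := fun _ => blockCount l * (1 / 4) ^ v)]
        · rw [Finset.sum_const, Finset.card_erase_of_mem hi, nsmul_eq_mul, Nat.cast_sub hpos]
          simp
        · intro j hj
          rw [Finset.mem_erase] at hj
          exact sum_blockInd_mul hvl (hY i hi) (hY j hj.2) (Ne.symm hj.1)
    rw [Finset.sum_congr rfl hi, Finset.sum_const, nsmul_eq_mul]; ring
  have hb : 0 < blockCount l := by unfold blockCount; positivity
  -- For a natural number `X`, the quantity `2 * X - X * X` is `1` at `X = 1`, `0` at `X = 0`, and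
  -- at most `0` from `2` on. It is a lower bound for the indicator of `X = 1`.
  have h3 : ∑ u : Block l, (if Isolates u Y then (1 : ℝ) else 0) ≥ ∑ u, (2 * X u - X u * X u) := by
    refine Finset.sum_le_sum fun u _ => ?_
    rw [hXe]
    by_cases h : (Y.filter (Passes v u)).card = 1
    · rw [if_pos ⟨v, hvl, h⟩, h]; norm_num
    · refine le_trans ?_ (show (0 : ℝ) ≤ _ by split_ifs <;> norm_num)
      rcases Nat.lt_or_ge (Y.filter (Passes v u)).card 2 with h' | h'
      · obtain h0 : (Y.filter (Passes v u)).card = 0 := by omega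
        rw [h0]; simp
      · have : (2 : ℝ) ≤ ((Y.filter (Passes v u)).card : ℝ) := by exact_mod_cast h'
        nlinarith
  have h4 : ∑ u : Block l, (if Isolates u Y then (1 : ℝ) else 0) +
      ((Set.ncard {u : Block l | ¬ Isolates u Y} : ℕ) : ℝ) = blockCount l := by
    rw [Finset.sum_boole, ← card_block, Set.ncard_eq_toFinset_card', ← Nat.cast_add,
      Set.toFinset_ofPred, Finset.card_filter_add_card_filter_not, Finset.card_univ]
  -- If `a` is the mean, the second moment is at most `a + a * a`, and `a - a * a ≥ 1 / 8` for `a`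
  -- between `1 / 4` and `1 / 2`.
  have h5 : ∑ u, (2 * X u - X u * X u) ≥ 1 / 8 * blockCount l := by
    rw [Finset.sum_sub_distrib, ← Finset.mul_sum, h1, h2]
    set a : ℝ := Y.card * (1 / 2) ^ v with ha
    have hq : (1 / 4 : ℝ) ^ v = (1 / 2) ^ v * (1 / 2) ^ v := by rw [← mul_pow]; norm_num
    have hp : (0 : ℝ) < (1 / 2) ^ v := by positivity
    have hpp : (2 : ℝ) ^ v * (1 / 2) ^ v = 1 := by rw [← mul_pow]; norm_num
    have a1 : a ≤ 1 / 2 := by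
      have : (2 : ℝ) * Y.card ≤ 2 ^ v := by exact_mod_cast hup.le
      nlinarith
    have a2 : 1 / 4 ≤ a := by
      have : (2 : ℝ) ^ v ≤ 4 * Y.card := by exact_mod_cast hlo'
      nlinarith
    have a3 : (Y.card : ℝ) * (Y.card - 1) * (blockCount l * (1 / 4) ^ v) ≤ a * a * blockCount l := by
      rw [hq, ha]
      have : (0 : ℝ) ≤ Y.card := by positivity
      have e : (Y.card : ℝ) * (1 / 2) ^ v * (Y.card * (1 / 2) ^ v) * blockCount l -
        (Y.card : ℝ) * (Y.card - 1) * (blockCount l * ((1 / 2) ^ v * (1 / 2) ^ v)) =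
        Y.card * ((1 / 2) ^ v * (1 / 2) ^ v) * blockCount l := by ring
      have : 0 ≤ (Y.card : ℝ) * ((1 / 2) ^ v * (1 / 2) ^ v) * blockCount l := by positivity
      linarith
    have a4 : (Y.card : ℝ) * (blockCount l * (1 / 2) ^ v) = a * blockCount l := by rw [ha]; ring
    rw [a4]
    nlinarith [mul_nonneg (mul_nonneg (sub_nonneg.2 a1) (sub_nonneg.2 a2)) hb.le]
  linarith

/-- The blocks are independent: the set of bad strings is a product, and the failure probabilities
multiply. -/
theorem card_forall_not_isolates_le (L : ℕ) {Y : Finset ℕ} (hne : Y.Nonempty)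
    (hY : ∀ i ∈ Y, i < 2 ^ l) (hcard : 2 * Y.card < 2 ^ l) :
    ((Set.ncard {u : Fin L → Block l | ∀ a, ¬ Isolates (u a) Y} : ℕ) : ℝ) ≤
      (7 / 8) ^ L * blockCount l ^ L := by
  classical
  have h : {u : Fin L → Block l | ∀ a, ¬ Isolates (u a) Y} =
      ↑(Fintype.piFinset fun _ : Fin L => {u : Block l | ¬ Isolates u Y}.toFinset) := by
    ext u; simp
  rw [h, Set.ncard_coe_finset, Fintype.card_piFinset, Finset.prod_const, Finset.card_univ,
    Fintype.card_fin, Nat.cast_pow, ← mul_pow, ← Set.ncard_eq_toFinset_card']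
  exact pow_le_pow_left₀ (by positivity) (card_not_isolates_le hne hY hcard) L

/-- Splitting a string of bits into blocks. -/
def blockEquiv (L l : ℕ) : (Fin (L * (l * (l + 1))) → Bool) ≃ (Fin L → Block l) where
  toFun r a q h := r (finProdFinEquiv (a, finProdFinEquiv (q, h)))
  invFun u i := u (finProdFinEquiv.symm i).1 (finProdFinEquiv.symm (finProdFinEquiv.symm i).2).1
    (finProdFinEquiv.symm (finProdFinEquiv.symm i).2).2
  left_inv r := funext fun i => congrArg r (by
    rw [Prod.mk.eta, Equiv.apply_symm_apply, Prod.mk.eta, Equiv.apply_symm_apply])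
  right_inv u := by ext a q h; simp

/-- This matches the product structure used for counting with the flat bit addresses that `Survives`
and the program use. -/
theorem blockEquiv_bitSeq {L : ℕ} (r : Fin (L * (l * (l + 1))) → Bool) (a : Fin L) (q : Fin l)
    {h : ℕ} (hh : h < l + 1) :
    bitSeq (blockEquiv L l r a q) h = bitSeq r (a * (l * (l + 1)) + q * (l + 1) + h) := by
  have hlt : (a : ℕ) * (l * (l + 1)) + q * (l + 1) + h < L * (l * (l + 1)) := by
    have h1 : (q : ℕ) * (l + 1) + h < l * (l + 1) := by
      have := Nat.mul_le_mul_right (l + 1) (Nat.succ_le_of_lt q.2)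
      rw [Nat.succ_mul] at this; omega
    have := Nat.mul_le_mul_right (l * (l + 1)) (Nat.succ_le_of_lt a.2)
    rw [Nat.succ_mul] at this; omega
  simp only [bitSeq, hh, hlt, dif_pos, blockEquiv, Equiv.coe_fn_mk]
  congr 2
  ext
  simp only [finProdFinEquiv_apply_val]
  ring

/-- A test number `a * (l + 1) + v` encodes the block `a` and the level `v`; the level runs from `0`
to `l`, hence the base `l + 1`. -/
theorem survives_iff {L : ℕ} (r : Fin (L * (l * (l + 1))) → Bool) (a : Fin L) {v : ℕ} (hv : v ≤ l)
    (i : ℕ) : Survives l (bitSeq r) (a * (l + 1) + v) i ↔ Passes v (blockEquiv L l r a) i := by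
  have h1 : ((a : ℕ) * (l + 1) + v) % (l + 1) = v := by
    rw [Nat.mul_add_mod_self_right, Nat.mod_eq_of_lt (by omega)]
  have h2 : ((a : ℕ) * (l + 1) + v) / (l + 1) = a := by
    rw [Nat.mul_comm, Nat.mul_add_div (by omega), Nat.div_eq_of_lt (by omega), add_zero]
  have h3 : ∀ q : Fin l, parity l (fun h => bitSeq r (a * (l * (l + 1)) + q * (l + 1) + h)) i =
      parity l (bitSeq (blockEquiv L l r a q)) i := fun q =>
    Finset.sum_congr rfl fun g hg => by rw [blockEquiv_bitSeq r a q (Finset.mem_range.1 hg)]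
  simp only [Survives, Passes, h1, h2]
  constructor
  · intro h q hq; rw [← h3]; exact h q hq
  · intro h q hq; have := h ⟨q, by omega⟩ hq; rwa [← h3] at this

/-- With high probability, a random string isolates an element of each of finitely many nonempty
sets. -/
theorem prob_isolates {ι : Type} [Fintype ι] (L : ℕ) (Y : ι → Finset ℕ)
    (hY : ∀ a, ∀ i ∈ Y a, i < 2 ^ l) (hcard : ∀ a, 2 * (Y a).card < 2 ^ l) {η : ℝ}
    (hη : Fintype.card ι * (7 / 8 : ℝ) ^ L ≤ η) :
    1 - η ≤ prob fun r : Fin (L * (l * (l + 1))) → Bool => ∀ a, (Y a).Nonempty →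
      ∃ j < L * (l + 1), ((Y a).filter (Survives l (bitSeq r) j)).card = 1 := by
  classical
  set A : (Fin (L * (l * (l + 1))) → Bool) → Prop := fun r => ∀ a, (Y a).Nonempty →
      ∃ j < L * (l + 1), ((Y a).filter (Survives l (bitSeq r) j)).card = 1 with hA
  have hb : 0 < blockCount l := by unfold blockCount; positivity
  have hcardr : (Fintype.card (Fin (L * (l * (l + 1))) → Bool) : ℝ) = blockCount l ^ L := by
    rw [Fintype.card_congr (blockEquiv L l), Fintype.card_fun, Nat.cast_pow, card_block,
      Fintype.card_fin]
  -- Union bound: a bad string fails in all blocks for one of the nonempty sets.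
  have hsub : {r | ¬ A r} ⊆ ⋃ a ∈ Finset.univ.filter fun a => (Y a).Nonempty,
      (blockEquiv L l) ⁻¹' {u : Fin L → Block l | ∀ b, ¬ Isolates (u b) (Y a)} := by
    intro r hr
    simp only [hA, Set.mem_ofPred_eq, not_forall] at hr
    obtain ⟨a, ha, hno⟩ := hr
    simp only [Set.mem_iUnion, Set.mem_preimage, Set.mem_ofPred_eq]
    refine ⟨a, by simpa using ha, fun b hb => hno ?_⟩
    obtain ⟨v, hv, hc⟩ := hb
    refine ⟨b * (l + 1) + v, ?_, ?_⟩
    · have := Nat.mul_le_mul_right (l + 1) (Nat.succ_le_of_lt b.2)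
      rw [Nat.succ_mul] at this; omega
    · simpa only [survives_iff r b hv] using hc
  have hbad : ((Set.ncard {r | ¬ A r} : ℕ) : ℝ) ≤ η * blockCount l ^ L := by
    have h1 := Set.ncard_le_ncard hsub (Set.toFinite _)
    have h2 := Finset.set_ncard_biUnion_le (Finset.univ.filter fun a => (Y a).Nonempty)
      (fun a => (blockEquiv L l) ⁻¹' {u : Fin L → Block l | ∀ b, ¬ Isolates (u b) (Y a)})
    have h3 : ∀ a ∈ Finset.univ.filter fun a => (Y a).Nonempty,
        ((Set.ncard ((blockEquiv L l) ⁻¹' {u : Fin L → Block l | ∀ b, ¬ Isolates (u b) (Y a)}) : ℕ) : ℝ)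
          ≤ (7 / 8) ^ L * blockCount l ^ L := by
      intro a ha
      rw [Set.ncard_preimage_of_injective_subset_range (blockEquiv L l).injective
        (by simp [(blockEquiv L l).surjective.range_eq])]
      exact card_forall_not_isolates_le L (by simpa using ha) (hY a) (hcard a)
    calc ((Set.ncard {r | ¬ A r} : ℕ) : ℝ) ≤ ((∑ a ∈ Finset.univ.filter fun a => (Y a).Nonempty,
          Set.ncard ((blockEquiv L l) ⁻¹' {u : Fin L → Block l | ∀ b, ¬ Isolates (u b) (Y a)}) : ℕ) : ℝ) := by
          exact_mod_cast h1.trans h2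
      _ ≤ ∑ a ∈ Finset.univ.filter fun a => (Y a).Nonempty, (7 / 8) ^ L * blockCount l ^ L := by
          rw [Nat.cast_sum]; exact Finset.sum_le_sum h3
      _ ≤ ∑ a : ι, (7 / 8) ^ L * blockCount l ^ L :=
          Finset.sum_le_sum_of_subset_of_nonneg (Finset.filter_subset _ _)
            (fun _ _ _ => by positivity)
      _ = Fintype.card ι * (7 / 8 : ℝ) ^ L * blockCount l ^ L := by
          rw [Finset.sum_const, nsmul_eq_mul, Finset.card_univ]; ring
      _ ≤ η * blockCount l ^ L := by gcongr
  have htot : ((Set.ncard {r | A r} : ℕ) : ℝ) + ((Set.ncard {r | ¬ A r} : ℕ) : ℝ) =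
      blockCount l ^ L := by
    rw [← hcardr, ← Nat.card_eq_fintype_card, ← Set.ncard_add_ncard_compl {r | A r}]
    push_cast; rfl
  unfold prob
  rw [hcardr, le_div_iff₀ (by positivity)]
  linarith

end isolation

end AMStream
namespace AMStream
open Polynomial

/-! ### The low-degree polynomial of an instance -/

theorem sum_range_mul {M : Type*} [AddCommMonoid M] (f : ℕ → M) (a b : ℕ) :
    ∑ i ∈ Finset.range (a * b), f i =
      ∑ u ∈ Finset.range a, ∑ v ∈ Finset.range b, f (u * b + v) := by
  induction a with
  | zero => simp
  | succ a ih => rw [Nat.succ_mul, Finset.sum_range_add, ih, Finset.sum_range_succ]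

/-- The data from which the sum over the alphabet is computed: the letters are arranged in a grid
with `s` columns and `w` rows, and each of the `D` tests of a clause adds up the literals at the
selected positions. -/
structure Grid where
  s : ℕ
  w : ℕ
  m : ℕ
  n : ℕ
  k : ℕ
  D : ℕ
  lit : ℕ → ℕ → ℕ
  letter : ℕ → ℕ
  sel : ℕ → ℕ → Prop
  decSel : ∀ l i, Decidable (sel l i)
  psi : ℕ → ℤ

namespace Grid
variable (I : Grid) (p : ℕ)

instance (l i : ℕ) : Decidable (I.sel l i) := I.decSel l i

/-- The Lagrange basis polynomial at `b` for the nodes `0, …, w - 1`. -/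
noncomputable def lam (b : ℕ) : (ZMod p)[X] :=
  ∏ v ∈ Finset.range I.w, if v = b then 1 else (X - C (v : ZMod p)) * C (((b : ZMod p) - v) ^ (p - 2))

/-- The extension of the literal with code `c`, in column `a`. -/
noncomputable def litPoly (c a : ℕ) : (ZMod p)[X] :=
  C ((c % 2 : ℕ) : ZMod p) + ∑ i ∈ Finset.range I.m,
    (if a = I.letter i % I.s then I.lam p (I.letter i / I.s) else 0) *
      C ((if c = 2 * i + 2 then 1 else 0) - (if c = 2 * i + 3 then 1 else 0))

/-- The extension of the number of satisfied literals of clause `t` selected by test `l`. -/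
noncomputable def count (a t l : ℕ) : (ZMod p)[X] :=
  ∑ i ∈ Finset.range I.m, if I.sel l i then I.litPoly p (I.lit t i) a else 0

/-- The extension of the negation of clause `t`. -/
noncomputable def clauseNot (a t : ℕ) : (ZMod p)[X] :=
  ∏ l ∈ Finset.range I.D, (1 - I.count p a t l)

/-- The extension of the indicator of the occupied cells of column `a`. -/
noncomputable def mask (a : ℕ) : (ZMod p)[X] :=
  ∑ b ∈ Finset.range I.w, if a + I.s * b < I.n then I.lam p b else 0

/-- The extension of the summand of column `a`. -/
noncomputable def column (a : ℕ) : (ZMod p)[X] :=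
  ∑ x ∈ Finset.range (2 ^ I.k), C ((I.psi x : ℤ) : ZMod p) *
    ∏ t ∈ Finset.range I.k, if x.testBit t then 1 - I.clauseNot p a t else I.clauseNot p a t

/-- The sum over the columns. -/
noncomputable def total : (ZMod p)[X] :=
  ∑ a ∈ Finset.range I.s, I.mask p a * I.column p a

theorem natDegree_lam_le (b : ℕ) : (I.lam p b).natDegree ≤ I.w := by
  refine (natDegree_prod_le _ _).trans ?_
  refine (Finset.sum_le_card_nsmul _ _ 1 fun v _ => ?_).trans (by simp)
  split_ifs
  · simp
  · exact (natDegree_mul_C_le _ _).trans (natDegree_X_sub_C_le _)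

theorem natDegree_litPoly_le (c a : ℕ) : (I.litPoly p c a).natDegree ≤ I.w := by
  refine (natDegree_add_le _ _).trans (max_le (by simp) ?_)
  refine natDegree_sum_le_of_forall_le _ _ fun i _ => (natDegree_mul_C_le _ _).trans ?_
  split_ifs
  · exact I.natDegree_lam_le p _
  · simp

theorem natDegree_count_le (a t l : ℕ) : (I.count p a t l).natDegree ≤ I.w := by
  refine natDegree_sum_le_of_forall_le _ _ fun i _ => ?_
  split_ifs
  · exact I.natDegree_litPoly_le p _ _
  · simp

theorem natDegree_clauseNot_le (a t : ℕ) : (I.clauseNot p a t).natDegree ≤ I.D * I.w := by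
  refine (natDegree_prod_le _ _).trans ?_
  refine (Finset.sum_le_card_nsmul _ _ I.w fun l _ => ?_).trans (by simp)
  exact (natDegree_sub_le _ _).trans (max_le (by simp) (I.natDegree_count_le p _ _ _))

theorem natDegree_mask_le (a : ℕ) : (I.mask p a).natDegree ≤ I.w := by
  refine natDegree_sum_le_of_forall_le _ _ fun i _ => ?_
  split_ifs
  · exact I.natDegree_lam_le p _
  · simp

theorem natDegree_column_le (a : ℕ) : (I.column p a).natDegree ≤ I.k * (I.D * I.w) := by
  refine natDegree_sum_le_of_forall_le _ _ fun x _ => (natDegree_C_mul_le _ _).trans ?_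
  refine (natDegree_prod_le _ _).trans ?_
  refine (Finset.sum_le_card_nsmul _ _ (I.D * I.w) fun l _ => ?_).trans (by simp)
  split_ifs
  · exact (natDegree_sub_le _ _).trans (max_le (by simp) (I.natDegree_clauseNot_le p _ _))
  · exact I.natDegree_clauseNot_le p _ _

/-- Each of the `k` clauses contributes `D` factors of degree `w`, and the mask contributes one more
`w`. This degree determines both the proof length and the soundness error. -/
theorem natDegree_total_le : (I.total p).natDegree ≤ (I.k * I.D + 1) * I.w := by
  refine natDegree_sum_le_of_forall_le _ _ fun a _ => natDegree_mul_le.trans ?_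
  have := I.natDegree_mask_le p a
  have := I.natDegree_column_le p a
  calc _ ≤ I.w + I.k * (I.D * I.w) := by omega
    _ = _ := by ring

variable [hp : Fact p.Prime]

/-- The condition `w ≤ p` keeps the nodes `0, …, w - 1` distinct in the field, so that the
differences in the denominators are invertible. -/
theorem eval_lam {b c : ℕ} (hw : I.w ≤ p) (hb : b < I.w) (hc : c < I.w) :
    (I.lam p b).eval (c : ZMod p) = if b = c then 1 else 0 := by
  have hcast : ∀ {u v : ℕ}, u < I.w → v < I.w → ((u : ZMod p) - v = 0 ↔ u = v) := by
    intro u v hu hv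
    rw [sub_eq_zero, ZMod.natCast_eq_natCast_iff', Nat.mod_eq_of_lt (by omega),
      Nat.mod_eq_of_lt (by omega)]
  rw [lam, eval_prod]
  split_ifs with h
  · subst h
    refine Finset.prod_eq_one fun v hv => ?_
    split_ifs with hv'
    · simp
    · have hne : (b : ZMod p) - v ≠ 0 := fun h0 => hv' ((hcast hb (Finset.mem_range.1 hv)).1 h0).symm
      rw [eval_mul, eval_C, eval_sub, eval_X, eval_C, ← pow_succ']
      have h2 := hp.out.two_le
      rw [show p - 2 + 1 = p - 1 by omega]
      -- The power `p - 2` in `lam` is the inverse by Fermat's little theorem, which lets the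
      -- program compute it as a product.
      exact ZMod.pow_card_sub_one_eq_one hne
  · refine Finset.prod_eq_zero (Finset.mem_range.2 hc) ?_
    rw [if_neg (Ne.symm h)]
    simp

end Grid

/-- The bits of a number below `2 ^ k`. -/
theorem prod_testBit {R : Type*} [CommRing R] (k : ℕ) (y : ℕ → Bool) (f : ℕ → R) :
    ∑ x ∈ Finset.range (2 ^ k), f x * ∏ t ∈ Finset.range k,
      (if x.testBit t then 1 - (if y t then (0 : R) else 1) else (if y t then 0 else 1)) =
    f (Nat.ofBits fun t : Fin k => y t) := by
  have hlt : Nat.ofBits (fun t : Fin k => y t) < 2 ^ k := Nat.ofBits_lt_two_pow _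
  rw [Finset.sum_eq_single_of_mem _ (Finset.mem_range.2 hlt)]
  · rw [Finset.prod_eq_one, mul_one]
    intro t ht
    rw [Nat.testBit_ofBits_lt _ _ (Finset.mem_range.1 ht)]
    simp only
    cases y t <;> simp
  · intro x hx hne
    have : ∃ t < k, x.testBit t ≠ y t := by
      by_contra! h
      refine hne (Nat.eq_of_testBit_eq fun t => ?_)
      rcases lt_or_ge t k with ht | ht
      · rw [h t ht, Nat.testBit_ofBits_lt _ _ ht]
      · rw [Nat.testBit_ofBits_ge _ _ ht, Nat.testBit_lt_two_pow
          ((Finset.mem_range.1 hx).trans_le (Nat.pow_le_pow_right (by norm_num) ht))]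
    obtain ⟨t, ht, hne⟩ := this
    rw [Finset.prod_eq_zero (Finset.mem_range.2 ht), mul_zero]
    revert hne
    cases x.testBit t <;> cases y t <;> simp

/-- The stream as a sequence of numbers. -/
def Stream.letter {m n : ℕ} (σ : Stream m n) (i : ℕ) : ℕ := if h : i < m then (σ ⟨i, h⟩ : ℕ) else 0

/-- The positions of the satisfied literals of a clause. -/
def satisfied {m : ℕ} (c : Clause m) (x : Fin m → Bool) : Finset ℕ :=
  (Finset.univ.filter fun i : Fin m => (c i).value x = true).map Fin.valEmbedding

theorem satisfied_nonempty {m : ℕ} (c : Clause m) (x : Fin m → Bool) :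
    (satisfied c x).Nonempty ↔ c.value x = true := by
  simp [satisfied, Clause.value, Finset.filter_nonempty_iff]

theorem mem_satisfied_lt {m : ℕ} {c : Clause m} {x : Fin m → Bool} {i : ℕ} (h : i ∈ satisfied c x) :
    i < m := by
  simp only [satisfied, Finset.mem_map] at h
  obtain ⟨j, -, rfl⟩ := h
  exact j.2

theorem card_satisfied_le {m : ℕ} (c : Clause m) (x : Fin m → Bool) : (satisfied c x).card ≤ m := by
  rw [satisfied, Finset.card_map]
  exact (Finset.card_le_univ _).trans (by simp)

/-! ### The polynomial of a data stream at the row numbers -/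

section semantics
variable {m n k : ℕ}

/-- The codes of the literals of a family of clauses. -/
def litCode (C : Fin k → Clause m) (t i : ℕ) : ℕ :=
  if ht : t < k then if hi : i < m then (C ⟨t, ht⟩ ⟨i, hi⟩).code else 0 else 0

/-- The grid of a data stream. -/
def streamGrid (C : Fin k → Clause m) (ψ : (Fin k → Bool) → ℤ) (σ : Stream m n) (s w D : ℕ)
    (sel : ℕ → ℕ → Prop) [∀ l i, Decidable (sel l i)] : Grid where
  s := s
  w := w
  m := m
  n := n
  k := k
  D := D
  lit := litCode C
  letter := σ.letter
  sel := sel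
  decSel := inferInstance
  psi x := ψ fun t => x.testBit t

variable (C : Fin k → Clause m) (ψ : (Fin k → Bool) → ℤ) (σ : Stream m n) (s w D : ℕ)
    (sel : ℕ → ℕ → Prop) [∀ l i, Decidable (sel l i)] (p : ℕ) [hp : Fact p.Prime]

theorem grid_eq_iff {s a b j : ℕ} (ha : a < s) : (a = j % s ∧ j / s = b) ↔ j = a + s * b := by
  constructor
  · rintro ⟨h, rfl⟩; subst h; exact (Nat.mod_add_div j s).symm
  · rintro rfl
    rw [Nat.add_mul_mod_self_left, Nat.mod_eq_of_lt ha, Nat.add_mul_div_left _ _ (by omega),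
      Nat.div_eq_of_lt ha]
    simp

/-- The parity of the code supplies the constant term: `1` for negated variables and for the
constant true. The sum adds the indicator of a positive variable or subtracts that of a negated one.
-/
theorem eval_litPoly (hw : w ≤ p) (hn : n ≤ s * w) (L : Literal m) {a b : ℕ} (ha : a < s)
    (hb : b < w) (j : Fin n) (hj : (j : ℕ) = a + s * b) :
    ((streamGrid C ψ σ s w D sel).litPoly p L.code a).eval (b : ZMod p) =
      if L.value (indicator σ j) then 1 else 0 := by
  set I := streamGrid C ψ σ s w D sel with hI
  have hcell : ∀ i : Fin m, (if a = I.letter i % I.s then I.lam p (I.letter i / I.s) else 0).eval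
      (b : ZMod p) = if σ i = j then 1 else 0 := by
    intro i
    have hl : I.letter i = σ i := by simp [hI, streamGrid, Stream.letter]
    have hrow : (σ i : ℕ) / s < w := Nat.div_lt_of_lt_mul ((σ i).2.trans_le hn)
    have hs : I.s = s := rfl
    rw [hl, hs]
    have key := grid_eq_iff (b := b) (j := (σ i : ℕ)) ha
    split_ifs with h1 h2 h2
    · rw [I.eval_lam p hw hrow hb, if_pos (key.2 (by rw [h2, hj])).2]
    · rw [I.eval_lam p hw hrow hb, if_neg]
      intro h3
      exact h2 (Fin.ext (by rw [hj]; exact key.1 ⟨h1, h3⟩))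
    · exact absurd (key.2 (by rw [h2, hj])).1 h1
    · simp
  have hsum : ∀ g : ℕ → ZMod p, (∑ i ∈ Finset.range I.m,
      (if a = I.letter i % I.s then I.lam p (I.letter i / I.s) else 0) * Polynomial.C (g i)).eval
        (b : ZMod p) = ∑ i : Fin m, (if σ i = j then 1 else 0) * g i := by
    intro g
    rw [eval_finsetSum, show I.m = m from rfl, Finset.sum_range]
    exact Finset.sum_congr rfl fun i _ => by rw [eval_mul, eval_C, hcell]
  rw [Grid.litPoly, eval_add, eval_C, hsum]
  cases L with
  | const v =>
    rw [Finset.sum_eq_zero]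
    · cases v <;> simp [Literal.code, Literal.value]
    · intro i _
      cases v
      · simp [Literal.code]
      · have : ¬ (1 = 2 * (i : ℕ) + 2) := by omega
        have : ¬ (1 = 2 * (i : ℕ) + 3) := by omega
        simp [Literal.code]
  | pos i₀ =>
    have h1 : ∀ i : Fin m, (2 * (i₀ : ℕ) + 2 = 2 * (i : ℕ) + 2) ↔ i = i₀ := by
      intro i; rw [Fin.ext_iff]; omega
    have h2 : ∀ i : Fin m, ¬ (2 * (i₀ : ℕ) + 2 = 2 * (i : ℕ) + 3) := by intro i; omega
    have h3 : (2 * (i₀ : ℕ) + 2) % 2 = 0 := by omega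
    simp only [Literal.code, h1, h2, h3, if_false, sub_zero, Nat.cast_zero, zero_add, mul_ite,
      mul_one, mul_zero, Finset.sum_ite_eq', Finset.mem_univ, if_true]
    simp [Literal.value, indicator]
  | neg i₀ =>
    have h1 : ∀ i : Fin m, (2 * (i₀ : ℕ) + 3 = 2 * (i : ℕ) + 3) ↔ i = i₀ := by
      intro i; rw [Fin.ext_iff]; omega
    have h2 : ∀ i : Fin m, ¬ (2 * (i₀ : ℕ) + 3 = 2 * (i : ℕ) + 2) := by intro i; omega
    have h3 : (2 * (i₀ : ℕ) + 3) % 2 = 1 := by omega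
    simp only [Literal.code, h1, h2, h3, if_false, zero_sub, Nat.cast_one, mul_ite,
      mul_neg, mul_one, mul_zero]
    by_cases h : σ i₀ = j <;> simp [Literal.value, indicator, h]

/-- The tests detect every satisfied clause on the given stream. -/
def Detects : Prop := ∀ (j : Fin n) (t : Fin k), (satisfied (C t) (indicator σ j)).Nonempty →
  ∃ l < D, ((satisfied (C t) (indicator σ j)).filter (sel l)).card = 1

/-- At a row number every literal polynomial takes its Boolean value, so adding them up counts
satisfied selected literals. -/
theorem eval_count (hw : w ≤ p) (hn : n ≤ s * w) {a b : ℕ} (ha : a < s) (hb : b < w) (j : Fin n)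
    (hj : (j : ℕ) = a + s * b) (t : Fin k) (l : ℕ) :
    ((streamGrid C ψ σ s w D sel).count p a t l).eval (b : ZMod p) =
      ((satisfied (C t) (indicator σ j)).filter (sel l)).card := by
  rw [Grid.count, eval_finsetSum, Finset.card_eq_sum_ones, Nat.cast_sum, Finset.sum_filter,
    satisfied, Finset.sum_map, Finset.sum_filter, show (streamGrid C ψ σ s w D sel).m = m from rfl,
    Finset.sum_range]
  refine Finset.sum_congr rfl fun i _ => ?_
  have hc : (streamGrid C ψ σ s w D sel).lit t i = (C t i).code := by
    simp [streamGrid, litCode]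
  rw [hc]
  have hl := eval_litPoly C ψ σ s w D sel p hw hn (C t i) ha hb j hj
  by_cases h1 : sel l i
  · rw [if_pos (show (streamGrid C ψ σ s w D sel).sel l i from h1), hl]
    simp [h1]
  · rw [if_neg (show ¬ (streamGrid C ψ σ s w D sel).sel l i from h1)]
    simp [h1]

/-- For a satisfied clause the isolating test gives the factor `1 - 1`, and the other counts do not
matter. For an unsatisfied clause all counts are `0`. -/
theorem eval_clauseNot (hw : w ≤ p) (hn : n ≤ s * w) (hd : Detects C σ D sel) {a b : ℕ} (ha : a < s)
    (hb : b < w) (j : Fin n) (hj : (j : ℕ) = a + s * b) (t : Fin k) :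
    ((streamGrid C ψ σ s w D sel).clauseNot p a t).eval (b : ZMod p) =
      if (C t).value (indicator σ j) then 0 else 1 := by
  rw [Grid.clauseNot, eval_prod]
  by_cases h : (C t).value (indicator σ j) = true
  · rw [if_pos h]
    obtain ⟨l, hl, hc⟩ := hd j t ((satisfied_nonempty _ _).2 h)
    refine Finset.prod_eq_zero (Finset.mem_range.2 hl) ?_
    rw [eval_sub, eval_count C ψ σ s w D sel p hw hn ha hb j hj, hc]
    simp
  · rw [if_neg h]
    refine Finset.prod_eq_one fun l _ => ?_
    have he : satisfied (C t) (indicator σ j) = ∅ := by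
      rw [← Finset.not_nonempty_iff_eq_empty, satisfied_nonempty]; exact h
    rw [eval_sub, eval_count C ψ σ s w D sel p hw hn ha hb j hj, he]
    simp

/-- The products over the clauses form the interpolation basis on the Boolean cube, so only the term
whose binary digits are the clause values survives. -/
theorem eval_column (hw : w ≤ p) (hn : n ≤ s * w) (hd : Detects C σ D sel) {a b : ℕ} (ha : a < s)
    (hb : b < w) (j : Fin n) (hj : (j : ℕ) = a + s * b) :
    ((streamGrid C ψ σ s w D sel).column p a).eval (b : ZMod p) =
      ((ψ fun t => (C t).value (indicator σ j) : ℤ) : ZMod p) := by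
  set I := streamGrid C ψ σ s w D sel with hI
  set y : ℕ → Bool := fun t => if h : t < k then (C ⟨t, h⟩).value (indicator σ j) else false with hy
  have h := prod_testBit k y (fun x => ((I.psi x : ℤ) : ZMod p))
  have h2 : I.psi (Nat.ofBits fun t : Fin k => y t) = ψ fun t => (C t).value (indicator σ j) := by
    simp only [hI, streamGrid]
    congr 1
    ext t
    rw [Nat.testBit_ofBits_lt _ _ t.2]
    simp [hy]
  rw [h2] at h
  rw [← h, Grid.column, eval_finsetSum]
  refine Finset.sum_congr rfl fun x _ => ?_
  rw [eval_mul, eval_C, eval_prod]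
  congr 1
  refine Finset.prod_congr rfl fun t ht => ?_
  have hc := eval_clauseNot C ψ σ s w D sel p hw hn hd ha hb j hj ⟨t, Finset.mem_range.1 ht⟩
  have hyt : y t = (C ⟨t, Finset.mem_range.1 ht⟩).value (indicator σ j) := by
    simp only [hy]; rw [dif_pos]
  rw [hyt]
  split_ifs <;> simp_all

/-- Summing over rows and columns visits every grid cell once. The mask removes the cells that carry
no letter; they would otherwise contribute values of `ψ`. -/
theorem sum_eval_total (hw : w ≤ p) (hn : n ≤ s * w) (hd : Detects C σ D sel) :
    ∑ b ∈ Finset.range w, ((streamGrid C ψ σ s w D sel).total p).eval (b : ZMod p) =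
      ((∑ j : Fin n, ψ fun t => (C t).value (indicator σ j) : ℤ) : ZMod p) := by
  set I := streamGrid C ψ σ s w D sel with hI
  set F : ℕ → ZMod p := fun i => if h : i < n then
    ((ψ fun t => (C t).value (indicator σ ⟨i, h⟩) : ℤ) : ZMod p) else 0 with hF
  have h1 : ∀ b ∈ Finset.range w, (I.total p).eval (b : ZMod p) =
      ∑ a ∈ Finset.range s, F (b * s + a) := by
    intro b hb
    rw [Finset.mem_range] at hb
    rw [Grid.total, eval_finsetSum]
    refine Finset.sum_congr rfl fun a ha => ?_
    have ha' : a < s := Finset.mem_range.1 ha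
    have hmask : (I.mask p a).eval (b : ZMod p) = if a + s * b < n then 1 else 0 := by
      rw [Grid.mask, eval_finsetSum, show I.w = w from rfl, Finset.sum_eq_single_of_mem b (Finset.mem_range.2 hb)]
      · rw [show I.s = s from rfl, show I.n = n from rfl]
        split_ifs
        · rw [I.eval_lam p hw hb hb, if_pos rfl]
        · simp
      · intro c hc hne
        split_ifs
        · rw [I.eval_lam p hw (Finset.mem_range.1 hc) hb, if_neg hne]
        · simp
    rw [eval_mul, hmask]
    have hcomm : b * s + a = a + s * b := by ring
    simp only [hF, hcomm]
    by_cases h : a + s * b < n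
    · rw [if_pos h, dif_pos h, one_mul]
      exact eval_column C ψ σ s w D sel p hw hn hd ha' hb ⟨a + s * b, h⟩ rfl
    · rw [if_neg h, dif_neg h, zero_mul]
  rw [Finset.sum_congr rfl h1, ← sum_range_mul]
  push_cast
  -- The cells are split at `n`: the cells below `n` carry the letters, and the rest vanish.
  have : (Finset.range (w * s)) = Finset.range (n + (w * s - n)) := by
    rw [Nat.add_sub_cancel' (by rw [mul_comm]; exact hn)]
  rw [this, Finset.sum_range_add, Finset.sum_eq_zero (s := Finset.range (w * s - n)), add_zero,
    Finset.sum_range]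
  · exact Finset.sum_congr rfl fun i _ => by simp [hF]
  · intro i _
    simp [hF]

end semantics

/-! ### Proofs as polynomials -/

/-- The bits of a proof stream, continued by zeros. -/
def proofBit (ω : List Bool) (i : ℕ) : ℕ := proofSymbol (ω.drop i) / 2

/-- The polynomial whose coefficients are written in blocks of `v` bits. -/
noncomputable def proofPoly (p v N : ℕ) (ω : List Bool) : (ZMod p)[X] :=
  ∑ i ∈ Finset.range N, C ((proofBit ω i * 2 ^ (i % v) : ℕ) : ZMod p) * X ^ (i / v)

/-- Every bit string decodes to a polynomial within the degree bound, so the verifier needs no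
degree test and no check of the format. -/
theorem natDegree_proofPoly_le (p v d : ℕ) (ω : List Bool) :
    (proofPoly p v ((d + 1) * v) ω).natDegree ≤ d := by
  refine natDegree_sum_le_of_forall_le _ _ fun i hi => (natDegree_C_mul_X_pow_le _ _).trans ?_
  have := Nat.div_lt_of_lt_mul (by rw [mul_comm]; exact Finset.mem_range.1 hi : i < v * (d + 1))
  omega

theorem sum_testBit {v x : ℕ} (hx : x < 2 ^ v) :
    ∑ i ∈ Finset.range v, (x.testBit i).toNat * 2 ^ i = x := by
  induction v generalizing x with
  | zero => simp at hx ⊢; omega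
  | succ v ih =>
    rw [Finset.sum_range_succ']
    have h := ih (x := x / 2) (by rw [pow_succ] at hx; omega)
    have h2 : ∑ i ∈ Finset.range v, (x.testBit (i + 1)).toNat * 2 ^ (i + 1) = 2 * (x / 2) := by
      conv_rhs => rw [← h]
      rw [Finset.mul_sum]
      refine Finset.sum_congr rfl fun i _ => ?_
      rw [Nat.testBit_succ]; ring
    rw [h2, Nat.testBit_zero]
    rcases Nat.mod_two_eq_zero_or_one x with h3 | h3 <;> simp [h3] <;> omega

theorem proofBit_ofFn {N : ℕ} (f : Fin N → Bool) (i : Fin N) :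
    proofBit (List.ofFn f) i = (f i).toNat := by
  have : (List.ofFn f).drop i = f i :: (List.ofFn f).drop (i + 1) := by
    rw [List.drop_eq_getElem_cons (by simp)]
    simp
  rw [proofBit, this]
  cases f i <;> simp [proofSymbol]

/-- A residue fits into `v` bits because `p ≤ 2 ^ v`. The encoding need not be unique, since a block
of bits may exceed `p`. -/
theorem exists_proofPoly_eq {p : ℕ} [hp : Fact p.Prime] {v d : ℕ} (hpv : p ≤ 2 ^ v) {G : (ZMod p)[X]}
    (hG : G.natDegree ≤ d) :
    ∃ ω : List Bool, ω.length = (d + 1) * v ∧ proofPoly p v ((d + 1) * v) ω = G := by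
  refine ⟨List.ofFn fun i : Fin ((d + 1) * v) => (G.coeff (i / v)).val.testBit (i % v), by simp, ?_⟩
  have h1 : ∀ i ∈ Finset.range ((d + 1) * v), proofBit (List.ofFn fun i : Fin ((d + 1) * v) =>
      (G.coeff (i / v)).val.testBit (i % v)) i = ((G.coeff (i / v)).val.testBit (i % v)).toNat :=
    fun i hi => proofBit_ofFn _ ⟨i, Finset.mem_range.1 hi⟩
  rw [proofPoly, Finset.sum_congr rfl fun i hi => by rw [h1 i hi], sum_range_mul]
  conv_rhs => rw [G.as_sum_range' (d + 1) (by omega)]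
  refine Finset.sum_congr rfl fun e _ => ?_
  have h2 : ∀ i ∈ Finset.range v, (e * v + i) % v = i ∧ (e * v + i) / v = e := by
    intro i hi
    rw [Finset.mem_range] at hi
    rw [Nat.mul_add_mod_self_right, Nat.mod_eq_of_lt hi, mul_comm e v, Nat.mul_add_div (by omega),
      Nat.div_eq_of_lt hi]
    simp
  rw [Finset.sum_congr rfl fun i hi => by rw [(h2 i hi).1, (h2 i hi).2], ← Finset.sum_mul,
    ← C_mul_X_pow_eq_monomial, ← map_sum, ← Nat.cast_sum,
    sum_testBit ((ZMod.val_lt _).trans_le hpv)]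
  simp

end AMStream
namespace AMStream

/-! ### Writing terms -/

namespace Term

instance : Add Term := ⟨.op .add⟩
instance : Sub Term := ⟨.op .sub⟩
instance : Mul Term := ⟨.op .mul⟩
instance : Div Term := ⟨.op .div⟩
instance : Mod Term := ⟨.op .mod⟩
instance (v : ℕ) : OfNat Term v := ⟨.const v⟩

/-- The comparison `a < b`. -/
def lt (a b : Term) : Term := .op .lt a b
/-- The comparison `a = b`. -/
def eq (a b : Term) : Term := (1 - lt a b) * (1 - lt b a)
/-- The sum of `b` over `x < N` modulo `q`. -/
def sum (q : Term) (x : ℕ) (N b : Term) : Term := .fold .add 0 q x N b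
/-- The product of `b` over `x < N` modulo `q`. -/
def prod (q : Term) (x : ℕ) (N b : Term) : Term := .fold .mul 1 q x N b
/-- A constant power. -/
def pow (T : Term) : ℕ → Term
  | 0 => 1
  | e + 1 => pow T e * T

variable (E : Env) (A ρ : ℕ → ℕ) (a b : Term)

@[simp] theorem eval_add : (a + b).eval E A ρ = a.eval E A ρ + b.eval E A ρ := (rfl)
@[simp] theorem eval_sub : (a - b).eval E A ρ = a.eval E A ρ - b.eval E A ρ := (rfl)
@[simp] theorem eval_mul : (a * b).eval E A ρ = a.eval E A ρ * b.eval E A ρ := (rfl)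
@[simp] theorem eval_div : (a / b).eval E A ρ = a.eval E A ρ / b.eval E A ρ := (rfl)
@[simp] theorem eval_mod : (a % b).eval E A ρ = a.eval E A ρ % b.eval E A ρ := (rfl)
@[simp] theorem eval_lt : (lt a b).eval E A ρ = if a.eval E A ρ < b.eval E A ρ then 1 else 0 := (rfl)
@[simp] theorem eval_ofNat (v : ℕ) :
    (ofNat(v) : Term).eval E A ρ = OfNat.ofNat v := (rfl)
@[simp] theorem eval_zero : (0 : Term).eval E A ρ = 0 := (rfl)
@[simp] theorem eval_one : (1 : Term).eval E A ρ = 1 := (rfl)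
@[simp] theorem eval_const (v : ℕ) : (Term.const v).eval E A ρ = v := (rfl)
@[simp] theorem eval_var (x : ℕ) : (Term.var x).eval E A ρ = ρ x := (rfl)
@[simp] theorem eval_param (p : Param) (h : p ≠ .w) : (Term.param p h).eval E A ρ = E.param p := (rfl)
@[simp] theorem eval_arr : (Term.arr a).eval E A ρ = A (a.eval E A ρ) := (rfl)
@[simp] theorem eval_common : (Term.common a).eval E A ρ = E.common (a.eval E A ρ) := (rfl)
@[simp] theorem eval_literal :
    (Term.literal a b).eval E A ρ = E.literal (a.eval E A ρ) (b.eval E A ρ) := (rfl)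
@[simp] theorem eval_psiPos : (Term.psiPos a).eval E A ρ = (E.psi (a.eval E A ρ)).toNat := (rfl)
@[simp] theorem eval_psiNeg : (Term.psiNeg a).eval E A ρ = (-E.psi (a.eval E A ρ)).toNat := (rfl)

@[simp] theorem eval_eq :
    (eq a b).eval E A ρ = if a.eval E A ρ = b.eval E A ρ then 1 else 0 := by
  simp only [eq, eval_mul, eval_sub, eval_one, eval_lt]
  split_ifs <;> omega

@[simp] theorem eval_pow (e : ℕ) : (pow a e).eval E A ρ = a.eval E A ρ ^ e := by
  induction e with
  | zero => rfl
  | succ e ih => rw [pow, eval_mul, ih, pow_succ]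

theorem eval_sum (q : Term) (x : ℕ) (N : Term) (hq : 0 < q.eval E A ρ) :
    (sum q x N b).eval E A ρ =
      (∑ j ∈ Finset.range (N.eval E A ρ), b.eval E A (Function.update ρ x j)) % q.eval E A ρ := by
  simp only [sum, eval]
  set Q := q.eval E A ρ
  induction N.eval E A ρ with
  | zero => simp [foldVal]
  | succ N ih =>
    rw [foldVal, ih, Finset.sum_range_succ, Nat.sub_add_cancel hq]
    simp [BinOp.value]

theorem eval_prod (q : Term) (x : ℕ) (N : Term) (hq : 0 < q.eval E A ρ) :
    (prod q x N b).eval E A ρ =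
      (∏ j ∈ Finset.range (N.eval E A ρ), b.eval E A (Function.update ρ x j)) % q.eval E A ρ := by
  simp only [prod, eval]
  set Q := q.eval E A ρ
  induction N.eval E A ρ with
  | zero => simp [foldVal, Nat.sub_add_cancel hq]
  | succ N ih =>
    rw [foldVal, ih, Finset.prod_range_succ, Nat.sub_add_cancel hq]
    simp [BinOp.value]

end Term

/-- Products modulo `2` are how the term language expresses a bounded universal quantifier. -/
theorem prod_mod_two (f : ℕ → ℕ) (N : ℕ) :
    (∏ j ∈ Finset.range N, f j) % 2 = if ∀ j < N, f j % 2 = 1 then 1 else 0 := by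
  induction N with
  | zero => simp
  | succ N ih =>
    rw [Finset.prod_range_succ, Nat.mul_mod, ih]
    have h : (∀ j < N + 1, f j % 2 = 1) ↔ (∀ j < N, f j % 2 = 1) ∧ f N % 2 = 1 := by
      constructor
      · exact fun h => ⟨fun j hj => h j (by omega), h N (by omega)⟩
      · rintro ⟨h1, h2⟩ j hj
        rcases Nat.lt_succ_iff_lt_or_eq.1 hj with h | rfl
        · exact h1 j h
        · exact h2
    by_cases hN : ∀ j < N, f j % 2 = 1
    · rw [if_pos hN]
      rcases Nat.mod_two_eq_zero_or_one (f N) with h0 | h0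
      · rw [h0, if_neg fun hh => by have := (h.1 hh).2; omega]
      · rw [h0, if_pos (h.2 ⟨hN, h0⟩)]
    · rw [if_neg hN, if_neg fun hh => hN (h.1 hh).1]; simp

namespace Term

/-! ### Parameters -/

/-- The stream length. -/
def length : Term := .param .length (by simp)
/-- The size of the alphabet. -/
def alphabet : Term := .param .alphabet (by simp)
/-- The number of clauses. -/
def clauses : Term := .param .clauses (by simp)
/-- The space parameter. -/
def space : Term := .param .s (by simp)
/-- The inverse error probability. -/
def invError : Term := .param .invError (by simp)

/-- A quantity of the order of the input size. -/
def bulk : Term := 2 * (length + alphabet + invError)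

/-- The bit length of `bulk`, as the number of its divisors among powers of two. -/
def bulkSize : Term :=
  sum (bulk + 1) 20 bulk (eq (prod (.var 20 + 1) 21 bulk 2) 0)

/-- The power `2 ^ (κ * var 2)`. -/
def bigPow (κ : ℕ) : Term := pow (prod (2 * bulk + 1) 20 (.var 2) 2) κ

/-- The indicator of `var 15 + 1 + var 21` being prime. -/
def isPrime : Term :=
  prod 2 22 (.var 15 + 1 + .var 21 - 2) (lt 0 ((.var 15 + 1 + .var 21) % (.var 22 + 2)))

/-- The least prime greater than `var 15`. -/
def nextPrime : Term :=
  .var 15 + 1 + sum (2 * .var 15) 20 (.var 15) (prod 2 21 (.var 20 + 1) (1 - isPrime))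

/-- The number of columns. -/
def columns : Term := space * lt space alphabet + alphabet * (1 - lt space alphabet)

/-- The divisors of `2 ^ y` up to `y` are the powers of two up to `y`, and there are as many of them
as `y` has binary digits. -/
theorem card_filter_dvd_two_pow (y : ℕ) :
    ∑ j ∈ Finset.range y, (if 2 ^ y % (j + 1) = 0 then 1 else 0) = Nat.size y := by
  rw [Finset.sum_boole, Nat.cast_id]
  have : (Finset.range y).filter (fun j => 2 ^ y % (j + 1) = 0) =
      (Finset.range (Nat.size y)).image (fun e => 2 ^ e - 1) := by
    ext j
    simp only [Finset.mem_filter, Finset.mem_range, Finset.mem_image]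
    constructor
    · rintro ⟨hj, h⟩
      obtain ⟨e, -, he⟩ := (Nat.dvd_prime_pow Nat.prime_two).1 (Nat.dvd_of_mod_eq_zero h)
      exact ⟨e, Nat.lt_size.2 (by omega), by omega⟩
    · rintro ⟨e, he, rfl⟩
      have h1 := Nat.lt_size.1 he
      have h2 := Nat.one_le_two_pow (n := e)
      have h3 : e < 2 ^ e := Nat.lt_two_pow_self
      refine ⟨by omega, ?_⟩
      rw [Nat.sub_add_cancel h2]
      exact Nat.mod_eq_zero_of_dvd (pow_dvd_pow 2 (by omega))
  rw [this, Finset.card_image_of_injective, Finset.card_range]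
  intro e e' h
  have h1 := Nat.one_le_two_pow (n := e)
  have h2 := Nat.one_le_two_pow (n := e')
  exact Nat.pow_right_injective le_rfl (show 2 ^ e = 2 ^ e' by simp only at h; omega)

/-- The value of `bulk`. -/
def bulkVal (E : Env) : ℕ := 2 * (E.param .length + E.param .alphabet + E.param .invError)

variable (E : Env) (A ρ : ℕ → ℕ)

theorem eval_bulk : bulk.eval E A ρ = bulkVal E := rfl

/-- Divisibility is tested on `2 ^ bulk` reduced modulo the candidate divisor, so that the huge
power is never stored. The outer modulus `bulk + 1` exceeds the count and has no effect. -/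
theorem eval_bulkSize : bulkSize.eval E A ρ = Nat.size (bulkVal E) := by
  rw [bulkSize, eval_sum _ _ _ _ _ _ _ (by simp [eval_bulk]), eval_bulk]
  have h : ∀ j, (eq (prod (.var 20 + 1) 21 bulk 2) 0).eval E A (Function.update ρ 20 j) =
      if 2 ^ bulkVal E % (j + 1) = 0 then 1 else 0 := by
    intro j
    rw [eval_eq, eval_prod _ _ _ _ _ _ _ (by simp)]
    simp [eval_bulk]
  simp only [h, card_filter_dvd_two_pow]
  refine Nat.mod_eq_of_lt ?_
  have : Nat.size (bulkVal E) ≤ bulkVal E := Nat.size_le.2 Nat.lt_two_pow_self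
  simp [eval_bulk]; omega

theorem two_pow_size_le {y : ℕ} (hy : 0 < y) : 2 ^ Nat.size y ≤ 2 * y := by
  have h := Nat.size_pos.2 hy
  have h1 : 2 ^ (Nat.size y - 1) ≤ y := Nat.lt_size.1 (by omega)
  have h2 : 2 ^ Nat.size y = 2 * 2 ^ (Nat.size y - 1) := by rw [← pow_succ']; congr 1; omega
  omega

/-- The inner power of two is at most twice `bulk`, hence below its modulus; the constant exponent
`κ` is applied outside the fold. -/
theorem eval_bigPow (κ : ℕ) (h2 : ρ 2 = Nat.size (bulkVal E)) (hy : 0 < bulkVal E) :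
    (bigPow κ).eval E A ρ = 2 ^ (κ * Nat.size (bulkVal E)) := by
  rw [bigPow, eval_pow, eval_prod _ _ _ _ _ _ _ (by simp)]
  simp only [eval_var, eval_ofNat, eval_add, eval_mul, eval_bulk, h2, Finset.prod_const,
    Finset.card_range]
  rw [Nat.mod_eq_of_lt (by have := two_pow_size_le hy; omega), ← pow_mul, mul_comm]

/-- Trial division by all numbers from `2` on. The hypothesis keeps the candidate at least `2`. -/
theorem eval_isPrime (h : 1 ≤ ρ 15) :
    isPrime.eval E A ρ = if (ρ 15 + 1 + ρ 21).Prime then 1 else 0 := by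
  rw [isPrime, eval_prod _ _ _ _ _ _ _ (by simp)]
  simp only [eval_sub, eval_add, eval_var, eval_ofNat, eval_lt, eval_mod,
    Function.update_self, Function.update_of_ne (show (15 : ℕ) ≠ 22 by norm_num),
    Function.update_of_ne (show (21 : ℕ) ≠ 22 by norm_num)]
  rw [prod_mod_two]
  refine if_congr ?_ rfl rfl
  rw [Nat.prime_def_lt']
  constructor
  · intro hh
    refine ⟨by omega, fun m hm hlt hd => ?_⟩
    have := hh (m - 2) (by omega)
    rw [Nat.sub_add_cancel hm, Nat.mod_eq_zero_of_dvd hd] at this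
    simp at this
  · rintro ⟨-, hh⟩ v hv
    have := hh (v + 2) (by omega) (by omega)
    rw [if_pos (Nat.pos_of_ne_zero fun h0 => this (Nat.dvd_of_mod_eq_zero h0))]

theorem exists_prime_add (Q : ℕ) : ∃ g, (Q + 1 + g).Prime := by
  obtain ⟨p, hp, hpr⟩ := Nat.exists_infinite_primes (Q + 1)
  exact ⟨p - (Q + 1), by rwa [Nat.add_sub_cancel' hp]⟩

/-- The least prime greater than `Q`. -/
noncomputable def primeAfter (Q : ℕ) : ℕ := Q + 1 + Nat.find (exists_prime_add Q)

theorem primeAfter_prime (Q : ℕ) : (primeAfter Q).Prime := Nat.find_spec (exists_prime_add Q)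

theorem lt_primeAfter (Q : ℕ) : Q < primeAfter Q := by unfold primeAfter; omega

/-- Bertrand's postulate bounds the search range, and later the size of the modulus. -/
theorem find_prime_lt {Q : ℕ} (h : 1 ≤ Q) : Nat.find (exists_prime_add Q) < Q := by
  obtain ⟨p, hp, hlt, hle⟩ := Nat.exists_prime_lt_and_le_two_mul Q (by omega)
  have := Nat.find_min' (exists_prime_add Q) (m := p - (Q + 1)) (by
    rwa [show Q + 1 + (p - (Q + 1)) = p by omega])
  omega

theorem primeAfter_le {Q : ℕ} (h : 1 ≤ Q) : primeAfter Q ≤ 2 * Q := by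
  have := find_prime_lt h
  unfold primeAfter; omega

/-- The term counts the `j < Q` such that none of `Q + 1, …, Q + 1 + j` is prime. This count is the
offset of the least prime; since the offset is below `Q`, neither the range nor the modulus `2 * Q`
truncates it. -/
theorem eval_nextPrime (h : 1 ≤ ρ 15) : nextPrime.eval E A ρ = primeAfter (ρ 15) := by
  set Q := ρ 15 with hQ
  set hex := exists_prime_add Q
  have hfind := find_prime_lt h
  have hin : ∀ j, (prod 2 21 (.var 20 + 1) (1 - isPrime)).eval E A (Function.update ρ 20 j) =
      if j < Nat.find hex then 1 else 0 := by
    intro j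
    rw [eval_prod _ _ _ _ _ _ _ (by simp)]
    have h1 : ∀ i, (1 - isPrime).eval E A (Function.update (Function.update ρ 20 j) 21 i) =
        if (Q + 1 + i).Prime then 0 else 1 := by
      intro i
      rw [eval_sub, eval_isPrime]
      · simp only [eval_one, Function.update_self,
          Function.update_of_ne (show (15 : ℕ) ≠ 21 by norm_num),
          Function.update_of_ne (show (15 : ℕ) ≠ 20 by norm_num), ← hQ]
        split_ifs <;> rfl
      · simpa [Function.update_of_ne] using h
    simp only [h1]
    simp only [eval_add, eval_var, Function.update_self, eval_ofNat]
    rw [prod_mod_two]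
    refine if_congr ?_ rfl rfl
    constructor
    · intro hh
      rw [Nat.lt_find_iff]
      intro i hi hpr
      have := hh i (by omega)
      simp [hpr] at this
    · intro hh i hi
      rw [if_neg (Nat.find_min hex (by omega))]
  rw [nextPrime, eval_add, eval_sum _ _ _ _ _ _ _ (by simp; omega)]
  simp only [hin]
  simp only [eval_add, eval_var, eval_mul, eval_ofNat, ← hQ]
  have : ∑ j ∈ Finset.range Q, (if j < Nat.find hex then 1 else 0) = Nat.find hex := by
    rw [Finset.sum_boole, Nat.cast_id]
    have : (Finset.range Q).filter (· < Nat.find hex) = Finset.range (Nat.find hex) := by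
      ext
      simp only [Finset.mem_filter, Finset.mem_range]
      omega
    rw [this, Finset.card_range]
  rw [this, Nat.mod_eq_of_lt (by omega), primeAfter]

theorem eval_columns : columns.eval E A ρ = min (E.param .s) (E.param .alphabet) := by
  simp only [columns, eval_add, eval_mul, eval_sub, eval_lt, space, alphabet, eval_param, eval_one]
  split_ifs with h
  · rw [min_eq_left h.le]; simp
  · rw [min_eq_right (not_lt.1 h)]; simp

/-! ### The randomized verifier -/

/-- The number of tests of a clause. -/
def tests : Term := 24 * .var 2 * (.var 2 + 1)

/-- The Lagrange basis polynomial at the value of the variable `x`, evaluated at `var 5`. -/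
def basis (x : ℕ) : Term :=
  prod (.var 0) 30 (.var 4) (eq (.var 30) (.var x) + (1 - eq (.var 30) (.var x)) *
    ((.var 5 + (.var 0 - 1) * .var 30) *
      prod (.var 0) 31 (.var 0 - 2) (.var x + (.var 0 - 1) * .var 30)))

/-- The indicator of the position `var 23` being selected by the test `var 24`. -/
def selected : Term :=
  prod 2 25 (.var 24 % (.var 2 + 1)) (1 + sum 2 26 (.var 2 + 1)
    (.common (.var 24 / (.var 2 + 1) * (.var 2 * (.var 2 + 1)) + .var 25 * (.var 2 + 1) + .var 26) *
      (lt (.var 26) (.var 2) * (.var 23 / prod (.var 0) 27 (.var 26) 2 % 2) +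
        (1 - lt (.var 26) (.var 2)))))

/-- The new value of the array entry `var 9` when the `var 6`-th symbol `var 8` is read. -/
def sketchStep : Term :=
  (.arr (.var 9) + eq (.var 9 / tests / clauses) ((.var 8 - 1) % .var 3) * basis 14 *
    sum (.var 0) 23 length (selected *
      (eq (.literal (.var 9 / tests % clauses) (.var 23)) (2 * .var 6 + 2) +
        (.var 0 - 1) * eq (.literal (.var 9 / tests % clauses) (.var 23)) (2 * .var 6 + 3)))) %
    .var 0

/-- The negation of clause `var 21` in column `var 20`. -/
def negClause : Term :=
  prod (.var 0) 24 tests (1 + (.var 0 - 1) *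
    (.arr ((.var 20 * clauses + .var 21) * tests + .var 24) +
      sum (.var 0) 23 length (selected * (.literal (.var 21) (.var 23) % 2))))

/-- The bit `var 21` of `var 22`. -/
def bit : Term := .var 22 / prod (.var 1) 29 (.var 21) 2 % 2

/-- The value of the polynomial of the instance at `var 5`. -/
def totalValue : Term :=
  sum (.var 0) 20 (.var 3)
    (sum (.var 0) 28 (.var 4) (lt (.var 20 + .var 3 * .var 28) alphabet * basis 28) *
      sum (.var 0) 22 (.var 1 / 2)
        ((.psiPos (.var 22) + (.var 0 - 1) * .psiNeg (.var 22)) *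
          prod (.var 0) 21 clauses
            (bit * (1 + (.var 0 - 1) * negClause) + (1 - bit) * negClause)))

/-- The length of a coefficient in the proof. -/
def coefBits (κ : ℕ) : Term := .const κ * .var 2 + 1

/-- The length of the proof. -/
def proofLength (κ : ℕ) : Term := ((clauses * tests + 1) * .var 4 + 1) * coefBits κ

/-- The contribution of the symbol `var 8` of the proof to the value of the proof polynomial. -/
def pointStep (κ : ℕ) : Term :=
  (.var 12 + .var 8 / 2 * prod (.var 0) 20 (.var 6 % coefBits κ) 2 *
    prod (.var 0) 20 (.var 6 / coefBits κ) (.var 5)) % .var 0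

/-- The contribution of the symbol `var 8` of the proof to the sum of the values. -/
def sumStep (κ : ℕ) : Term :=
  (.var 13 + .var 8 / 2 * prod (.var 0) 20 (.var 6 % coefBits κ) 2 *
    sum (.var 0) 21 (.var 4) (prod (.var 0) 20 (.var 6 / coefBits κ) (.var 21))) % .var 0

end Term
end AMStream
namespace AMStream
open Polynomial

/-! ### The values of the terms of the randomized verifier -/

/-- The state of the array entry `c` after `i` letters. -/
noncomputable def Grid.sketch (I : Grid) (p : ℕ) (z : ZMod p) (i c : ℕ) : ZMod p :=
  ∑ u ∈ Finset.range i,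
    (if c / I.D / I.k = I.letter u % I.s then (I.lam p (I.letter u / I.s)).eval z else 0) *
      ∑ q ∈ Finset.range I.m, if I.sel (c % I.D) q then
        ((if I.lit (c / I.D % I.k) q = 2 * u + 2 then 1 else 0) -
          (if I.lit (c / I.D % I.k) q = 2 * u + 3 then 1 else 0)) else 0

/-- Exchanging the sums over literals and over stream positions makes the count linear in the
stream: an arriving letter adds its Lagrange value times the signed number of selected literals on
its position. The constant parts of the literals need no stream and are added at the end. -/
theorem Grid.eval_count_eq (I : Grid) (p : ℕ) (z : ZMod p) {a t l : ℕ} (ht : t < I.k)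
    (hl : l < I.D) :
    (I.count p a t l).eval z = I.sketch p z I.m ((a * I.k + t) * I.D + l) +
      ∑ q ∈ Finset.range I.m, if I.sel l q then ((I.lit t q % 2 : ℕ) : ZMod p) else 0 := by
  have h1 : ((a * I.k + t) * I.D + l) % I.D = l := by
    rw [Nat.mul_add_mod_self_right, Nat.mod_eq_of_lt hl]
  have h2 : ((a * I.k + t) * I.D + l) / I.D = a * I.k + t := by
    rw [mul_comm, Nat.mul_add_div (by omega), Nat.div_eq_of_lt hl, add_zero]
  have h3 : (a * I.k + t) % I.k = t := by rw [Nat.mul_add_mod_self_right, Nat.mod_eq_of_lt ht]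
  have h4 : (a * I.k + t) / I.k = a := by
    rw [mul_comm, Nat.mul_add_div (by omega), Nat.div_eq_of_lt ht, add_zero]
  rw [Grid.sketch, h1, h2, h3, h4, Grid.count, eval_finsetSum]
  simp_rw [Finset.mul_sum]
  rw [Finset.sum_comm, ← Finset.sum_add_distrib]
  refine Finset.sum_congr rfl fun q _ => ?_
  by_cases hs : I.sel l q
  · simp only [if_pos hs]
    rw [Grid.litPoly, eval_add, eval_C, eval_finsetSum, add_comm]
    congr 1
    refine Finset.sum_congr rfl fun u _ => ?_
    rw [eval_mul, eval_C]
    congr 1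
    split_ifs <;> simp
  · simp only [if_neg hs, eval_zero, mul_zero, Finset.sum_const_zero, add_zero]

/-- The variables and the environment describe the grid `I`, the prime `p` and the point `z`. -/
structure Sees (E : Env) (I : Grid) (p ell z : ℕ) (ρ : ℕ → ℕ) : Prop where
  prime : ρ 0 = p
  pow : ρ 1 = 2 ^ (I.k + 1)
  levels : ρ 2 = ell
  s : ρ 3 = I.s
  w : ρ 4 = I.w
  point : ρ 5 = z
  length : E.param .length = I.m
  alphabet : E.param .alphabet = I.n
  clauses : E.param .clauses = I.k
  lit : ∀ t i, E.literal t i = I.lit t i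
  psi : ∀ x, E.psi x = I.psi x
  sel : ∀ l i, I.sel l i ↔ Survives ell E.common l i
  D : I.D = 24 * ell * (ell + 1)
  lt : 2 ^ ell < p

/-! ### Arithmetic of the terms modulo the prime -/

section
variable {E : Env} {I : Grid} {p ell z : ℕ} {ρ : ℕ → ℕ}

/-- Variables `0` to `5` hold the data of the protocol; loop indices and scratch variables have
larger numbers. -/
theorem Sees.update (h : Sees E I p ell z ρ) {x : ℕ} (hx : 6 ≤ x) (v : ℕ) :
    Sees E I p ell z (Function.update ρ x v) := by
  obtain ⟨h0, h1, h2, h3, h4, h5, hr⟩ := h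
  constructor <;> first
    | assumption
    | (rw [Function.update_of_ne (by omega)]; assumption)

variable (A : ℕ → ℕ)

theorem Sees.eval_tests (h : Sees E I p ell z ρ) : Term.tests.eval E A ρ = I.D := by
  simp [Term.tests, h.levels, h.D]

theorem Sees.eval_bit (h : Sees E I p ell z ρ) (ht : ρ 21 < I.k) :
    Term.bit.eval E A ρ = if (ρ 22).testBit (ρ 21) then 1 else 0 := by
  have hpow : (Term.prod (.var 1) 29 (.var 21) 2).eval E A ρ = 2 ^ ρ 21 := by
    rw [Term.eval_prod _ _ _ _ _ _ _ (by simp [h.pow])]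
    simp only [Term.eval_var, h.pow, Term.eval_ofNat, Finset.prod_const, Finset.card_range]
    exact Nat.mod_eq_of_lt (Nat.pow_lt_pow_right (by norm_num) (by omega))
  rw [Term.bit, Term.eval_mod, Term.eval_div, hpow, Term.eval_var, Term.eval_ofNat,
    Nat.testBit_eq_decide_div_mod_eq]
  have : ρ 22 / 2 ^ ρ 21 % 2 = 0 ∨ ρ 22 / 2 ^ ρ 21 % 2 = 1 := by omega
  rcases this with h | h <;> simp [h]

variable [hp : Fact p.Prime]

/-- Subtraction of natural numbers is truncated, so the terms multiply by `p - 1` in place of `-1`.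
-/
theorem cast_pred_prime : ((p - 1 : ℕ) : ZMod p) = -1 := by
  rw [Nat.cast_sub hp.out.one_le]; simp

theorem Term.cast_sum (h : ρ 0 = p) (x : ℕ) (N b : Term) :
    (((Term.sum (.var 0) x N b).eval E A ρ : ℕ) : ZMod p) =
      ∑ j ∈ Finset.range (N.eval E A ρ), ((b.eval E A (Function.update ρ x j) : ℕ) : ZMod p) := by
  rw [Term.eval_sum _ _ _ _ _ _ _ (by simpa [h] using hp.out.pos), Term.eval_var, h,
    ZMod.natCast_mod, Nat.cast_sum]

theorem Term.cast_prod (h : ρ 0 = p) (x : ℕ) (N b : Term) :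
    (((Term.prod (.var 0) x N b).eval E A ρ : ℕ) : ZMod p) =
      ∏ j ∈ Finset.range (N.eval E A ρ), ((b.eval E A (Function.update ρ x j) : ℕ) : ZMod p) := by
  rw [Term.eval_prod _ _ _ _ _ _ _ (by simpa [h] using hp.out.pos), Term.eval_var, h,
    ZMod.natCast_mod, Nat.cast_prod]

/-- The inner product over `p - 2` equal factors is the Fermat inverse in `lam`. Indices below `30`
do not clash with the loop variables `30` and `31`. -/
theorem Sees.cast_basis (h : Sees E I p ell z ρ) {x : ℕ} (hx : x < 30) :
    (((Term.basis x).eval E A ρ : ℕ) : ZMod p) = (I.lam p (ρ x)).eval (z : ZMod p) := by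
  rw [Term.basis, Term.cast_prod A h.prime, Grid.lam, eval_prod, Term.eval_var, h.w]
  refine Finset.prod_congr rfl fun v _ => ?_
  have h' := h.update (x := 30) (by norm_num) v
  have hxv : Function.update ρ 30 v x = ρ x := Function.update_of_ne (by omega) _ _
  simp only [Term.eval_add, Term.eval_mul, Term.eval_eq, Term.eval_sub, Term.eval_one,
    Term.eval_var, Function.update_self, hxv]
  by_cases hv : v = ρ x
  · simp [hv]
  · simp only [if_neg hv, Nat.cast_add, Nat.cast_mul, Term.cast_prod A h'.prime, h'.prime, h'.point,
      cast_pred_prime, Term.eval_sub, Term.eval_var, Term.eval_ofNat, Term.eval_add, Term.eval_mul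
      ]
    have h31 : ∀ j, Function.update (Function.update ρ 30 v) 31 j 0 = p := fun j =>
      (h'.update (x := 31) (by norm_num) j).prime
    have h31x : ∀ j, Function.update (Function.update ρ 30 v) 31 j x = ρ x := fun j => by
      rw [Function.update_of_ne (by omega), hxv]
    have h31v : ∀ j, Function.update (Function.update ρ 30 v) 31 j 30 = v := fun j => by
      rw [Function.update_of_ne (by omega), Function.update_self]
    simp only [h31, h31x, h31v, cast_pred_prime, Finset.prod_const, Finset.card_range]
    simp [sub_eq_add_neg]

/-- As `2 ^ ell < p`, reduction modulo the prime does not disturb these powers, which are used as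
integers to extract binary digits. -/
theorem Sees.eval_pow_two (h : Sees E I p ell z ρ) {x y v : ℕ} (hv : ρ y = v)
    (hlt : v ≤ ell) : (Term.prod (.var 0) x (.var y) 2).eval E A ρ = 2 ^ v := by
  rw [Term.eval_prod _ _ _ _ _ _ _ (by simpa [h.prime] using hp.out.pos)]
  simp only [Term.eval_var, h.prime, hv, Term.eval_ofNat, Finset.prod_const, Finset.card_range]
  exact Nat.mod_eq_of_lt ((Nat.pow_le_pow_right (by norm_num) hlt).trans_lt h.lt)

/-- The factor `1 + parity` is odd exactly when the parity check holds, so the product modulo `2` is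
the conjunction over the first rows of the block. -/
theorem Sees.eval_selected (h : Sees E I p ell z ρ) :
    Term.selected.eval E A ρ = if I.sel (ρ 24) (ρ 23) then 1 else 0 := by
  rw [Term.selected, Term.eval_prod _ _ _ _ _ _ _ (by simp)]
  have key : ∀ q, (1 + Term.sum 2 26 (.var 2 + 1)
      (.common (.var 24 / (.var 2 + 1) * (.var 2 * (.var 2 + 1)) + .var 25 * (.var 2 + 1) + .var 26) *
      (Term.lt (.var 26) (.var 2) * (.var 23 / Term.prod (.var 0) 27 (.var 26) 2 % 2) +
        (1 - Term.lt (.var 26) (.var 2))))).eval E A (Function.update ρ 25 q) =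
      1 + parity ell (fun h => E.common (ρ 24 / (ell + 1) * (ell * (ell + 1)) + q * (ell + 1) + h))
        (ρ 23) % 2 := by
    intro q
    have h25 := h.update (x := 25) (by norm_num) q
    rw [Term.eval_add, Term.eval_sum _ _ _ _ _ _ _ (by simp), parity]
    simp only [Term.eval_add, Term.eval_var, h25.levels, Term.eval_ofNat]
    congr 2
    refine Finset.sum_congr rfl fun g hg => ?_
    have h26 := h25.update (x := 26) (by norm_num) g
    have v24 : Function.update (Function.update ρ 25 q) 26 g 24 = ρ 24 := by simp
    have v23 : Function.update (Function.update ρ 25 q) 26 g 23 = ρ 23 := by simp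
    have v25 : Function.update (Function.update ρ 25 q) 26 g 25 = q := by simp
    have v26 : Function.update (Function.update ρ 25 q) 26 g 26 = g := by simp
    rw [Finset.mem_range] at hg
    simp only [Term.eval_mul, Term.eval_common, Term.eval_add, Term.eval_div, Term.eval_mod,
      Term.eval_var, Term.eval_lt, Term.eval_sub, v24, v25, v26, v23, h26.levels,
      Term.eval_ofNat, h26.eval_pow_two A (x := 27) (y := 26) v26 (by omega), coef]
    by_cases hlt : g < ell <;> simp [hlt]
  simp only [key]
  simp only [Term.eval_mod, Term.eval_add, Term.eval_var, h.levels, Term.eval_ofNat]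
  rw [prod_mod_two]
  refine if_congr ?_ rfl rfl
  rw [h.sel, Survives]
  refine forall₂_congr fun q _ => ?_
  omega

theorem val_natCast_mod {x : ℕ} {y : ZMod p} (h : (x : ZMod p) = y) : x % p = y.val := by
  rw [← h, ZMod.val_natCast]

/-- An array index is a number in mixed radix: test `c % D`, clause `c / D % k`, column `c / D / k`.
The test is copied to variable `24`, where `selected` looks for it. -/
theorem Sees.eval_sketchStep (h : Sees E I p ell z ρ) (hA : A (ρ 9) = (I.sketch p z (ρ 6) (ρ 9)).val)
    (h24 : ρ 24 = ρ 9 % I.D) (h8 : ρ 8 = I.letter (ρ 6) + 1) (h14 : ρ 14 = I.letter (ρ 6) / I.s) :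
    Term.sketchStep.eval E A ρ = (I.sketch p z (ρ 6 + 1) (ρ 9)).val := by
  rw [Term.sketchStep, Term.eval_mod, Term.eval_var, h.prime]
  refine val_natCast_mod ?_
  rw [Grid.sketch, Finset.sum_range_succ, ← Grid.sketch]
  simp only [Term.eval_add, Term.eval_arr, Term.eval_var, hA, Nat.cast_add, ZMod.natCast_val,
    ZMod.cast_id]
  congr 1
  simp only [Term.eval_mul, Nat.cast_mul]
  congr 1
  · rw [h.cast_basis A (by norm_num), h14]
    simp only [Term.eval_eq, Term.eval_div, Term.eval_mod, Term.eval_var, h.eval_tests,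
      Term.eval_sub, Term.eval_one, h8, h.s, Term.clauses, Term.eval_param, h.clauses,
      Nat.add_sub_cancel]
    split_ifs <;> simp
  · rw [Term.cast_sum A h.prime, Term.length, Term.eval_param, h.length]
    refine Finset.sum_congr rfl fun q _ => ?_
    have h' := h.update (x := 23) (by norm_num) q
    rw [Term.eval_mul, h'.eval_selected]
    simp only [Function.update_self, Function.update_of_ne (show (24 : ℕ) ≠ 23 by norm_num),
      Function.update_of_ne (show (9 : ℕ) ≠ 23 by norm_num),
      Function.update_of_ne (show (6 : ℕ) ≠ 23 by norm_num), h24, Term.eval_add, Term.eval_eq,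
      Term.eval_literal, Term.eval_div, Term.eval_mod, Term.eval_var, Term.eval_mul,
      Term.eval_ofNat, h'.eval_tests, Term.eval_sub, h'.prime, Term.clauses,
      Term.eval_param, h'.clauses, h'.lit, Nat.cast_mul, Nat.cast_add, cast_pred_prime, Nat.cast_ite,
      Nat.cast_one, Nat.cast_zero]
    split_ifs <;> simp

theorem Sees.cast_negClause (h : Sees E I p ell z ρ)
    (hA : ∀ c < I.s * I.k * I.D, A c = (I.sketch p z I.m c).val) (ha : ρ 20 < I.s)
    (ht : ρ 21 < I.k) :
    ((Term.negClause.eval E A ρ : ℕ) : ZMod p) = (I.clauseNot p (ρ 20) (ρ 21)).eval (z : ZMod p) := by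
  rw [Term.negClause, Term.cast_prod A h.prime, Grid.clauseNot, eval_prod, h.eval_tests]
  refine Finset.prod_congr rfl fun l hl => ?_
  rw [Finset.mem_range] at hl
  have h' := h.update (x := 24) (by norm_num) l
  have hidx : (ρ 20 * I.k + ρ 21) * I.D + l < I.s * I.k * I.D := by
    have h1 : ρ 20 * I.k + ρ 21 + 1 ≤ I.s * I.k := by
      have := Nat.mul_le_mul_right I.k (Nat.succ_le_of_lt ha)
      rw [Nat.succ_mul] at this; omega
    have h2 := Nat.mul_le_mul_right I.D h1
    rw [Nat.succ_mul] at h2; omega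
  rw [eval_sub, I.eval_count_eq p z ht hl]
  simp only [Term.eval_add, Term.eval_mul, Term.eval_sub, Term.eval_one, Term.eval_var, h'.prime,
    Term.eval_arr, h'.eval_tests, Term.clauses, Term.eval_param, h'.clauses, Function.update_self,
    Function.update_of_ne (show (20 : ℕ) ≠ 24 by norm_num),
    Function.update_of_ne (show (21 : ℕ) ≠ 24 by norm_num), hA _ hidx, Nat.cast_add, Nat.cast_mul,
    cast_pred_prime, Nat.cast_one, ZMod.natCast_val, ZMod.cast_id, Term.cast_sum A h'.prime,
    Term.length, h'.length]
  have hsum : ∀ q, ((Term.selected.eval E A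
      (Function.update (Function.update ρ 24 l) 23 q) : ℕ) : ZMod p) *
        (((Term.literal (.var 21) (.var 23) % 2).eval E A
      (Function.update (Function.update ρ 24 l) 23 q) : ℕ) : ZMod p) =
      if I.sel l q then ((I.lit (ρ 21) q % 2 : ℕ) : ZMod p) else 0 := by
    intro q
    have h'' := h'.update (x := 23) (by norm_num) q
    have v24 : Function.update (Function.update ρ 24 l) 23 q 24 = l := by simp
    have v23 : Function.update (Function.update ρ 24 l) 23 q 23 = q := by simp
    have v21 : Function.update (Function.update ρ 24 l) 23 q 21 = ρ 21 := by simp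
    rw [h''.eval_selected, v24, v23]
    simp only [Term.eval_mod, Term.eval_literal, Term.eval_var, v21, v23, h''.lit, Term.eval_ofNat]
    split_ifs <;> simp
  simp only [hsum, eval_one]
  ring

/-- Sums and products of the term mirror those of `total` at the secret point. The values of `ψ`
enter as a difference of two natural numbers, since queries return only positive and negative parts.
-/
theorem Sees.cast_totalValue (h : Sees E I p ell z ρ)
    (hA : ∀ c < I.s * I.k * I.D, A c = (I.sketch p z I.m c).val) :
    ((Term.totalValue.eval E A ρ : ℕ) : ZMod p) = (I.total p).eval (z : ZMod p) := by
  rw [Term.totalValue, Term.cast_sum A h.prime, Grid.total, eval_finsetSum, Term.eval_var, h.s]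
  refine Finset.sum_congr rfl fun a ha => ?_
  rw [Finset.mem_range] at ha
  have h1 := h.update (x := 20) (by norm_num) a
  rw [Term.eval_mul, Nat.cast_mul, eval_mul]
  congr 1
  · rw [Term.cast_sum A h1.prime, Grid.mask, eval_finsetSum, Term.eval_var, h1.w]
    refine Finset.sum_congr rfl fun b _ => ?_
    have h2 := h1.update (x := 28) (by norm_num) b
    have v28 : Function.update (Function.update ρ 20 a) 28 b 28 = b := by simp
    have v20 : Function.update (Function.update ρ 20 a) 28 b 20 = a := by simp
    rw [Term.eval_mul, Nat.cast_mul, h2.cast_basis A (by norm_num), v28]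
    simp only [Term.eval_lt, Term.eval_add, Term.eval_mul, Term.eval_var, v20, v28, h2.s,
      Term.alphabet, Term.eval_param, h2.alphabet]
    split_ifs <;> simp
  · have hk : (Term.var 1 / 2).eval E A (Function.update ρ 20 a) = 2 ^ I.k := by
      rw [Term.eval_div, Term.eval_var, h1.pow, Term.eval_ofNat, pow_succ,
        Nat.mul_div_cancel _ (by norm_num)]
    rw [Term.cast_sum A h1.prime, Grid.column, eval_finsetSum, hk]
    refine Finset.sum_congr rfl fun x _ => ?_
    have h2 := h1.update (x := 22) (by norm_num) x
    rw [Term.eval_mul, Nat.cast_mul, eval_mul, eval_C]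
    congr 1
    · simp only [Term.eval_add, Term.eval_mul, Term.eval_sub, Term.eval_psiPos, Term.eval_psiNeg,
        Term.eval_var, Term.eval_one, h2.prime, Function.update_self, h2.psi, Nat.cast_add,
        Nat.cast_mul, cast_pred_prime]
      have := Int.toNat_sub_toNat_neg (I.psi x)
      conv_rhs => rw [← this]
      push_cast
      ring
    · rw [Term.cast_prod A h2.prime, eval_prod, Term.clauses, Term.eval_param, h2.clauses]
      refine Finset.prod_congr rfl fun t ht => ?_
      rw [Finset.mem_range] at ht
      have h3 := h2.update (x := 21) (by norm_num) t
      have v21 : Function.update (Function.update (Function.update ρ 20 a) 22 x) 21 t 21 = t := by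
        simp
      have v20 : Function.update (Function.update (Function.update ρ 20 a) 22 x) 21 t 20 = a := by
        simp
      have v22 : Function.update (Function.update (Function.update ρ 20 a) 22 x) 21 t 22 = x := by
        simp
      have hneg := h3.cast_negClause A hA (by rw [v20]; exact ha) (by rw [v21]; exact ht)
      have hbit := h3.eval_bit A (by rw [v21]; exact ht)
      rw [v20, v21] at hneg
      rw [v21, v22] at hbit
      simp only [Term.eval_add, Term.eval_mul, Term.eval_sub, Term.eval_one, Term.eval_var, hbit,
        Nat.cast_add, Nat.cast_mul, hneg, h3.prime, cast_pred_prime, Nat.cast_one]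
      split_ifs <;> simp [sub_eq_add_neg]

/-- The outermost sum is reduced modulo the prime, so the term yields the canonical representative
and can be compared as a number. -/
theorem Sees.eval_totalValue (h : Sees E I p ell z ρ)
    (hA : ∀ c < I.s * I.k * I.D, A c = (I.sketch p z I.m c).val) :
    Term.totalValue.eval E A ρ = ((I.total p).eval (z : ZMod p)).val := by
  have h1 := h.cast_totalValue A hA
  rw [← val_natCast_mod h1, Nat.mod_eq_of_lt]
  rw [Term.totalValue, Term.eval_sum _ _ _ _ _ _ _ (by simpa [h.prime] using hp.out.pos)]
  refine (Nat.mod_lt _ ?_).trans_le ?_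
  · simpa [h.prime] using hp.out.pos
  · simp [h.prime]

theorem proofPoly_succ (v i : ℕ) (ω : List Bool) :
    proofPoly p v (i + 1) ω = proofPoly p v i ω +
      C ((proofBit ω i * 2 ^ (i % v) : ℕ) : ZMod p) * X ^ (i / v) := Finset.sum_range_succ _ _

theorem Sees.eval_pointStep (h : Sees E I p ell z ρ) (κ : ℕ) {ω : List Bool}
    (h8 : ρ 8 = proofSymbol (ω.drop (ρ 6)))
    (h12 : ρ 12 = ((proofPoly p (κ * ell + 1) (ρ 6) ω).eval (z : ZMod p)).val) :
    (Term.pointStep κ).eval E A ρ =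
      ((proofPoly p (κ * ell + 1) (ρ 6 + 1) ω).eval (z : ZMod p)).val := by
  have hz : ∀ j, Function.update ρ 20 j 5 = z := fun j => (h.update (by norm_num) j).point
  rw [Term.pointStep, Term.eval_mod, Term.eval_var, h.prime]
  refine val_natCast_mod ?_
  rw [proofPoly_succ]
  simp only [Term.eval_add, Term.eval_mul, Term.eval_var, h12, Nat.cast_add, Nat.cast_mul,
    ZMod.natCast_val, ZMod.cast_id, Term.cast_prod A h.prime, Term.eval_mod, Term.eval_div,
    Term.coefBits, Term.eval_const, h.levels, Term.eval_ofNat, h8, hz,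
    Finset.prod_const, Finset.card_range, eval_add, eval_mul, eval_C, eval_pow, eval_X, proofBit,
    Nat.cast_pow]

/-- The proof is read once, so each bit must contribute to all row values when it arrives: its
coefficient is multiplied by the sum of the row numbers raised to its exponent. -/
theorem Sees.eval_sumStep (h : Sees E I p ell z ρ) (κ : ℕ) {ω : List Bool}
    (h8 : ρ 8 = proofSymbol (ω.drop (ρ 6)))
    (h13 : ρ 13 = (∑ b ∈ Finset.range I.w,
      (proofPoly p (κ * ell + 1) (ρ 6) ω).eval (b : ZMod p)).val) :
    (Term.sumStep κ).eval E A ρ = (∑ b ∈ Finset.range I.w,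
      (proofPoly p (κ * ell + 1) (ρ 6 + 1) ω).eval (b : ZMod p)).val := by
  have h21 : ∀ j, Function.update ρ 21 j 0 = p := fun j => (h.update (by norm_num) j).prime
  have h6 : ∀ j, Function.update ρ 21 j 6 = ρ 6 := fun j => Function.update_of_ne (by norm_num) _ _
  have h2 : ∀ j, Function.update ρ 21 j 2 = ell := fun j => (h.update (by norm_num) j).levels
  have h20 : ∀ j i, Function.update (Function.update ρ 21 j) 20 i 21 = j := fun j i => by
    rw [Function.update_of_ne (by norm_num), Function.update_self]
  rw [Term.sumStep, Term.eval_mod, Term.eval_var, h.prime]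
  refine val_natCast_mod ?_
  simp only [proofPoly_succ, eval_add, Finset.sum_add_distrib]
  simp only [Term.eval_add, Term.eval_mul, Term.eval_var, h13, Nat.cast_add, Nat.cast_mul,
    ZMod.natCast_val, ZMod.cast_id, Term.cast_prod A h.prime, Term.cast_sum A h.prime,
    Term.eval_mod, Term.eval_div, Term.coefBits, Term.eval_const, h.levels,
    Term.eval_ofNat, h8, h.w, Finset.prod_const, Finset.card_range, eval_mul, eval_C,
    eval_pow, eval_X, proofBit, Nat.cast_pow, Term.cast_prod A (h21 _), h20, h6, h2,
    ← Finset.mul_sum]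

end

end AMStream

namespace AMStream
open Polynomial

/-! ### The program -/

namespace Term

/-- The truth value of the literal with code `literal (var 21) (var 23)` at the letter `var 20`,
when the array holds the stream. -/
def literalValue : Term :=
  (.literal (.var 21) (.var 23) % 2 + lt 1 (.literal (.var 21) (.var 23)) *
    eq (.arr (.literal (.var 21) (.var 23) / 2 - 1)) (.var 20 + 1)) % 2

/-- The number whose bits are the values of the clauses at the letter `var 20`. -/
def clauseBits : Term :=
  sum (.var 1) 21 clauses (prod (.var 1) 22 (.var 21) 2 *
    ((1 + prod 2 23 length (1 + literalValue)) % 2))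

/-- The acceptance condition. -/
def accept : Term := eq (.var 11) (.var 12) * eq (.var 8) 0

/-- The positive part of the result. -/
def posPart : Term := .var 13 * lt (.var 13 + .var 13) (.var 0)

/-- The negative part of the result. -/
def negPart : Term := (.var 0 - .var 13) * (1 - lt (.var 13 + .var 13) (.var 0))

end Term

open Term in
/-- The terms that the program evaluates. -/
def terms (κ : ℕ) : List Term :=
  [bulkSize, bigPow κ, nextPrime, columns, alphabet / .var 3 + 1, 2, clauses, .var 1 * 2,
    lt clauses length, .const κ * .var 2, 2 * .var 5 + .var 8, length, .var 3 * clauses * tests,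
    (.var 8 - 1) / .var 3, .var 9 % tests, .var 9, sketchStep, totalValue, proofLength κ,
    pointStep κ, sumStep κ, accept, posPart, negPart, .var 6, .var 8, eq (.var 8) 0,
    sum (.var 0) 20 alphabet (.psiPos clauseBits), sum (.var 0) 20 alphabet (.psiNeg clauseBits)]

open Term in
/-- Computing the parameters of the protocol. -/
def setup (κ : ℕ) : Prog :=
  .seq (assign 2 bulkSize) <| .seq (assign 15 (bigPow κ)) <| .seq (assign 0 nextPrime) <|
  .seq (assign 3 columns) <| .seq (assign 4 (alphabet / .var 3 + 1)) <| .seq (assign 1 2) <|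
  .seq (assign 7 clauses) <| forTo 6 7 (assign 1 (.var 1 * 2))

open Term in
/-- Choosing the point of evaluation. -/
def choosePoint (κ : ℕ) : Prog :=
  .seq (assign 7 (.const κ * .var 2)) <|
  forTo 6 7 (.seq (.toss (.const (varCell 8))) (assign 5 (2 * .var 5 + .var 8)))

open Term in
/-- Reading the input stream. -/
def readStream : Prog :=
  .seq (assign 7 length) <| .seq (assign 10 (.var 3 * clauses * tests)) <|
  forTo 6 7 (.seq (.readInput (.const (varCell 8))) <| .seq (assign 14 ((.var 8 - 1) / .var 3)) <|
    forTo 9 10 (.seq (assign 24 (.var 9 % tests)) (setArr (.var 9) sketchStep)))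

open Term in
/-- Reading the proof stream. -/
def readProofPoly (κ : ℕ) : Prog :=
  .seq (assign 7 (proofLength κ)) <|
  forTo 6 7 (.seq (.readProof (.const (varCell 8))) <| .seq (assign 12 (pointStep κ))
    (assign 13 (sumStep κ)))

open Term in
/-- Checking the end of the proof, and the output. -/
def finish : Prog :=
  .seq (.readProof (.const (varCell 8))) <| .seq (setOut 0 accept) <| .seq (setOut 1 posPart)
    (setOut 2 negPart)

open Term in
/-- The verifier for few clauses. -/
def randomized (κ : ℕ) : Prog :=
  .seq (choosePoint κ) <| .seq readStream <| .seq (assign 11 totalValue) <|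
  .seq (readProofPoly κ) finish

open Term in
/-- The verifier for many clauses, which stores the input stream. -/
def deterministic : Prog :=
  .seq (assign 7 length) <|
  .seq (forTo 6 7 (.seq (.readInput (.const (varCell 8))) (setArr (.var 6) (.var 8)))) <|
  .seq (.readProof (.const (varCell 8))) <| .seq (setOut 0 (eq (.var 8) 0)) <|
  .seq (setOut 1 (sum (.var 0) 20 alphabet (.psiPos clauseBits)))
    (setOut 2 (sum (.var 0) 20 alphabet (.psiNeg clauseBits)))

/-- The program of the verifier. -/
def program (κ : ℕ) : Prog :=
  .seq (setup κ) (ifThen (Term.lt Term.clauses Term.length) (randomized κ) deterministic)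

/-! ### Triples -/

/-- Every run of `p` from a configuration with property `P` ends in one with property `Q`. -/
def Triple (f : ℕ → ℕ) (g : ℕ) (E : Env) (S : ℕ) (P : Cfg → Prop) (p : Prog) (Q : Cfg → Prop) :
    Prop :=
  ∀ st c, Rel f g st c → P c → ∃ st' c', Runs E S p st st' ∧ Rel f g st' c' ∧ Q c'

section
variable {E : Env} {S Z γ g : ℕ} {f : ℕ → ℕ}

theorem Triple.of_steps {P Q : Cfg → Prop} {p : Prog}
    (h : ∀ c, P c → ∃ c', Steps f g E S p c c' ∧ Q c') : Triple f g E S P p Q := by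
  intro st c hr hc
  obtain ⟨c', hs, hq⟩ := h c hc
  obtain ⟨st', r, h'⟩ := hs st hr
  exact ⟨st', c', r, h', hq⟩

theorem Triple.seq {P Q R : Cfg → Prop} {p q : Prog} (h₁ : Triple f g E S P p Q)
    (h₂ : Triple f g E S Q q R) : Triple f g E S P (.seq p q) R := by
  intro st c hr hc
  obtain ⟨st1, c1, r1, h1, hq⟩ := h₁ st c hr hc
  obtain ⟨st2, c2, r2, h2, hr⟩ := h₂ st1 c1 h1 hq
  exact ⟨st2, c2, .seq _ _ _ _ _ r1 r2, h2, hr⟩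

theorem Triple.imp {P Q Q' : Cfg → Prop} {p : Prog} (h : Triple f g E S P p Q)
    (hQ : ∀ c, Q c → Q' c) : Triple f g E S P p Q' := fun st c hr hc => by
  obtain ⟨st', c', r, h', q⟩ := h st c hr hc
  exact ⟨st', c', r, h', hQ _ q⟩

theorem Triple.weaken {P P' Q : Cfg → Prop} {p : Prog} (h : Triple f g E S P p Q)
    (hP : ∀ c, P' c → P c) : Triple f g E S P' p Q := fun st c hr hc => h st c hr (hP c hc)

/-- A configuration after an assignment. -/
def Cfg.set (c : Cfg) (x v : ℕ) : Cfg := { c with vars := Function.update c.vars x v }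

@[simp] theorem Cfg.set_vars (c : Cfg) (x v : ℕ) : (c.set x v).vars = Function.update c.vars x v := rfl
@[simp] theorem Cfg.set_arr (c : Cfg) (x v : ℕ) : (c.set x v).arr = c.arr := rfl
@[simp] theorem Cfg.set_out (c : Cfg) (x v : ℕ) : (c.set x v).out = c.out := rfl
@[simp] theorem Cfg.set_input (c : Cfg) (x v : ℕ) : (c.set x v).input = c.input := rfl
@[simp] theorem Cfg.set_proof (c : Cfg) (x v : ℕ) : (c.set x v).proof = c.proof := rfl
@[simp] theorem Cfg.set_coins (c : Cfg) (x v : ℕ) : (c.set x v).coins = c.coins := rfl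

protected theorem Resources.assignTriple (hR : Resources E S Z γ f g) {T : Term} (hT : T.Ok Z γ g)
    {x : ℕ} (hx : varCell x < Z) {P Q : Cfg → Prop}
    (h : ∀ c, P c → ∃ v, T.eval E c.arr c.vars = v ∧ Nat.size v ≤ g ∧ Q (c.set x v)) :
    Triple f g E S P (assign x T) Q := by
  refine Triple.of_steps fun c hc => ?_
  obtain ⟨v, hv, hs, hq⟩ := h c hc
  subst hv
  exact ⟨_, hR.assign hT hx c hs, hq⟩

/-- The body must preserve the counter and the bound. Its postcondition states the next invariant
with the counter already advanced, because the increment follows the body. -/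
protected theorem Resources.forTriple (hR : Resources E S Z γ f g) {x y : ℕ} (hx : varCell x < Z)
    (hy : varCell y < Z) (hxy : x ≠ y) {p : Prog} {N : ℕ} (hN : Nat.size N ≤ g) (Inv : ℕ → Cfg → Prop)
    {P : Cfg → Prop} (h0 : ∀ c, P c → c.vars y = N ∧ Inv 0 (c.set x 0))
    (hp : ∀ j < N, Triple f g E S (fun c => Inv j c ∧ c.vars x = j ∧ c.vars y = N) p
      (fun c => c.vars x = j ∧ c.vars y = N ∧ Inv (j + 1) (c.set x (j + 1)))) :
    Triple f g E S P (forTo x y p) (fun c => Inv N c ∧ c.vars x = N ∧ c.vars y = N) := by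
  have n1 : Nat.size 1 = 1 := size_one_eq
  intro st c hrel hc
  obtain ⟨hcy, hi⟩ := h0 c hc
  have hOk : (Term.const 0).Ok Z γ g := ⟨by simpa [Term.wt] using hR.le,
      le_trans (by simp [Term.top]) hR.large, le_trans (by simp [Term.top]) hR.large⟩
  obtain ⟨st0, r0, hr0⟩ := hR.assign hOk hx c (by simp [Term.eval]) st hrel
  let J : ℕ → State → Prop := fun j st => ∃ c, Rel f g st c ∧ Inv j c ∧ c.vars x = j ∧ c.vars y = N
  obtain ⟨st', r', c', h1, h2, h3, h4⟩ := runs_loop (E := E) (S := S) (N := N)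
    (b := .op .lt (cell (varCell x)) (cell (varCell y)))
    (c := .seq p (.store (.const (varCell x)) (.op .add (cell (varCell x)) (.const 1)))) J
    (by
      rintro j hj st ⟨c, h, hI, hvx, hvy⟩
      rw [← h.vars] at hvx hvy
      refine ⟨?_, ?_⟩
      · have hb := hR.room.bits _ h.fit
        have := hR.room.size_addr hx
        have := hR.room.size_addr hy
        have h3 := BinOp.bits_op E st.mem .lt (cell (varCell x)) (cell (varCell y))
        have h4 := Nat.size_le_size hj
        have := hR.le
        rw [bits_cell, bits_cell, value_cell, value_cell, hvx, hvy] at h3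
        omega
      · simp [Exp.value, hvx, hvy, BinOp.value])
    (by
      rintro j hj st ⟨c, h, hI, hvx, hvy⟩
      obtain ⟨st1, c1, r1, h1, e1, e2, e3⟩ := hp j hj st c h ⟨hI, hvx, hvy⟩
      have hvx : st1.mem (varCell x) = j := by rw [h1.vars, e1]
      have hs1 : Nat.size (j + 1) ≤ g := (Nat.size_le_size hj).trans hN
      have hs0 : Nat.size j ≤ g := (Nat.size_le_size hj.le).trans hN
      have := hR.le
      obtain ⟨r2, -⟩ := hR.room.runs_store (E := E) h1.fit (a := varCell x) (v := j + 1)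
        (e := .op .add (cell (varCell x)) (.const 1)) hx
        (by simp only [Exp.value, hvx]; rfl) (hs1.trans hR.le)
        (by
          have := hR.room.size_addr hx
          simp only [Exp.bits, Exp.value, hvx, n1, BinOp.value]; omega)
        st1.input st1.proof st1.coins
      refine ⟨_, .seq _ _ _ _ _ r1 r2, c1.set x (j + 1), h1.setVar hs1 (hR.setVar_fit hx hs1), e3,
        by simp [Cfg.set], ?_⟩
      simp only [Cfg.set_vars]
      rw [Function.update_of_ne hxy.symm, e2]) st0
    ⟨c.set x 0, hr0, hi, by simp [Cfg.set], by
      simp only [Cfg.set_vars]; rw [Function.update_of_ne hxy.symm, hcy]⟩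
  exact ⟨st', c', .seq _ _ _ _ _ r0 r', h1, h2, h3, h4⟩


end

/-! ### The parameters of the protocol -/

section run
variable {E : Env} {S Z γ g κ ell : ℕ} {f : ℕ → ℕ}

/-- The modulus. -/
noncomputable def modulus (κ ell : ℕ) : ℕ := Term.primeAfter (2 ^ (κ * ell))

theorem modulus_prime (κ ell : ℕ) : (modulus κ ell).Prime := Term.primeAfter_prime _

theorem modulus_le (κ ell : ℕ) : modulus κ ell ≤ 2 ^ (κ * ell + 1) := by
  rw [pow_succ']; exact Term.primeAfter_le Nat.one_le_two_pow

theorem lt_modulus (κ ell : ℕ) : 2 ^ (κ * ell) < modulus κ ell := Term.lt_primeAfter _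

theorem size_modulus_le (κ ell : ℕ) : Nat.size (modulus κ ell) ≤ κ * ell + 2 :=
  (Nat.size_le_size (modulus_le κ ell)).trans (by rw [Nat.size_pow])

/-- What the program knows when its parameters have been computed and the point is `z`. -/
structure Ready (E : Env) (κ ell : ℕ) (i : List ℕ) (p l : List Bool) (z : ℕ) (c : Cfg) : Prop where
  prime : c.vars 0 = modulus κ ell
  pow : c.vars 1 = 2 ^ (E.param .clauses + 1)
  size : c.vars 2 = ell
  s : c.vars 3 = min (E.param .s) (E.param .alphabet)
  w : c.vars 4 = E.param .alphabet / min (E.param .s) (E.param .alphabet) + 1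
  point : c.vars 5 = z
  acc : c.vars 12 = 0
  total : c.vars 13 = 0
  arr : c.arr = 0
  out : c.out = 0
  input : c.input = i
  proof : c.proof = p
  coins : c.coins = l

theorem Ready.set {i : List ℕ} {p l : List Bool} {z : ℕ} {c : Cfg} (h : Ready E κ ell i p l z c)
    {x : ℕ} (hx : 6 ≤ x) (h12 : x ≠ 12) (h13 : x ≠ 13) (v : ℕ) :
    Ready E κ ell i p l z (c.set x v) := by
  obtain ⟨h0, h1, h2, h3, h4, h5, h6, h7, hr⟩ := h
  constructor <;> first
    | assumption
    | (rw [Cfg.set_vars, Function.update_of_ne (by omega)]; assumption)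

/-- What the program knows before its parameters have been computed. -/
structure Fresh (i : List ℕ) (p l : List Bool) (c : Cfg) : Prop where
  point : c.vars 5 = 0
  acc : c.vars 12 = 0
  total : c.vars 13 = 0
  arr : c.arr = 0
  out : c.out = 0
  input : c.input = i
  proof : c.proof = p
  coins : c.coins = l

theorem Fresh.set {i : List ℕ} {p l : List Bool} {c : Cfg} (h : Fresh i p l c)
    {x : ℕ} (h5 : x ≠ 5) (h12 : x ≠ 12) (h13 : x ≠ 13) (v : ℕ) : Fresh i p l (c.set x v) := by
  obtain ⟨h0, h1, h2, hr⟩ := h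
  constructor <;> first
    | assumption
    | (rw [Cfg.set_vars, Function.update_of_ne (by omega)]; assumption)

/-- The standing assumptions on a run. -/
structure Setting (E : Env) (S Z γ : ℕ) (f : ℕ → ℕ) (g κ ell : ℕ) : Prop extends
    Resources E S Z γ f g where
  ok : ∀ T ∈ terms κ, T.Ok Z γ g
  pos : 0 < Term.bulkVal E
  ell_eq : Nat.size (Term.bulkVal E) = ell
  prime_size : κ * ell + 2 ≤ g
  one_le_mul : 1 ≤ κ
  clauses_le : E.param .clauses + 2 ≤ g

/-- Variables below `60` occupy cells up to `181`, inside the `200` cells guaranteed by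
`Resources.large`. -/
protected theorem Setting.cell_lt (hS : Setting E S Z γ f g κ ell) {x : ℕ} (hx : x < 60) : varCell x < Z := by
  have := hS.large
  simp only [varCell]; omega

protected theorem Setting.size_le (hS : Setting E S Z γ f g κ ell) {x : ℕ} (hx : x ≤ 2 ^ ell) :
    Nat.size x ≤ g := by
  refine (Nat.size_le_size hx).trans ?_
  rw [Nat.size_pow]
  have := hS.prime_size
  have : ell ≤ κ * ell := Nat.le_mul_of_pos_left _ hS.one_le_mul
  omega

protected theorem Setting.param_lt (hS : Setting E S Z γ f g κ ell) :
    E.param .length < 2 ^ ell ∧ E.param .alphabet < 2 ^ ell ∧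
      E.param .length + E.param .alphabet < 2 ^ ell := by
  have h2 : Term.bulkVal E < 2 ^ ell := by rw [← hS.ell_eq]; exact Nat.lt_size_self _
  unfold Term.bulkVal at h2
  omega

/-- The exponent of `2 ^ (k + 1)` is known only at run time, so the concluding loop builds this
power by repeated doubling, starting from `2`. -/
protected theorem Setting.setup (hS : Setting E S Z γ f g κ ell) (i : List ℕ) (p l : List Bool) :
    Triple f g E S (Fresh i p l) (setup κ) (Ready E κ ell i p l 0) := by
  have hR := hS.toResources
  have hell := hS.ell_eq
  have hsz := hS.prime_size
  have hkk := hS.clauses_le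
  refine (hR.assignTriple (hS.ok _ (by simp [terms])) (hS.cell_lt (by norm_num))
    (Q := fun c => Fresh i p l c ∧ c.vars 2 = ell) ?_).seq ?_
  · intro c h
    exact ⟨ell, by rw [Term.eval_bulkSize, hell], hS.size_le Nat.lt_two_pow_self.le,
      h.set (by norm_num) (by norm_num) (by norm_num) _, by simp⟩
  refine (hR.assignTriple (hS.ok _ (by simp [terms])) (hS.cell_lt (by norm_num))
    (Q := fun c => Fresh i p l c ∧ c.vars 2 = ell ∧ c.vars 15 = 2 ^ (κ * ell)) ?_).seq ?_
  · rintro c ⟨h, h2⟩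
    refine ⟨_, Term.eval_bigPow E c.arr c.vars κ (h2.trans hell.symm) hS.pos,
      by rw [Nat.size_pow, hell]; omega, h.set (by norm_num) (by norm_num) (by norm_num) _, ?_⟩
    simp [h2, hell]
  refine (hR.assignTriple (hS.ok _ (by simp [terms])) (hS.cell_lt (by norm_num))
    (Q := fun c => Fresh i p l c ∧ c.vars 2 = ell ∧ c.vars 0 = modulus κ ell) ?_).seq ?_
  · rintro c ⟨h, h2, h15⟩
    refine ⟨modulus κ ell, ?_, (size_modulus_le κ ell).trans hsz,
      h.set (by norm_num) (by norm_num) (by norm_num) _, ?_⟩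
    · rw [Term.eval_nextPrime E c.arr c.vars (by rw [h15]; exact Nat.one_le_two_pow), h15, modulus]
    · simp [h2]
  refine (hR.assignTriple (hS.ok _ (by simp [terms])) (hS.cell_lt (by norm_num))
    (Q := fun c => Fresh i p l c ∧ c.vars 2 = ell ∧ c.vars 0 = modulus κ ell ∧
      c.vars 3 = min (E.param .s) (E.param .alphabet)) ?_).seq ?_
  · rintro c ⟨h, h2, h0⟩
    refine ⟨_, Term.eval_columns E c.arr c.vars,
      hS.size_le ((min_le_right _ _).trans hS.param_lt.2.1.le),
      h.set (by norm_num) (by norm_num) (by norm_num) _, ?_⟩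
    simp [h2, h0]
  refine (hR.assignTriple (hS.ok _ (by simp [terms])) (hS.cell_lt (by norm_num))
    (Q := fun c => Fresh i p l c ∧ c.vars 2 = ell ∧ c.vars 0 = modulus κ ell ∧
      c.vars 3 = min (E.param .s) (E.param .alphabet) ∧
      c.vars 4 = E.param .alphabet / min (E.param .s) (E.param .alphabet) + 1) ?_).seq ?_
  · rintro c ⟨h, h2, h0, h3⟩
    refine ⟨E.param .alphabet / min (E.param .s) (E.param .alphabet) + 1, ?_, hS.size_le ?_,
      h.set (by norm_num) (by norm_num) (by norm_num) _, ?_⟩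
    · simp [Term.alphabet, h3]
    · have h1 := Nat.div_le_self (E.param .alphabet) (min (E.param .s) (E.param .alphabet))
      have h2 := hS.param_lt.2.1
      omega
    · simp [h2, h0, h3]
  refine (hR.assignTriple (hS.ok _ (by simp [terms])) (hS.cell_lt (by norm_num))
    (Q := fun c => Fresh i p l c ∧ c.vars 2 = ell ∧ c.vars 0 = modulus κ ell ∧
      c.vars 3 = min (E.param .s) (E.param .alphabet) ∧
      c.vars 4 = E.param .alphabet / min (E.param .s) (E.param .alphabet) + 1 ∧
      c.vars 1 = 2) ?_).seq ?_
  · rintro c ⟨h, h2, h0, h3, h4⟩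
    refine ⟨2, by simp, (by decide : Nat.size 2 ≤ 2).trans (by omega),
      h.set (by norm_num) (by norm_num) (by norm_num) _, ?_⟩
    simp [h2, h0, h3, h4]
  refine (hR.assignTriple (hS.ok _ (by simp [terms])) (hS.cell_lt (by norm_num))
    (Q := fun c => Fresh i p l c ∧ c.vars 2 = ell ∧ c.vars 0 = modulus κ ell ∧
      c.vars 3 = min (E.param .s) (E.param .alphabet) ∧
      c.vars 4 = E.param .alphabet / min (E.param .s) (E.param .alphabet) + 1 ∧
      c.vars 1 = 2 ∧ c.vars 7 = E.param .clauses) ?_).seq ?_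
  · rintro c ⟨h, h2, h0, h3, h4, h1⟩
    refine ⟨E.param .clauses, by simp [Term.clauses], hR.env.param .clauses (by simp),
      h.set (by norm_num) (by norm_num) (by norm_num) _, ?_⟩
    simp [h2, h0, h3, h4, h1]
  refine (hR.forTriple (hS.cell_lt (by norm_num)) (hS.cell_lt (by norm_num)) (by norm_num)
    (hR.env.param .clauses (by simp)) (fun j c => Fresh i p l c ∧ c.vars 2 = ell ∧
      c.vars 0 = modulus κ ell ∧ c.vars 3 = min (E.param .s) (E.param .alphabet) ∧
      c.vars 4 = E.param .alphabet / min (E.param .s) (E.param .alphabet) + 1 ∧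
      c.vars 1 = 2 ^ (j + 1)) ?_ ?_).imp ?_
  · rintro c ⟨h, h2, h0, h3, h4, h1, h7⟩
    exact ⟨h7, h.set (by norm_num) (by norm_num) (by norm_num) _, by simp [h2, h0, h3, h4, h1]⟩
  · intro j hj
    refine hR.assignTriple (hS.ok _ (by simp [terms])) (hS.cell_lt (by norm_num)) ?_
    rintro c ⟨⟨h, h2, h0, h3, h4, h1⟩, h6, h7⟩
    refine ⟨2 ^ (j + 1 + 1), by simp [h1, pow_succ], by rw [Nat.size_pow]; omega, by simpa using h6,
      by simpa using h7, (h.set (by norm_num) (by norm_num) (by norm_num) _).set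
        (by norm_num) (by norm_num) (by norm_num) _, by simp [h2, h0, h3, h4]⟩
  · rintro c ⟨⟨h, h2, h0, h3, h4, h1⟩, -, -⟩
    exact ⟨h0, h1, h2, h3, h4, h.point, h.acc, h.total, h.arr, h.out, h.input, h.proof, h.coins⟩

/-- The number with the given binary digits. -/
def digitsValue (l : List Bool) : ℕ := l.foldl (fun z b => 2 * z + b.toNat) 0

theorem digitsValue_take_succ {l : List Bool} {j : ℕ} (hj : j < l.length) :
    digitsValue (l.take (j + 1)) = 2 * digitsValue (l.take j) + (l[j]).toNat := by
  rw [digitsValue, List.take_succ_eq_append_getElem hj, List.foldl_append]; rfl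

theorem digitsValue_take_lt (l : List Bool) (j : ℕ) : digitsValue (l.take j) < 2 ^ j := by
  induction j with
  | zero => simp [digitsValue]
  | succ j ih =>
    rw [pow_succ]
    by_cases hj : j < l.length
    · rw [digitsValue_take_succ hj]
      have := Bool.toNat_le l[j]
      omega
    · rw [List.take_of_length_le (by omega)] at ih ⊢
      omega

/-- The coins are the binary digits of the point, most significant digit first; the invariant splits
the coins into those used and those left. -/
protected theorem Setting.choosePoint (hS : Setting E S Z γ f g κ ell) (i : List ℕ) (p l : List Bool)
    (hl : l.length = κ * ell) :
    Triple f g E S (Ready E κ ell i p l 0) (choosePoint κ)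
      (Ready E κ ell i p [] (digitsValue l)) := by
  have hR := hS.toResources
  have hsz := hS.prime_size
  have hN : Nat.size (κ * ell) ≤ g := (Nat.size_le.2 Nat.lt_two_pow_self).trans (by omega)
  refine (hR.assignTriple (hS.ok _ (by simp [terms])) (hS.cell_lt (by norm_num))
    (Q := fun c => Ready E κ ell i p l 0 c ∧ c.vars 7 = κ * ell) ?_).seq ?_
  · intro c h
    exact ⟨κ * ell, by simp [h.size], hN, h.set (by norm_num) (by norm_num) (by norm_num) _, by simp⟩
  refine (hR.forTriple (hS.cell_lt (by norm_num)) (hS.cell_lt (by norm_num)) (by norm_num)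
    hN (fun j c => Ready E κ ell i p (l.drop j) (digitsValue (l.take j)) c) ?_ ?_).imp ?_
  · rintro c ⟨h, h7⟩
    exact ⟨h7, by simpa [digitsValue] using h.set (x := 6) (by norm_num) (by norm_num) (by norm_num) 0⟩
  · intro j hj
    have hjl : j < l.length := by omega
    refine Triple.seq (Q := fun c => Ready E κ ell i p (l.drop (j + 1)) (digitsValue (l.take j)) c ∧
      c.vars 6 = j ∧ c.vars 7 = κ * ell ∧ c.vars 8 = (l[j]).toNat) (Triple.of_steps ?_) ?_
    · rintro c ⟨h, h6, h7⟩
      refine ⟨_, hR.toss (hS.cell_lt (by norm_num)) c (b := l[j]) (l := l.drop (j + 1))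
        (h.coins.trans (List.drop_eq_getElem_cons hjl)), ?_⟩
      have h' := h.set (x := 8) (by norm_num) (by norm_num) (by norm_num) l[j].toNat
      exact ⟨⟨h'.prime, h'.pow, h'.size, h'.s, h'.w, h'.point, h'.acc, h'.total, h'.arr, h'.out,
        h'.input, h'.proof, rfl⟩, by simpa using h6, by simpa using h7, by simp⟩
    · refine hR.assignTriple (hS.ok _ (by simp [terms])) (hS.cell_lt (by norm_num)) ?_
      rintro c ⟨h, h6, h7, h8⟩
      have hz := digitsValue_take_lt l (j + 1)
      refine ⟨digitsValue (l.take (j + 1)), by simp [digitsValue_take_succ hjl, h.point, h8], ?_,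
        by simpa using h6, by simpa using h7, ?_⟩
      · exact (Nat.size_le.2 hz).trans (by omega)
      · refine Ready.set ?_ (by norm_num) (by norm_num) (by norm_num) _
        obtain ⟨h0, h1, h2, h3, h4, h5, h12, h13, hr⟩ := h
        constructor <;> first | assumption | simp
  · rintro c ⟨h, -, -⟩
    rwa [← hl, List.drop_length, List.take_length] at h

end run

end AMStream
namespace AMStream
open Polynomial

/-! ### The run of the verifier for few clauses -/

instance (κ ell : ℕ) : Fact (modulus κ ell).Prime := ⟨modulus_prime κ ell⟩

/-- The grid `I` describes the instance that the environment `E` provides. -/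
structure Grid.Fits (I : Grid) (E : Env) (ell : ℕ) : Prop where
  s : I.s = min (E.param .s) (E.param .alphabet)
  w : I.w = E.param .alphabet / min (E.param .s) (E.param .alphabet) + 1
  length : E.param .length = I.m
  alphabet : E.param .alphabet = I.n
  clauses : E.param .clauses = I.k
  lit : ∀ t i, E.literal t i = I.lit t i
  psi : ∀ x, E.psi x = I.psi x
  sel : ∀ l i, I.sel l i ↔ Survives ell E.common l i
  D : I.D = 24 * ell * (ell + 1)

/-- The content of the array after `j` letters, where the entries below `c` are one letter
ahead. -/
noncomputable def Grid.table (I : Grid) (p : ℕ) (z : ZMod p) (j c q : ℕ) : ℕ :=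
  if q < I.s * I.k * I.D then (I.sketch p z (if q < c then j + 1 else j) q).val else 0

theorem Grid.table_zero_zero (I : Grid) (p : ℕ) (z : ZMod p) : I.table p z 0 0 = 0 := by
  ext q; simp [Grid.table, Grid.sketch]

/-- A complete sweep through the array advances every entry by one letter. -/
theorem Grid.table_mul (I : Grid) (p : ℕ) (z : ZMod p) (j : ℕ) :
    I.table p z j (I.s * I.k * I.D) = I.table p z (j + 1) 0 := by
  ext q
  simp only [Grid.table]
  split_ifs <;> simp_all

theorem Grid.update_table (I : Grid) (p : ℕ) (z : ZMod p) {j c : ℕ} (hc : c < I.s * I.k * I.D) :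
    Function.update (I.table p z j c) c (I.sketch p z (j + 1) c).val = I.table p z j (c + 1) := by
  ext q
  by_cases hq : q = c
  · subst hq; simp [Grid.table, hc]
  · rw [Function.update_of_ne hq]
    simp only [Grid.table]
    split_ifs <;> first | rfl | omega

/-- What the program knows in the main phases. -/
structure View (E : Env) (I : Grid) (κ ell z : ℕ) (A : ℕ → ℕ) (i : List ℕ) (p : List Bool)
    (c : Cfg) : Prop where
  sees : Sees E I (modulus κ ell) ell z c.vars
  arr : c.arr = A
  out : c.out 3 = 0
  input : c.input = i
  proof : c.proof = p

section
variable {E : Env} {I : Grid} {S Z γ g κ ell z : ℕ} {f : ℕ → ℕ} {A : ℕ → ℕ} {i : List ℕ}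
  {p : List Bool} {c : Cfg}

theorem View.set (h : View E I κ ell z A i p c) {x : ℕ} (hx : 6 ≤ x) (v : ℕ) :
    View E I κ ell z A i p (c.set x v) := ⟨h.sees.update hx v, h.arr, h.out, h.input, h.proof⟩

theorem Ready.view (hS : Setting E S Z γ f g κ ell) (hI : I.Fits E ell) {l : List Bool}
    (h : Ready E κ ell i p l z c) : View E I κ ell z 0 i p c := by
  refine ⟨⟨h.prime, ?_, h.size, h.s.trans hI.s.symm, h.w.trans hI.w.symm, h.point, hI.length,
    hI.alphabet, hI.clauses, hI.lit, hI.psi, hI.sel, hI.D, ?_⟩, h.arr, by rw [h.out]; rfl, h.input,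
    h.proof⟩
  · rw [h.pow, hI.clauses]
  · exact (Nat.pow_le_pow_right (by norm_num) (Nat.le_mul_of_pos_left _ hS.one_le_mul)).trans_lt
      (lt_modulus κ ell)

theorem size_val_le (y : ZMod (modulus κ ell)) : Nat.size y.val ≤ κ * ell + 2 :=
  (Nat.size_le_size (ZMod.val_lt y).le).trans (size_modulus_le κ ell)

/-- The outer loop runs over letters and the inner one over accumulators: a letter cannot be read
again, so all accumulators are updated at once. Their residues fit the profile of the array by `hf`.
-/
protected theorem Setting.readStream (hS : Setting E S Z γ f g κ ell)
    (hM : Nat.size (I.s * I.k * I.D) ≤ g)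
    (hf : ∀ q < I.s * I.k * I.D, κ * ell + 2 ≤ f (arrCell q))
    (hin : ∀ j < I.m, inputSymbol (i.drop j) = I.letter j + 1) (hlet : ∀ j < I.m, I.letter j < I.n) :
    Triple f g E S (fun c => View E I κ ell z 0 i p c ∧ c.vars 12 = 0 ∧ c.vars 13 = 0) readStream
      (fun c => View E I κ ell z (I.table (modulus κ ell) z I.m 0) (i.drop I.m) p c ∧
        c.vars 12 = 0 ∧ c.vars 13 = 0) := by
  have hR := hS.toResources
  have hsz := hS.prime_size
  refine (hR.assignTriple (hS.ok _ (by simp [terms])) (hS.cell_lt (by norm_num))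
    (Q := fun c => (View E I κ ell z 0 i p c ∧ c.vars 12 = 0 ∧ c.vars 13 = 0) ∧
      c.vars 7 = I.m) ?_).seq ?_
  · rintro c ⟨h, h12, h13⟩
    exact ⟨I.m, by simp [Term.length, h.sees.length],
      by rw [← h.sees.length]; exact hR.env.param .length (by simp),
      ⟨h.set (by norm_num) _, by simpa using h12, by simpa using h13⟩, by simp⟩
  refine (hR.assignTriple (hS.ok _ (by simp [terms])) (hS.cell_lt (by norm_num))
    (Q := fun c => (View E I κ ell z 0 i p c ∧ c.vars 12 = 0 ∧ c.vars 13 = 0) ∧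
      c.vars 7 = I.m ∧ c.vars 10 = I.s * I.k * I.D ∧ Nat.size I.m ≤ g) ?_).seq ?_
  · rintro c ⟨⟨h, h12, h13⟩, h7⟩
    refine ⟨I.s * I.k * I.D, by simp [Term.clauses, h.sees.clauses, h.sees.eval_tests, h.sees.s], hM,
      ⟨h.set (by norm_num) _, by simpa using h12, by simpa using h13⟩, by simpa using h7, by simp, ?_⟩
    rw [← h.sees.length]; exact hR.env.param .length (by simp)
  -- The bound on `m` and the identification of the alphabet are parts of the precondition; they are
  -- extracted here because the loop rule needs them as hypotheses.
  intro st c hrel hc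
  have hm := hc.2.2.2
  have halph := hc.1.1.sees.alphabet
  refine (hR.forTriple (hS.cell_lt (by norm_num)) (hS.cell_lt (by norm_num)) (by norm_num) hm
    (fun j c => (View E I κ ell z (I.table (modulus κ ell) z j 0) (i.drop j) p c ∧ c.vars 12 = 0 ∧
      c.vars 13 = 0) ∧ c.vars 10 = I.s * I.k * I.D) (P := fun c => (View E I κ ell z 0 i p c ∧
      c.vars 12 = 0 ∧ c.vars 13 = 0) ∧ c.vars 7 = I.m ∧ c.vars 10 = I.s * I.k * I.D ∧
      Nat.size I.m ≤ g) ?_ ?_).imp ?_ st c hrel hc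
  · rintro c ⟨⟨h, h12, h13⟩, h7, h10, -⟩
    rw [I.table_zero_zero]
    exact ⟨h7, ⟨h.set (x := 6) (by norm_num) 0, by simpa using h12, by simpa using h13⟩,
      by simpa using h10⟩
  · intro j hj
    have hl := hlet j hj
    refine Triple.seq (Q := fun c => (View E I κ ell z (I.table (modulus κ ell) z j 0)
      (i.drop (j + 1)) p c ∧ c.vars 12 = 0 ∧ c.vars 13 = 0) ∧ c.vars 10 = I.s * I.k * I.D ∧
      c.vars 6 = j ∧ c.vars 7 = I.m ∧ c.vars 8 = I.letter j + 1) (Triple.of_steps ?_) ?_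
    · rintro c ⟨⟨⟨h, h12, h13⟩, h10⟩, h6, h7⟩
      have hsym : inputSymbol c.input = I.letter j + 1 := by rw [h.input, hin j hj]
      refine ⟨_, hR.readInput (hS.cell_lt (by norm_num)) c (x := 8) ?_, ?_⟩
      · rw [hsym]
        have := hS.param_lt.2.1
        exact hS.size_le (by omega)
      · refine ⟨⟨⟨h.sees.update (by norm_num) _, h.arr, h.out, ?_, h.proof⟩, ?_⟩, ?_⟩
        · simp [h.input]
        · simpa using ⟨h12, h13⟩
        · simpa [hsym] using ⟨h10, h6, h7⟩
    refine (hR.assignTriple (hS.ok _ (by simp [terms])) (hS.cell_lt (by norm_num))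
      (Q := fun c => (View E I κ ell z (I.table (modulus κ ell) z j 0)
      (i.drop (j + 1)) p c ∧ c.vars 12 = 0 ∧ c.vars 13 = 0) ∧ c.vars 10 = I.s * I.k * I.D ∧
      c.vars 6 = j ∧ c.vars 7 = I.m ∧ c.vars 8 = I.letter j + 1 ∧
      c.vars 14 = I.letter j / I.s) ?_).seq ?_
    · rintro c ⟨⟨h, h12, h13⟩, h10, h6, h7, h8⟩
      refine ⟨I.letter j / I.s, by simp [h8, h.sees.s], hS.size_le ?_, ⟨h.set (by norm_num) _,
        by simpa using ⟨h12, h13⟩⟩, by simpa using ⟨h10, h6, h7, h8⟩⟩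
      have := hS.param_lt.2.1
      exact (Nat.div_le_self _ _).trans (by omega)
    refine (hR.forTriple (hS.cell_lt (by norm_num)) (hS.cell_lt (by norm_num)) (by norm_num) hM
      (fun q c => (View E I κ ell z (I.table (modulus κ ell) z j q)
      (i.drop (j + 1)) p c ∧ c.vars 12 = 0 ∧ c.vars 13 = 0) ∧
      c.vars 6 = j ∧ c.vars 7 = I.m ∧ c.vars 8 = I.letter j + 1 ∧
      c.vars 14 = I.letter j / I.s) ?_ ?_).imp ?_
    · rintro c ⟨⟨h, h12, h13⟩, h10, h6, h7, h8, h14⟩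
      exact ⟨h10, ⟨h.set (x := 9) (by norm_num) 0, by simpa using ⟨h12, h13⟩⟩,
        by simpa using ⟨h6, h7, h8, h14⟩⟩
    · intro q hq
      refine (hR.assignTriple (hS.ok _ (by simp [terms])) (hS.cell_lt (by norm_num))
        (Q := fun c => ((View E I κ ell z (I.table (modulus κ ell) z j q)
          (i.drop (j + 1)) p c ∧ c.vars 12 = 0 ∧ c.vars 13 = 0) ∧
          c.vars 6 = j ∧ c.vars 7 = I.m ∧ c.vars 8 = I.letter j + 1 ∧
          c.vars 14 = I.letter j / I.s) ∧ c.vars 9 = q ∧ c.vars 10 = I.s * I.k * I.D ∧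
          c.vars 24 = q % I.D) ?_).seq (Triple.of_steps ?_)
      · rintro c ⟨⟨⟨h, h12, h13⟩, h6, h7, h8, h14⟩, h9, h10⟩
        refine ⟨q % I.D, by simp [h9, h.sees.eval_tests],
          (Nat.size_le_size ((Nat.mod_le _ _).trans hq.le)).trans hM,
          ⟨⟨h.set (by norm_num) _, by simpa using ⟨h12, h13⟩⟩, by simpa using ⟨h6, h7, h8, h14⟩⟩,
          by simpa using ⟨h9, h10⟩⟩
      · rintro c ⟨⟨⟨h, h12, h13⟩, h6, h7, h8, h14⟩, h9, h10, h24⟩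
        have hval := h.sees.eval_sketchStep c.arr (by
          rw [h.arr, h6, h9, Grid.table, if_pos hq, if_neg (lt_irrefl _)])
          (by rw [h9, h24]) (by rw [h6, h8]) (by rw [h6, h14])
        rw [h6, h9] at hval
        have hstep := hR.setArr (hS.ok (.var 9) (by simp [terms]))
          (hS.ok Term.sketchStep (by simp [terms])) c
          (by rw [hval]; exact (size_val_le _).trans hsz) (by
            rw [hval, Term.eval_var, h9]; exact (size_val_le _).trans (hf q hq))
        rw [hval, Term.eval_var, h9] at hstep
        refine ⟨_, hstep, h9, h10, ⟨⟨h.sees.update (by norm_num) _, ?_, h.out, h.input, h.proof⟩,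
          by simpa using ⟨h12, h13⟩⟩, by simpa using ⟨h6, h7, h8, h14⟩⟩
        simp only [Cfg.set_arr, h.arr]
        exact I.update_table _ _ hq
    · rintro c ⟨⟨⟨h, h12, h13⟩, h6, h7, h8, h14⟩, h9, h10⟩
      rw [I.table_mul] at h
      exact ⟨h6, h7, ⟨h.set (by norm_num) _, by simpa using ⟨h12, h13⟩⟩, by simpa using h10⟩
  · rintro c ⟨⟨h, -⟩, -, -⟩
    exact h

/-- The number of proof bits that the verifier reads. -/
def Grid.proofLength (I : Grid) (κ ell : ℕ) : ℕ := ((I.k * I.D + 1) * I.w + 1) * (κ * ell + 1)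

/-- The polynomial in the proof. -/
noncomputable def Grid.proof (I : Grid) (κ ell : ℕ) (ω : List Bool) : (ZMod (modulus κ ell))[X] :=
  proofPoly (modulus κ ell) (κ * ell + 1) (I.proofLength κ ell) ω

/-- One pass maintains both the value at the secret point and the sum over the rows, for the
polynomial truncated to the bits read so far. -/
protected theorem Setting.readProofPoly (hS : Setting E S Z γ f g κ ell)
    (hN : Nat.size (I.proofLength κ ell) ≤ g) {G : ℕ} :
    Triple f g E S (fun c => (View E I κ ell z A i p c ∧ c.vars 11 = G) ∧ c.vars 12 = 0 ∧
        c.vars 13 = 0) (readProofPoly κ)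
      (fun c => (View E I κ ell z A i (p.drop (I.proofLength κ ell)) c ∧ c.vars 11 = G) ∧
        c.vars 12 = ((I.proof κ ell p).eval (z : ZMod (modulus κ ell))).val ∧
        c.vars 13 = (∑ b ∈ Finset.range I.w,
          (I.proof κ ell p).eval (b : ZMod (modulus κ ell))).val) := by
  have hR := hS.toResources
  have hsz := hS.prime_size
  refine (hR.assignTriple (hS.ok _ (by simp [terms])) (hS.cell_lt (by norm_num))
    (Q := fun c => ((View E I κ ell z A i p c ∧ c.vars 11 = G) ∧ c.vars 12 = 0 ∧ c.vars 13 = 0) ∧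
      c.vars 7 = I.proofLength κ ell) ?_).seq ?_
  · rintro c ⟨⟨h, h11⟩, h12, h13⟩
    refine ⟨I.proofLength κ ell, ?_, hN,
      ⟨⟨h.set (by norm_num) _, by simpa using h11⟩, by simpa using ⟨h12, h13⟩⟩, by simp⟩
    simp [Term.proofLength, Term.coefBits, h.sees.eval_tests, Term.clauses, h.sees.clauses,
      h.sees.w, h.sees.levels, Grid.proofLength]
  refine (hR.forTriple (hS.cell_lt (by norm_num)) (hS.cell_lt (by norm_num)) (by norm_num) hN
    (fun j c => (View E I κ ell z A i (p.drop j) c ∧ c.vars 11 = G) ∧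
      c.vars 12 = ((proofPoly (modulus κ ell) (κ * ell + 1) j p).eval
        (z : ZMod (modulus κ ell))).val ∧
      c.vars 13 = (∑ b ∈ Finset.range I.w, (proofPoly (modulus κ ell) (κ * ell + 1) j p).eval
        (b : ZMod (modulus κ ell))).val) ?_ ?_).imp fun c h => h.1
  · rintro c ⟨⟨⟨h, h11⟩, h12, h13⟩, h7⟩
    exact ⟨h7, ⟨h.set (x := 6) (by norm_num) 0, by simpa using h11⟩,
      by simp [h12, h13, proofPoly]⟩
  · intro j hj
    refine Triple.seq (Q := fun c => ((View E I κ ell z A i (p.drop (j + 1)) c ∧ c.vars 11 = G) ∧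
      c.vars 12 = ((proofPoly (modulus κ ell) (κ * ell + 1) j p).eval
        (z : ZMod (modulus κ ell))).val ∧
      c.vars 13 = (∑ b ∈ Finset.range I.w, (proofPoly (modulus κ ell) (κ * ell + 1) j p).eval
        (b : ZMod (modulus κ ell))).val) ∧ c.vars 6 = j ∧ c.vars 7 = I.proofLength κ ell ∧
        c.vars 8 = proofSymbol (p.drop j)) (Triple.of_steps ?_) ?_
    · rintro c ⟨⟨⟨h, h11⟩, h12, h13⟩, h6, h7⟩
      refine ⟨_, hR.readProof (hS.cell_lt (by norm_num)) (by omega) c (x := 8), ?_⟩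
      refine ⟨⟨⟨⟨h.sees.update (by norm_num) _, h.arr, h.out, h.input, ?_⟩, ?_⟩, ?_⟩, ?_⟩
      · simp [h.proof]
      · simpa using h11
      · simpa using ⟨h12, h13⟩
      · simpa [h.proof] using ⟨h6, h7⟩
    refine (hR.assignTriple (hS.ok _ (by simp [terms])) (hS.cell_lt (by norm_num))
      (Q := fun c => ((View E I κ ell z A i (p.drop (j + 1)) c ∧ c.vars 11 = G) ∧
      c.vars 12 = ((proofPoly (modulus κ ell) (κ * ell + 1) (j + 1) p).eval
        (z : ZMod (modulus κ ell))).val ∧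
      c.vars 13 = (∑ b ∈ Finset.range I.w, (proofPoly (modulus κ ell) (κ * ell + 1) j p).eval
        (b : ZMod (modulus κ ell))).val) ∧ c.vars 6 = j ∧ c.vars 7 = I.proofLength κ ell ∧
        c.vars 8 = proofSymbol (p.drop j)) ?_).seq (hR.assignTriple (hS.ok _ (by simp [terms]))
      (hS.cell_lt (by norm_num)) ?_)
    · rintro c ⟨⟨⟨h, h11⟩, h12, h13⟩, h6, h7, h8⟩
      have hval := h.sees.eval_pointStep c.arr κ (ω := p) (by rw [h6, h8]) (by rw [h6, h12])
      rw [h6] at hval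
      exact ⟨_, hval, (size_val_le _).trans hsz, ⟨⟨h.set (by norm_num) _, by simpa using h11⟩,
        by simpa using h13⟩, by simpa using ⟨h6, h7, h8⟩⟩
    · rintro c ⟨⟨⟨h, h11⟩, h12, h13⟩, h6, h7, h8⟩
      have hval := h.sees.eval_sumStep c.arr κ (ω := p) (by rw [h6, h8]) (by rw [h6, h13])
      rw [h6] at hval
      exact ⟨_, hval, (size_val_le _).trans hsz, by simpa using h6, by simpa using h7,
        ⟨(h.set (by norm_num) _).set (by norm_num) _, by simpa using h11⟩, by simpa using h12⟩

/-- The residue that the verifier outputs. -/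
noncomputable def Grid.answer (I : Grid) (κ ell : ℕ) (p : List Bool) : ℕ :=
  (∑ b ∈ Finset.range I.w, (I.proof κ ell p).eval (b : ZMod (modulus κ ell))).val

open Classical in
/-- The output cells at the end of the verifier for few clauses. -/
structure Grid.Verdict (I : Grid) (κ ell z : ℕ) (p : List Bool) (c : Cfg) : Prop where
  accept : c.out 0 = if p.length ≤ I.proofLength κ ell ∧
    (I.total (modulus κ ell)).eval (z : ZMod (modulus κ ell)) =
      (I.proof κ ell p).eval (z : ZMod (modulus κ ell)) then 1 else 0
  pos : c.out 1 = if 2 * I.answer κ ell p < modulus κ ell then I.answer κ ell p else 0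
  neg : c.out 2 = if 2 * I.answer κ ell p < modulus κ ell then 0 else
    modulus κ ell - I.answer κ ell p
  den : c.out 3 = 0

theorem proofSymbol_eq_zero_iff (l : List Bool) : proofSymbol l = 0 ↔ l = [] := by
  cases l <;> simp [proofSymbol]

/-- One more proof symbol is read. It is `0` exactly when the proof has ended, so longer proofs are
rejected. Equality of representatives is equality in the field. -/
protected theorem Setting.finish (hS : Setting E S Z γ f g κ ell) :
    Triple f g E S
      (fun c => (View E I κ ell z A i (p.drop (I.proofLength κ ell)) c ∧
        c.vars 11 = ((I.total (modulus κ ell)).eval (z : ZMod (modulus κ ell))).val) ∧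
        c.vars 12 = ((I.proof κ ell p).eval (z : ZMod (modulus κ ell))).val ∧
        c.vars 13 = (∑ b ∈ Finset.range I.w,
          (I.proof κ ell p).eval (b : ZMod (modulus κ ell))).val) finish
      (I.Verdict κ ell z p) := by
  have hR := hS.toResources
  have hsz := hS.prime_size
  refine Triple.of_steps ?_
  rintro c ⟨⟨h, h11⟩, h12, h13⟩
  refine ⟨_, (hR.readProof (hS.cell_lt (by norm_num)) (by omega) c (x := 8)).seq
    ((hR.setOut (hS.ok _ (by simp [terms])) (by norm_num) _).seq
    ((hR.setOut (hS.ok _ (by simp [terms])) (by norm_num) _).seq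
      (hR.setOut (hS.ok _ (by simp [terms])) (by norm_num) _))), ?_⟩
  rw [← Grid.answer] at h13
  have hs := h.sees.prime
  refine ⟨?_, ?_, ?_, ?_⟩
  · simp only [Function.update_apply, Term.accept]
    simp only [h11, h12, h.proof, Term.eval_mul, Term.eval_eq, Term.eval_var, Term.eval_zero,
      Function.update_apply]
    norm_num
    simp only [proofSymbol_eq_zero_iff, List.drop_eq_nil_iff,
      (ZMod.val_injective (modulus κ ell)).eq_iff]
    split_ifs <;> simp_all
  · simp only [Function.update_apply, Term.posPart]
    simp [h13, hs, two_mul]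
  · simp only [Function.update_apply, Term.negPart]
    simp only [Term.eval_mul, Term.eval_sub, Term.eval_lt, Term.eval_var, Term.eval_one,
      Term.eval_add, Function.update_apply, two_mul]
    simp only [h13, hs]
    norm_num
    split_ifs <;> simp
  · simp [h.out]

/-- The array must hold the final table before the true polynomial is evaluated, and that value is
stored before the proof is read. -/
protected theorem Setting.randomized (hS : Setting E S Z γ f g κ ell) (hI : I.Fits E ell)
    (hM : Nat.size (I.s * I.k * I.D) ≤ g)
    (hf : ∀ q < I.s * I.k * I.D, κ * ell + 2 ≤ f (arrCell q))
    (hin : ∀ j < I.m, inputSymbol (i.drop j) = I.letter j + 1) (hlet : ∀ j < I.m, I.letter j < I.n)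
    (hN : Nat.size (I.proofLength κ ell) ≤ g) {l : List Bool} (hl : l.length = κ * ell) :
    Triple f g E S (Ready E κ ell i p l 0) (randomized κ) (I.Verdict κ ell (digitsValue l) p) := by
  have hR := hS.toResources
  have hsz := hS.prime_size
  refine (hS.choosePoint i p l hl).seq ?_
  refine ((hS.readStream hM hf hin hlet).weaken fun c h => ⟨h.view hS hI, h.acc, h.total⟩).seq ?_
  refine (hR.assignTriple (hS.ok _ (by simp [terms])) (hS.cell_lt (by norm_num)) ?_).seq
    ((hS.readProofPoly (i := i.drop I.m)
      (A := I.table (modulus κ ell) (digitsValue l : ℕ) I.m 0) hN).seq hS.finish)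
  rintro c ⟨h, h12, h13⟩
  have hval := h.sees.eval_totalValue c.arr (by
    intro q hq
    rw [h.arr, Grid.table, if_pos hq, if_neg (Nat.not_lt_zero _)])
  exact ⟨_, hval, (size_val_le _).trans hsz, ⟨h.set (by norm_num) _, by simp⟩,
    by simpa using ⟨h12, h13⟩⟩

/-! ### The run of the verifier for many clauses -/

theorem sum_two_pow_lt (b : ℕ → Bool) (k : ℕ) :
    ∑ t ∈ Finset.range k, 2 ^ t * (b t).toNat < 2 ^ k := by
  induction k with
  | zero => simp
  | succ k ih =>
    rw [Finset.sum_range_succ, pow_succ]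
    have : 2 ^ k * (b k).toNat ≤ 2 ^ k := by cases b k <;> simp
    omega

theorem testBit_sum_two_pow (b : ℕ → Bool) {k t : ℕ} (ht : t < k) :
    (∑ t ∈ Finset.range k, 2 ^ t * (b t).toNat).testBit t = b t := by
  induction t generalizing b k with
  | zero =>
    obtain ⟨k, rfl⟩ : ∃ k', k = k' + 1 := ⟨k - 1, by omega⟩
    rw [Finset.sum_range_succ', Nat.testBit_zero]
    simp_rw [pow_succ', mul_assoc, ← Finset.mul_sum]
    cases b 0 <;> simp [Nat.add_mod]
  | succ t ih =>
    obtain ⟨k, rfl⟩ : ∃ k', k = k' + 1 := ⟨k - 1, by omega⟩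
    rw [Finset.sum_range_succ', Nat.testBit_succ]
    simp_rw [pow_succ', mul_assoc, ← Finset.mul_sum]
    rw [← ih (fun t => b (t + 1)) (k := k) (by omega)]
    congr 1
    have := Bool.toNat_le (b 0)
    simp only [pow_zero, one_mul]
    omega

section
variable {m n k : ℕ} {C : Fin k → Clause m} {ψ : (Fin k → Bool) → ℤ} {σ : Stream m n} {E : Env}
  {S Z γ g κ ell : ℕ} {f : ℕ → ℕ} {A : ℕ → ℕ} {ρ : ℕ → ℕ}

/-- For both kinds of variable literal, `code / 2 - 1` is the index of the variable and `code % 2`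
is the negation, which is added modulo `2`. Codes up to `1` are constants, and `lt 1` masks their
meaningless index. -/
theorem Term.eval_literalValue (hlit : ∀ t i, E.literal t i = litCode C t i)
    (hA : ∀ i < m, A i = σ.letter i + 1) (t : Fin k) (i : Fin m) (j : Fin n)
    (h20 : ρ 20 = j) (h21 : ρ 21 = t) (h23 : ρ 23 = i) :
    Term.literalValue.eval E A ρ = ((C t i).value (indicator σ j)).toNat := by
  have hcode : E.literal t i = (C t i).code := by simp [hlit, litCode]
  simp only [Term.literalValue, Term.eval_mod, Term.eval_add, Term.eval_mul, Term.eval_lt,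
    Term.eval_eq, Term.eval_literal, Term.eval_var, Term.eval_arr, Term.eval_sub, Term.eval_div,
    Term.eval_ofNat, h20, h21, h23, hcode]
  have hletter : ∀ q : Fin m, (A q = j + 1) ↔ σ q = j := fun q => by
    rw [hA q q.2, Stream.letter, dif_pos q.2, Nat.add_right_cancel_iff, Fin.val_inj]
  cases C t i with
  | const b => cases b <;> simp [Literal.code, Literal.value]
  | pos q =>
    have h1 : (2 * (q : ℕ) + 2) / 2 - 1 = q := by omega
    simp only [Literal.code, Literal.value, h1, hletter, indicator]
    by_cases h : σ q = j <;> simp [h]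
  | neg q =>
    have h1 : (2 * (q : ℕ) + 3) / 2 - 1 = q := by omega
    simp only [Literal.code, Literal.value, h1, hletter, indicator]
    by_cases h : σ q = j <;> simp [h]

/-- The value of clause `t`, or `false` if there is none. -/
def clauseValue (C : Fin k → Clause m) (σ : Stream m n) (j : Fin n) (t : ℕ) : Bool :=
  if h : t < k then (C ⟨t, h⟩).value (indicator σ j) else false

/-- The disjunction is `1 + ∏ (1 + v)` modulo `2`: the product is odd exactly when every literal is
false. The modulus `2 ^ (k + 1)` exceeds any number with `k` digits. -/
theorem Term.eval_clauseBits (hlit : ∀ t i, E.literal t i = litCode C t i)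
    (hm : E.param .length = m) (hk : E.param .clauses = k)
    (hA : ∀ i < m, A i = σ.letter i + 1) (j : Fin n) (h20 : ρ 20 = j) (h1 : ρ 1 = 2 ^ (k + 1)) :
    Term.clauseBits.eval E A ρ = ∑ t ∈ Finset.range k, 2 ^ t * (clauseValue C σ j t).toNat := by
  rw [Term.clauseBits, Term.eval_sum _ _ _ _ _ _ _ (by simp [h1]), Term.clauses, Term.eval_param, hk,
    Term.eval_var, h1]
  have key : ∀ t ∈ Finset.range k, (Term.prod (.var 1) 22 (.var 21) 2 *
      ((1 + Term.prod 2 23 Term.length (1 + Term.literalValue)) % 2)).eval E A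
        (Function.update ρ 21 t) = 2 ^ t * (clauseValue C σ j t).toNat := by
    intro t ht
    rw [Finset.mem_range] at ht
    rw [Term.eval_mul, Term.eval_prod _ _ _ _ _ _ _ (by simp [h1])]
    congr 1
    · simp only [Term.eval_var, Function.update_self, Term.eval_ofNat, Finset.prod_const,
        Finset.card_range, Function.update_of_ne (show (1 : ℕ) ≠ 21 by norm_num), h1]
      exact Nat.mod_eq_of_lt (Nat.pow_lt_pow_right (by norm_num) (by omega))
    · rw [Term.eval_mod, Term.eval_add, Term.eval_prod _ _ _ _ _ _ _ (by simp), Term.length,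
        Term.eval_param, hm, clauseValue, dif_pos ht, Clause.value]
      simp only [Term.eval_ofNat, prod_mod_two]
      have hv : ∀ i : Fin m, (1 + Term.literalValue).eval E A
          (Function.update (Function.update ρ 21 t) 23 i) =
          1 + ((C ⟨t, ht⟩ i).value (indicator σ j)).toNat := by
        intro i
        rw [Term.eval_add, Term.eval_one, Term.eval_literalValue hlit hA ⟨t, ht⟩ i j] <;>
          simp [h20]
      by_cases hex : ∃ i, (C ⟨t, ht⟩ i).value (indicator σ j) = true
      · obtain ⟨i, hi⟩ := hex
        rw [if_neg fun hall => by have := hall i i.2; rw [hv, hi] at this; simp at this,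
          decide_eq_true ⟨i, hi⟩]
        rfl
      · rw [if_pos fun i hi => ?_, decide_eq_false hex]
        · rfl
        · push Not at hex
          have := hex ⟨i, hi⟩
          rw [hv ⟨i, hi⟩, Bool.eq_false_iff.2 this]; rfl
  rw [Finset.sum_congr rfl key]
  refine Nat.mod_eq_of_lt ((sum_two_pow_lt _ _).trans (Nat.pow_lt_pow_right (by norm_num) (by omega)))

theorem psi_clauseBits (C : Fin k → Clause m) (ψ : (Fin k → Bool) → ℤ) (σ : Stream m n) (j : Fin n) :
    (ψ fun t => (∑ t ∈ Finset.range k, 2 ^ t * (clauseValue C σ j t).toNat).testBit t) =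
      ψ fun t => (C t).value (indicator σ j) := by
  congr 1
  ext t
  rw [testBit_sum_two_pow _ t.2, clauseValue, dif_pos t.2]

/-- The output cells at the end of the verifier for many clauses. -/
structure ExactVerdict (C : Fin k → Clause m) (ψ : (Fin k → Bool) → ℤ) (σ : Stream m n)
    (p : List Bool) (c : Cfg) : Prop where
  accept : c.out 0 = if p = [] then 1 else 0
  pos : c.out 1 = ∑ j : Fin n, (ψ fun t => (C t).value (indicator σ j)).toNat
  neg : c.out 2 = ∑ j : Fin n, (-ψ fun t => (C t).value (indicator σ j)).toNat
  den : c.out 3 = 0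

/-- The stored stream determines every clause value, so the sum is computed exactly. Positive and
negative parts are accumulated separately and go to different output cells. -/
protected theorem Setting.deterministic (hS : Setting E S Z γ f g κ ell)
    (hlit : ∀ t i, E.literal t i = litCode C t i) (hm : E.param .length = m)
    (hn : E.param .alphabet = n) (hk : E.param .clauses = k)
    (hψ : ∀ x, E.psi x = ψ fun t => x.testBit t) {i : List ℕ} {p l : List Bool}
    (hf : ∀ q < m, κ * ell + 2 ≤ f (arrCell q))
    (hin : ∀ j < m, inputSymbol (i.drop j) = σ.letter j + 1) (hlet : ∀ j < m, σ.letter j < n)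
    {b : ℕ} (hb : ∀ x, |ψ x| ≤ b) (hbig : n * b < modulus κ ell) :
    Triple f g E S (Ready E κ ell i p l 0) deterministic (ExactVerdict C ψ σ p) := by
  have hR := hS.toResources
  have hsz := hS.prime_size
  have hmg : Nat.size m ≤ g := by rw [← hm]; exact hR.env.param .length (by simp)
  refine (hR.assignTriple (hS.ok _ (by simp [terms])) (hS.cell_lt (by norm_num))
    (Q := fun c => (c.vars 0 = modulus κ ell ∧ c.vars 1 = 2 ^ (k + 1) ∧ c.input = i ∧ c.arr = 0 ∧
      c.out = 0 ∧ c.proof = p) ∧ c.vars 7 = m) ?_).seq ?_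
  · intro c h
    exact ⟨m, by simp [Term.length, hm], hmg, ⟨by simpa using h.prime, by simpa [hk] using h.pow,
      h.input, h.arr, h.out, h.proof⟩, by simp⟩
  refine Triple.seq (Q := fun c => c.vars 0 = modulus κ ell ∧ c.vars 1 = 2 ^ (k + 1) ∧
    (∀ q < m, c.arr q = σ.letter q + 1) ∧ c.out = 0 ∧ c.proof = p)
    ((hR.forTriple (hS.cell_lt (by norm_num)) (hS.cell_lt (by norm_num)) (by norm_num) hmg
      (fun j c => c.vars 0 = modulus κ ell ∧ c.vars 1 = 2 ^ (k + 1) ∧ c.input = i.drop j ∧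
        (∀ q < j, c.arr q = σ.letter q + 1) ∧ c.out = 0 ∧ c.proof = p) ?_ ?_).imp ?_) ?_
  · rintro c ⟨⟨h0, h1, hi, -, ho, hp⟩, h7⟩
    simp [h0, h1, hi, ho, hp, h7]
  · intro j hj
    refine Triple.of_steps ?_
    rintro c ⟨⟨h0, h1, hi, ha, ho, hp⟩, h6, h7⟩
    have hsym : inputSymbol c.input = σ.letter j + 1 := by rw [hi, hin j hj]
    have hlt := hlet j hj
    have hle : σ.letter j + 1 ≤ 2 ^ ell := by have := hS.param_lt.2.1; omega
    have hstep := hR.setArr (hS.ok (.var 6) (by simp [terms])) (hS.ok (.var 8) (by simp [terms]))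
      { c with vars := Function.update c.vars 8 (inputSymbol c.input), input := c.input.tail }
      (by simpa [hsym] using hS.size_le hle) (by
        simp only [Term.eval_var, Function.update_self, hsym,
          Function.update_of_ne (show (6 : ℕ) ≠ 8 by norm_num), h6]
        refine le_trans ?_ (hf j hj)
        refine (Nat.size_le_size hle).trans ?_
        rw [Nat.size_pow]
        have := Nat.le_mul_of_pos_left ell hS.one_le_mul
        omega)
    refine ⟨_, (hR.readInput (hS.cell_lt (by norm_num)) c (x := 8)
      (by rw [hsym]; exact hS.size_le hle)).seq hstep, ?_⟩
    refine ⟨by simp [h6], by simp [h7], by simp [h0], by simp [h1], by simp [hi], ?_, ho, hp⟩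
    intro q hq
    simp only [Cfg.set_arr, Term.eval_var, Function.update_self, hsym,
      Function.update_of_ne (show (6 : ℕ) ≠ 8 by norm_num), h6]
    by_cases hqj : q = j
    · subst hqj; simp
    · rw [Function.update_of_ne hqj, ha q (by omega)]
  · rintro c ⟨⟨h0, h1, -, ha, ho, hp⟩, -, -⟩
    exact ⟨h0, h1, ha, ho, hp⟩
  refine Triple.of_steps ?_
  rintro c ⟨h0, h1, ha, ho, hp⟩
  refine ⟨_, (hR.readProof (hS.cell_lt (by norm_num)) (by omega) c (x := 8)).seq
    ((hR.setOut (hS.ok _ (by simp [terms])) (by norm_num) _).seq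
    ((hR.setOut (hS.ok _ (by simp [terms])) (by norm_num) _).seq
      (hR.setOut (hS.ok _ (by simp [terms])) (by norm_num) _))), ?_⟩
  have hbits : ∀ j : Fin n, ∀ v, Term.clauseBits.eval E c.arr
      (Function.update (Function.update c.vars 8 v) 20 j) =
      ∑ t ∈ Finset.range k, 2 ^ t * (clauseValue C σ j t).toNat := fun j v =>
    Term.eval_clauseBits hlit hm hk ha j (by simp) (by simpa using h1)
  -- Since `n * b` is below the modulus, neither partial sum is changed by the reduction.
  have hsum : ∀ F : ℤ → ℕ, (∀ y : ℤ, |y| ≤ b → F y ≤ b) →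
      ∑ j : Fin n, F (ψ fun t => (C t).value (indicator σ j)) < modulus κ ell := by
    intro F hF
    refine lt_of_le_of_lt ?_ hbig
    refine (Finset.sum_le_card_nsmul _ _ b fun j _ => hF _ (hb _)).trans (by simp)
  refine ⟨?_, ?_, ?_, ?_⟩
  · simp [hp, proofSymbol_eq_zero_iff]
  · have h2 := hsum (fun y => y.toNat) (fun y hy => by rw [abs_le] at hy; omega)
    simp only [Function.update_apply]
    simp only [if_true, if_false,
      Nat.reduceEqDiff]
    rw [Term.eval_sum _ _ _ _ _ _ _ (by simp [h0, (modulus_prime κ ell).pos])]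
    rw [Term.alphabet, Term.eval_param, hn, Finset.sum_range]
    simp only [Term.eval_psiPos, hbits, hψ, psi_clauseBits]
    rw [Term.eval_var, Function.update_of_ne (by norm_num), h0]
    exact Nat.mod_eq_of_lt h2
  · have h2 := hsum (fun y => (-y).toNat) (fun y hy => by rw [abs_le] at hy; omega)
    simp only [Function.update_self]
    rw [Term.eval_sum _ _ _ _ _ _ _ (by simp [h0, (modulus_prime κ ell).pos])]
    rw [Term.alphabet, Term.eval_param, hn, Finset.sum_range]
    simp only [Term.eval_psiNeg, hbits, hψ, psi_clauseBits]
    rw [Term.eval_var, Function.update_of_ne (by norm_num), h0]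
    exact Nat.mod_eq_of_lt h2
  · simp [ho]

end

end

end AMStream
namespace AMStream
open Polynomial

/-! ### Space -/

/-- The bit lengths that the memory cells may have: `γ` below `Z`, and `β` in the first `N` array
entries. -/
def profile (Z γ N β a : ℕ) : ℕ := if a < Z then γ else if a % 3 = 0 ∧ a < 3 * N + 6 then β else 0

/-- Below `Z` there are at most `Z` cells. Above it, a nonzero cell must be an array entry, since
the profile is `0` elsewhere. -/
theorem bits_le_of_fit {Z γ N β : ℕ} {μ : Mem} (h : Fit (profile Z γ N β) μ) :
    μ.bits ≤ Z * (Nat.size Z + γ) + (N + 2) * (Nat.size (3 * N + 6) + β) := by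
  rw [Mem.bits, Finsupp.sum, ← Finset.sum_filter_add_sum_filter_not _ (· < Z)]
  refine add_le_add ?_ ?_
  · refine (Finset.sum_le_card_nsmul _ _ (Nat.size Z + γ) fun a ha => ?_).trans ?_
    · have hZ := (Finset.mem_filter.1 ha).2
      have h1 := h a
      rw [profile, if_pos hZ] at h1
      exact add_le_add (Nat.size_le_size hZ.le) h1
    · rw [smul_eq_mul]
      refine Nat.mul_le_mul_right _ ((Finset.card_le_card (t := Finset.range Z) fun a ha => ?_).trans
        (by simp))
      exact Finset.mem_range.2 (Finset.mem_filter.1 ha).2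
  · have key : ∀ a ∈ {a ∈ μ.support | ¬ a < Z}, (a % 3 = 0 ∧ a < 3 * N + 6) ∧ Nat.size (μ a) ≤ β := by
      intro a ha
      obtain ⟨hs, hZ⟩ := Finset.mem_filter.1 ha
      have h1 := h a
      rw [profile, if_neg hZ] at h1
      by_cases hc : a % 3 = 0 ∧ a < 3 * N + 6
      · exact ⟨hc, by rwa [if_pos hc] at h1⟩
      · rw [if_neg hc] at h1
        exact absurd (Nat.size_eq_zero.1 (Nat.le_zero.1 h1)) (Finsupp.mem_support_iff.1 hs)
    refine (Finset.sum_le_card_nsmul _ _ (Nat.size (3 * N + 6) + β) fun a ha => ?_).trans ?_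
    · exact add_le_add (Nat.size_le_size (key a ha).1.2.le) (key a ha).2
    · rw [smul_eq_mul]
      -- There are `N + 2` multiples of 3 below `3 * N + 6`: the `N` array cells and the cells `0`
      -- and `3`.
      refine Nat.mul_le_mul_right _ ((Finset.card_le_card
        (t := (Finset.range (N + 2)).image (3 * ·)) fun a ha => ?_).trans
        (Finset.card_image_le.trans (by simp)))
      have h1 := (key a ha).1
      exact Finset.mem_image.2 ⟨a / 3, Finset.mem_range.2 (by omega), by omega⟩

theorem exists_ok (l : List Term) : ∃ Z, ∀ T ∈ l, T.wt ≤ Z ∧ T.top 0 ≤ Z ∧ T.top 1 ≤ Z := by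
  induction l with
  | nil => exact ⟨0, by simp⟩
  | cons T l ih =>
    obtain ⟨Z, hZ⟩ := ih
    refine ⟨Z + T.wt + T.top 0 + T.top 1, fun U hU => ?_⟩
    rcases List.mem_cons.1 hU with rfl | hU
    · omega
    · have := hZ U hU; omega

/-- The program uses finitely many terms, so one constant `Z`, depending only on `κ`, dominates
their weights and their fixed cells. Then `γ = Z * g` works. -/
theorem exists_setting {κ : ℕ} (hκ : 1 ≤ κ) : ∃ A, ∀ (E : Env) (g ell N S : ℕ),
    Nat.size (Term.bulkVal E) = ell → 0 < Term.bulkVal E → κ * ell + 2 ≤ g →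
    E.param .clauses + 2 ≤ g → E.Le g →
    A * g + (N + 2) * (Nat.size (3 * N + 6) + (κ * ell + 2)) ≤ S →
    ∃ Z γ f, Setting E S Z γ f g κ ell ∧ ∀ q < N, κ * ell + 2 ≤ f (arrCell q) := by
  obtain ⟨Z₀, hZ₀⟩ := exists_ok (terms κ)
  let Z := Z₀ + 200
  refine ⟨Z * (Nat.size Z + Z) + 20 * Z + 20, fun E g ell N S hell hpos hg hk hE hS => ?_⟩
  have hZg : Z ≤ Z * g := Nat.le_mul_of_pos_right _ (by omega)
  have hgZ : g ≤ Z * g := Nat.le_mul_of_pos_left _ (by omega)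
  have hsZ : Nat.size Z ≤ Z := Nat.size_le.2 Nat.lt_two_pow_self
  refine ⟨Z, Z * g, profile Z (Z * g) N (κ * ell + 2), ⟨⟨⟨fun μ hμ => ?_, fun a ha => ?_, ?_⟩, hE, ?_,
    hgZ, ?_⟩, fun T hT => ?_, hpos, hell, hg, hκ, hk⟩, fun q hq => ?_⟩
  · refine le_trans ?_ hS
    have h1 := bits_le_of_fit hμ
    have h2 : Z * (Nat.size Z + Z * g) + 20 * (Z * g) + 20 ≤
        (Z * (Nat.size Z + Z) + 20 * Z + 20) * g := by
      have h3 : Z * Nat.size Z ≤ Z * Nat.size Z * g := Nat.le_mul_of_pos_right _ (by omega)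
      have h4 : 20 ≤ 20 * g := by omega
      calc _ = Z * Nat.size Z + Z * Z * g + 20 * Z * g + 20 := by ring
        _ ≤ Z * Nat.size Z * g + Z * Z * g + 20 * Z * g + 20 * g := by omega
        _ = _ := by ring
    omega
  · rw [profile, if_pos ha]
  · omega
  · omega
  · omega
  · obtain ⟨h1, h2, h3⟩ := hZ₀ T hT
    exact ⟨Nat.mul_le_mul_right _ (by omega), by omega, by omega⟩
  · rw [profile]
    simp only [arrCell]
    split_ifs <;> omega

/-! ### The verifier -/

/-- The bit length of the size of the input. -/
def bulkLevel (p : Param → ℕ) : ℕ := Nat.size (2 * (p .length + p .alphabet + p .invError))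

/-- The verifier. -/
def verifier (κ : ℕ) : Verifier where
  prog := program κ
  commonBits p := 24 * bulkLevel p * (bulkLevel p * (bulkLevel p + 1))
  privateBits p := κ * bulkLevel p

theorem rel_start {f : ℕ → ℕ} {g : ℕ} {m n c : ℕ} (σ : Stream m n) (ω : List Bool)
    (coins : Fin c → Bool) :
    Rel f g (start σ ω coins) ⟨0, 0, 0, List.ofFn fun i => (σ i : ℕ) + 1, ω, List.ofFn coins⟩ := by
  constructor <;> intros <;> simp [start, Fit]

theorem inputSymbol_drop {m n : ℕ} (σ : Stream m n) {j : ℕ} (hj : j < m) :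
    inputSymbol ((List.ofFn fun i => (σ i : ℕ) + 1).drop j) = σ.letter j + 1 := by
  rw [List.drop_eq_getElem_cons (by simpa using hj)]
  simp [inputSymbol, Stream.letter, hj]

theorem Rel.output_eq {f : ℕ → ℕ} {g : ℕ} {st : State} {c : Cfg} (h : Rel f g st c) :
    st.output = if c.out 0 = 0 then none else
      some ((((c.out 1 : ℕ) : ℚ) - ((c.out 2 : ℕ) : ℚ)) / (((c.out 3 : ℕ) : ℚ) + 1)) := by
  rw [State.output, h.out 0 (by norm_num), h.out 1 (by norm_num), h.out 2 (by norm_num),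
    h.out 3 (by norm_num)]

section
variable {E : Env} {S Z γ g κ ell : ℕ} {f : ℕ → ℕ}

protected theorem Setting.program (hS : Setting E S Z γ f g κ ell) {i : List ℕ} {p l : List Bool}
    {Q : Cfg → Prop}
    (h₁ : E.param .clauses < E.param .length →
      Triple f g E S (Ready E κ ell i p l 0) (randomized κ) Q)
    (h₂ : ¬ E.param .clauses < E.param .length →
      Triple f g E S (Ready E κ ell i p l 0) deterministic Q) :
    Triple f g E S (Fresh i p l) (program κ) Q := by
  refine (hS.setup i p l).seq ?_
  intro st c hr hc
  have hval : (Term.lt Term.clauses Term.length).eval E c.arr c.vars =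
      if E.param .clauses < E.param .length then 1 else 0 := by
    simp [Term.clauses, Term.length]
  suffices h : ∃ st', Runs E S (AMStream.ifThen (Term.lt Term.clauses Term.length) (AMStream.randomized κ)
      AMStream.deterministic) st st' ∧ ∃ c', Rel f g st' c' ∧ Q c' by
    obtain ⟨st', r, c', h⟩ := h
    exact ⟨st', c', r, h⟩
  refine hS.ifThen (hS.ok (Term.lt Term.clauses Term.length) (by simp [terms]))
    (R := fun st' => ∃ c', Rel f g st' c' ∧ Q c') (fun hne st hr => ?_) (fun he st hr => ?_) hr
  · obtain ⟨st', c', r, h⟩ := h₁ (by by_contra hlt; simp [hval, hlt] at hne) st c hr hc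
    exact ⟨st', r, c', h⟩
  · obtain ⟨st', c', r, h⟩ := h₂ (fun hlt => by simp [hval, hlt] at he) st c hr hc
    exact ⟨st', r, c', h⟩

end

end AMStream
namespace AMStream
open Polynomial

/-! ### The bounds of a run -/

/-- The standing assumptions on the parameters; `b` bounds the values of `ψ`. -/
structure Regular (m n k s w : ℕ) (δ : ℝ) (κ b : ℕ) : Prop where
  m_pos : 0 < m
  n_pos : 0 < n
  k_pos : 0 < k
  cover : n ≤ s * w
  δ_pos : 0 < δ
  δ_le : δ ≤ 1
  κ_large : 20 ≤ κ
  bound : 2 * n * b ≤ 2 ^ (κ * bulkLevel (params m n k s w δ))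

/-- The grid of an instance. -/
noncomputable def gridOf {m n k N : ℕ} (C : Fin k → Clause m) (ψ : (Fin k → Bool) → ℤ)
    (σ : Stream m n) (s ell : ℕ) (r : Fin N → Bool) : Grid :=
  streamGrid C ψ σ (min s n) (n / min s n + 1) (24 * ell * (ell + 1)) (Survives ell (bitSeq r))

section
variable {m n k s w : ℕ} {δ : ℝ} {κ b : ℕ}

namespace Regular

theorem one_le_invError (h : Regular m n k s w δ κ b) : 1 ≤ ⌈1 / δ⌉₊ :=
  Nat.one_le_iff_ne_zero.2 (Nat.ceil_pos.2 (by have := h.δ_pos; positivity)).ne'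

theorem bulk_lt : 2 * (m + n + ⌈1 / δ⌉₊) < 2 ^ bulkLevel (params m n k s w δ) := Nat.lt_size_self _

theorem three_le_level (h : Regular m n k s w δ κ b) : 3 ≤ bulkLevel (params m n k s w δ) := by
  have h1 := h.one_le_invError
  have h2 := h.m_pos
  have h3 := h.n_pos
  refine Nat.lt_size.2 ?_
  simp only [params]
  omega

theorem s_pos (h : Regular m n k s w δ κ b) : 0 < s := by
  have h1 := h.cover
  have h2 := h.n_pos
  rcases Nat.eq_zero_or_pos s with rfl | h3
  · simp at h1; omega
  · exact h3

theorem w_pos (h : Regular m n k s w δ κ b) : 0 < w := by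
  have h1 := h.cover
  have h2 := h.n_pos
  rcases Nat.eq_zero_or_pos w with rfl | h3
  · simp at h1; omega
  · exact h3

/-- The program computes its own number of rows and never reads the parameter `w`, whose bit length
the space bound does not control. The extra row costs at most a factor `2` in the proof length. -/
theorem rows_le (h : Regular m n k s w δ κ b) : n / min s n + 1 ≤ 2 * w := by
  have hw := h.w_pos
  rcases le_total s n with hs | hs
  · rw [min_eq_left hs]
    have : n / s ≤ w := Nat.div_le_of_le_mul h.cover
    omega
  · rw [min_eq_right hs, Nat.div_self h.n_pos]; omega

theorem n_le (h : Regular m n k s w δ κ b) : n ≤ min s n * (n / min s n + 1) := by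
  have h1 : 0 < min s n := lt_min h.s_pos h.n_pos
  exact (Nat.lt_mul_div_succ n h1).le

theorem size_param {x : ℕ} (hx : x ≤ 2 * (m + n + ⌈1 / δ⌉₊)) :
    Nat.size x ≤ bulkLevel (params m n k s w δ) := Nat.size_le_size hx

theorem b_le (h : Regular m n k s w δ κ b) : b ≤ 2 ^ (κ * bulkLevel (params m n k s w δ)) :=
  (Nat.le_mul_of_pos_left b (by have := h.n_pos; omega : 0 < 2 * n)).trans h.bound

end Regular

theorem size_le_self (x : ℕ) : Nat.size x ≤ x := Nat.size_le.2 Nat.lt_two_pow_self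

theorem size_tests_le {ell : ℕ} (h : 3 ≤ ell) : Nat.size (24 * ell * (ell + 1)) ≤ 4 * ell := by
  have h1 := size_mul_le (24 * ell) (ell + 1)
  have h2 := size_mul_le 24 ell
  have h3 : Nat.size 24 = 5 := by decide
  have h4 := size_le_self ell
  have h5 : Nat.size (ell + 1) ≤ ell := by
    refine Nat.size_le.2 ?_
    have := Nat.lt_two_pow_self (n := ell - 1)
    have h6 : 2 ^ ell = 2 * 2 ^ (ell - 1) := by rw [← pow_succ']; congr 1; omega
    omega
  omega

/-- The lengths of `s` and `k` are bounded crudely by `s` and `k` themselves, which the budget `s *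
k` affords. All other quantities have length of order `bulkLevel`. -/
theorem env_le (h : Regular m n k s w δ κ b) (C : Fin k → Clause m) {ψ : (Fin k → Bool) → ℤ}
    (hψ : ∀ x, |ψ x| ≤ b) {N : ℕ} (r : Fin N → Bool) :
    (env (params m n k s w δ) C ψ r).Le (s + k + (κ + 30) * bulkLevel (params m n k s w δ)) := by
  set ell := bulkLevel (params m n k s w δ) with hell
  have h3 : 3 ≤ ell := h.three_le_level
  have hle : ell ≤ (κ + 30) * ell := Nat.le_mul_of_pos_left _ (by omega)
  have hκ : (κ + 30) * ell = κ * ell + 30 * ell := add_mul _ _ _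
  have hb : ∀ y : ℤ, |y| ≤ b → Nat.size y.toNat ≤ κ * ell + 1 := by
    intro y hy
    have h1 := h.b_le
    rw [← hell] at h1
    rw [abs_le] at hy
    refine (Nat.size_le_size (show y.toNat ≤ 2 ^ (κ * ell) by omega)).trans ?_
    rw [Nat.size_pow]
  refine ⟨fun p hp => ?_, fun i => ?_, fun t i => ?_, fun x => ?_, fun x => ?_⟩
  · cases p with
    | length => have : Nat.size m ≤ ell := Regular.size_param (by omega); simp only [env, params]; omega
    | alphabet => have : Nat.size n ≤ ell := Regular.size_param (by omega); simp only [env, params]; omega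
    | clauses => have := size_le_self k; simp only [env, params]; omega
    | s => have := size_le_self s; simp only [env, params]; omega
    | w => exact absurd rfl hp
    | invError =>
      have : Nat.size ⌈1 / δ⌉₊ ≤ ell := Regular.size_param (by omega)
      simp only [env, params]; omega
  · refine (size_le_self _).trans ?_
    simp only [env]
    split_ifs
    · have := Bool.toNat_le (r ⟨i, by assumption⟩); omega
    · omega
  · have hcode : (env (params m n k s w δ) C ψ r).literal t i ≤ 2 * m + 3 := by
      simp only [env]
      split_ifs with ht hi
      · cases C ⟨t, ht⟩ ⟨i, hi⟩ with
        | const b => cases b <;> simp [Literal.code]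
        | pos q => have := q.2; simp only [Literal.code]; omega
        | neg q => have := q.2; simp only [Literal.code]; omega
      · omega
      · omega
    have h1 := h.one_le_invError
    have h2 := h.n_pos
    have := Regular.size_param (m := m) (n := n) (k := k) (s := s) (w := w) (δ := δ)
      (hcode.trans (by omega))
    omega
  · have : Nat.size ((env (params m n k s w δ) C ψ r).psi x).toNat ≤ κ * ell + 1 := hb _ (hψ _)
    omega
  · have : Nat.size (-(env (params m n k s w δ) C ψ r).psi x).toNat ≤ κ * ell + 1 :=
      hb _ (by rw [abs_neg]; exact hψ _)
    omega

/-- The length of the array. -/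
def arrayLength (m n k s ell : ℕ) : ℕ := if k < m then min s n * k * (24 * ell * (ell + 1)) else m

/-- With few clauses this counts columns, clauses and tests. With many clauses the stored stream has
length `m ≤ k ≤ s * k`. -/
theorem arrayLength_le (h : Regular m n k s w δ κ b) {ell : ℕ} (h3 : 3 ≤ ell) :
    arrayLength m n k s ell + 2 ≤ 50 * (s * k * ell ^ 2) := by
  have hsk : 1 ≤ s * k := Nat.mul_pos h.s_pos h.k_pos
  have h1 : s * k ≤ s * k * ell ^ 2 := Nat.le_mul_of_pos_right _ (by positivity)
  rw [arrayLength]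
  split_ifs with hlt
  · have h2 : min s n * k * (24 * ell * (ell + 1)) ≤ s * k * (48 * ell ^ 2) := by
      refine Nat.mul_le_mul (Nat.mul_le_mul_right _ (min_le_left _ _)) ?_
      nlinarith
    have h4 : s * k * (48 * ell ^ 2) = 48 * (s * k * ell ^ 2) := by ring
    omega
  · have h2 : k ≤ s * k := Nat.le_mul_of_pos_left _ h.s_pos
    omega

theorem size_arrayLength_le (h : Regular m n k s w δ κ b) :
    Nat.size (3 * arrayLength m n k s (bulkLevel (params m n k s w δ)) + 6) ≤
      8 * bulkLevel (params m n k s w δ) := by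
  set ell := bulkLevel (params m n k s w δ)
  have h3 : 3 ≤ ell := h.three_le_level
  have h1 := size_add_le (3 * arrayLength m n k s ell) 6
  have h2 := size_mul_le 3 (arrayLength m n k s ell)
  have h4 : Nat.size 3 = 2 := by decide
  have h5 : Nat.size 6 = 3 := by decide
  have h6 : Nat.size (arrayLength m n k s ell) ≤ 6 * ell := by
    rw [arrayLength]
    split_ifs with hlt
    · have a1 := size_mul_le (min s n * k) (24 * ell * (ell + 1))
      have a2 := size_mul_le (min s n) k
      have a3 := size_tests_le h3
      have a4 : Nat.size (min s n) ≤ ell :=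
        Regular.size_param ((min_le_right s n).trans (by omega))
      have a5 : Nat.size k ≤ ell := Regular.size_param (by omega)
      omega
    · have : Nat.size m ≤ ell := Regular.size_param (by omega)
      omega
  omega

theorem fits_gridOf (C : Fin k → Clause m) (ψ : (Fin k → Bool) → ℤ) (σ : Stream m n) (ell : ℕ)
    {N : ℕ} (r : Fin N → Bool) :
    (gridOf C ψ σ s ell r).Fits (env (params m n k s w δ) C ψ r) ell :=
  ⟨rfl, rfl, rfl, rfl, rfl, fun _ _ => rfl, fun _ => rfl, fun _ _ => Iff.rfl, rfl⟩

theorem size_proofLength_le (h : Regular m n k s w δ κ b) (C : Fin k → Clause m)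
    (ψ : (Fin k → Bool) → ℤ) (σ : Stream m n) {N : ℕ} (r : Fin N → Bool) {ell : ℕ}
    (hell : bulkLevel (params m n k s w δ) = ell) :
    Nat.size ((gridOf C ψ σ s ell r).proofLength κ ell) ≤ s + k + (κ + 30) * ell := by
  subst hell
  set ell := bulkLevel (params m n k s w δ)
  have h3 : 3 ≤ ell := h.three_le_level
  show Nat.size (((k * (24 * ell * (ell + 1)) + 1) * (n / min s n + 1) + 1) * (κ * ell + 1)) ≤ _
  have a1 := size_mul_le ((k * (24 * ell * (ell + 1)) + 1) * (n / min s n + 1) + 1) (κ * ell + 1)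
  have a2 := size_add_le ((k * (24 * ell * (ell + 1)) + 1) * (n / min s n + 1)) 1
  have a3 := size_mul_le (k * (24 * ell * (ell + 1)) + 1) (n / min s n + 1)
  have a4 := size_add_le (k * (24 * ell * (ell + 1))) 1
  have a5 := size_mul_le k (24 * ell * (ell + 1))
  have a6 := size_tests_le h3
  have a7 : Nat.size (n / min s n + 1) ≤ ell := by
    have := Nat.div_le_self n (min s n)
    have := h.m_pos
    exact Regular.size_param (by omega)
  have a8 := size_le_self k
  have a9 := size_le_self (κ * ell + 1)
  have a10 := size_one_eq
  have hκ : (κ + 30) * ell = κ * ell + 30 * ell := add_mul _ _ _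
  omega

/-- The output of a configuration. -/
noncomputable def Cfg.output (c : Cfg) : Option ℚ :=
  if c.out 0 = 0 then none
  else some ((((c.out 1 : ℕ) : ℚ) - ((c.out 2 : ℕ) : ℚ)) / (((c.out 3 : ℕ) : ℚ) + 1))

/-- The constant is chosen before the instance, so the space bound is uniform in all parameters; the
array and the fixed cells together need order `s * k * ell ^ 3` bits. -/
theorem exists_run {κ : ℕ} (hκ : 20 ≤ κ) : ∃ A, ∀ (m n k s w : ℕ) (δ : ℝ) (b : ℕ),
    Regular m n k s w δ κ b → ∀ ell, bulkLevel (params m n k s w δ) = ell →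
    ∀ (C : Fin k → Clause m) (ψ : (Fin k → Bool) → ℤ), (∀ x, |ψ x| ≤ b) →
    ∀ (N : ℕ) (r : Fin N → Bool) (σ : Stream m n) (ω : List Bool) (coins : Fin (κ * ell) → Bool),
    ∃ st c, Runs (env (params m n k s w δ) C ψ r) (s * k * (A * ell ^ 3)) (program κ)
      (start σ ω coins) st ∧ st.output = c.output ∧
      (k < m → (gridOf C ψ σ s ell r).Verdict κ ell (digitsValue (List.ofFn coins)) ω c) ∧
      (¬ k < m → ExactVerdict C ψ σ ω c) := by
  obtain ⟨A, hA⟩ := exists_setting (κ := κ) (by omega)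
  refine ⟨A * (κ + 32) + 50 * (κ + 9), fun m n k s w δ b h ell hell C ψ hψ N r σ ω coins => ?_⟩
  have h3 : 3 ≤ ell := hell ▸ h.three_le_level
  set E := env (params m n k s w δ) C ψ r
  -- The summand `k` pays for storing `2 ^ (k + 1)`, the summand `s` for the parameter, and the last
  -- one for residues and counters.
  set g := s + k + (κ + 30) * ell
  have hκ' : (κ + 30) * ell = κ * ell + 30 * ell := add_mul _ _ _
  have hE : E.Le g := by have := env_le h C hψ r; rwa [hell] at this
  have hsize : Nat.size (Term.bulkVal E) = ell := hell
  have hpos : 0 < Term.bulkVal E := Nat.size_pos.1 (by omega)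
  have hcl : E.param .clauses = k := rfl
  have hsk : 1 ≤ s * k := Nat.mul_pos h.s_pos h.k_pos
  have hspace : A * g + (arrayLength m n k s ell + 2) *
      (Nat.size (3 * arrayLength m n k s ell + 6) + (κ * ell + 2)) ≤
      s * k * ((A * (κ + 32) + 50 * (κ + 9)) * ell ^ 3) := by
    have h1 : g ≤ s * k * ((κ + 32) * ell ^ 3) := by
      have e1 : s ≤ s * k := Nat.le_mul_of_pos_right _ h.k_pos
      have e2 : k ≤ s * k := Nat.le_mul_of_pos_left _ h.s_pos
      have e3 : ell ≤ ell ^ 3 := Nat.le_self_pow (by norm_num) _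
      have e4 : (κ + 30) * ell ≤ s * k * ((κ + 30) * ell ^ 3) :=
        (Nat.mul_le_mul_left _ e3).trans (Nat.le_mul_of_pos_left _ hsk)
      have e5 : s * k ≤ s * k * ell ^ 3 := Nat.le_mul_of_pos_right _ (by positivity)
      calc g ≤ s * k * ell ^ 3 + s * k * ell ^ 3 + s * k * ((κ + 30) * ell ^ 3) := by omega
        _ = _ := by ring
    have h2 := arrayLength_le h h3
    have h4 : Nat.size (3 * arrayLength m n k s ell + 6) + (κ * ell + 2) ≤ (κ + 9) * ell := by
      have := size_arrayLength_le h
      rw [hell] at this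
      have : (κ + 9) * ell = κ * ell + 9 * ell := add_mul _ _ _
      omega
    calc _ ≤ A * (s * k * ((κ + 32) * ell ^ 3)) + 50 * (s * k * ell ^ 2) * ((κ + 9) * ell) :=
          add_le_add (Nat.mul_le_mul_left _ h1) (Nat.mul_le_mul h2 h4)
      _ = _ := by ring
  obtain ⟨Z, γ, f, hS, hf⟩ := hA E g ell (arrayLength m n k s ell) _ hsize hpos (by omega)
    (by rw [hcl]; omega) hE hspace
  have hin : ∀ j < m, inputSymbol ((List.ofFn fun i => (σ i : ℕ) + 1).drop j) = σ.letter j + 1 :=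
    fun j hj => inputSymbol_drop σ hj
  have hlet : ∀ j < m, σ.letter j < n := fun j hj => by simp [Stream.letter, hj]
  suffices hT : Triple f g E (s * k * ((A * (κ + 32) + 50 * (κ + 9)) * ell ^ 3))
      (Fresh (List.ofFn fun i => (σ i : ℕ) + 1) ω (List.ofFn coins)) (program κ) fun c =>
        (k < m → (gridOf C ψ σ s ell r).Verdict κ ell (digitsValue (List.ofFn coins)) ω c) ∧
        (¬ k < m → ExactVerdict C ψ σ ω c) by
    obtain ⟨st, c, hrun, hrel, hQ⟩ := hT _ _ (rel_start σ ω coins)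
      ⟨rfl, rfl, rfl, rfl, rfl, rfl, rfl, rfl⟩
    exact ⟨st, c, hrun, hrel.output_eq, hQ⟩
  refine hS.program (fun hlt => ?_) (fun hlt => ?_)
  · have hlt' : k < m := hlt
    have hN : arrayLength m n k s ell = min s n * k * (24 * ell * (ell + 1)) := if_pos hlt'
    refine (hS.randomized (I := gridOf C ψ σ s ell r) (fits_gridOf C ψ σ ell r) ?_ ?_ hin hlet
      (size_proofLength_le h C ψ σ r hell) (by simp)).imp fun c hc =>
        ⟨fun _ => hc, fun hn => absurd hlt' hn⟩
    · show Nat.size (min s n * k * (24 * ell * (ell + 1))) ≤ g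
      have a1 := size_mul_le (min s n * k) (24 * ell * (ell + 1))
      have a2 := size_mul_le (min s n) k
      have a3 := size_tests_le h3
      have a4 : Nat.size (min s n) ≤ s := (size_le_self _).trans (min_le_left _ _)
      have a5 := size_le_self k
      omega
    · intro q hq
      exact hf q (by rw [hN]; exact hq)
  · have hlt' : ¬ k < m := hlt
    have hN : arrayLength m n k s ell = m := if_neg hlt'
    refine (hS.deterministic (C := C) (ψ := ψ) (σ := σ) (fun _ _ => rfl) rfl rfl rfl (fun _ => rfl)
      (fun q hq => hf q (by rw [hN]; exact hq)) hin hlet hψ ?_).imp fun c hc =>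
        ⟨fun hn => absurd hn hlt', fun _ => hc⟩
    have h1 := h.bound
    rw [hell] at h1
    have h2 := lt_modulus κ ell
    have h4 : n * b ≤ 2 * n * b := Nat.mul_le_mul_right _ (by omega)
    omega

end

end AMStream
namespace AMStream
open Polynomial

/-! ### Correctness -/

theorem ExactVerdict.output_eq {m n k : ℕ} {C : Fin k → Clause m} {ψ : (Fin k → Bool) → ℤ}
    {σ : Stream m n} {p : List Bool} {c : Cfg} (h : ExactVerdict C ψ σ p c) :
    c.output = if p = [] then
      some ((∑ j : Fin n, ψ fun t => (C t).value (indicator σ j) : ℤ) : ℚ) else none := by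
  rw [Cfg.output, h.accept, h.pos, h.neg, h.den]
  by_cases hp : p = []
  · simp only [hp, if_true, one_ne_zero, if_false]
    congr 1
    have : ∀ y : ℤ, ((y.toNat : ℕ) : ℚ) - (((-y).toNat : ℕ) : ℚ) = y := fun y => by
      have := Int.toNat_sub_toNat_neg y
      exact_mod_cast congrArg (Int.cast (R := ℚ)) this
    push_cast
    rw [← Finset.sum_sub_distrib]
    simp [this]
  · simp [hp]

/-- The integer of least absolute value with residue `R`. -/
def signedLift (p R : ℕ) : ℤ := if 2 * R < p then R else R - p

/-- An integer of absolute value below `p / 2` is the only one in that range with its residue. -/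
theorem signedLift_val {p : ℕ} (hp : 0 < p) {T : ℤ} (hT : 2 * |T| < p) :
    signedLift p ((T : ZMod p).val) = T := by
  have : NeZero p := ⟨hp.ne'⟩
  have h1 : (((T : ZMod p).val : ℕ) : ℤ) = T % p := ZMod.val_intCast T
  rw [signedLift]
  rcases le_or_gt 0 T with h | h
  · rw [abs_of_nonneg h] at hT
    rw [Int.emod_eq_of_lt h (by omega)] at h1
    rw [if_pos (by omega), h1]
  · rw [abs_of_neg h] at hT
    rw [← Int.add_emod_right, Int.emod_eq_of_lt (by omega) (by omega)] at h1
    rw [if_neg (by omega), h1]; ring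

open Classical in
theorem Grid.Verdict.output_eq {I : Grid} {κ ell z : ℕ} {p : List Bool} {c : Cfg}
    (h : I.Verdict κ ell z p c) :
    c.output = if p.length ≤ I.proofLength κ ell ∧
      (I.total (modulus κ ell)).eval (z : ZMod (modulus κ ell)) =
        (I.proof κ ell p).eval (z : ZMod (modulus κ ell)) then
      some ((signedLift (modulus κ ell) (I.answer κ ell p) : ℤ) : ℚ) else none := by
  have hR : I.answer κ ell p < modulus κ ell := ZMod.val_lt _
  rw [Cfg.output, h.accept, h.pos, h.neg, h.den, signedLift]
  split_ifs <;> simp_all [Nat.cast_sub hR.le]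

theorem prob_eq_one {α : Type} [Fintype α] [Nonempty α] {A : α → Prop} (h : ∀ a, A a) :
    prob A = 1 := by
  rw [prob, show {a | A a} = Set.univ from Set.eq_univ_of_forall h, Set.ncard_univ,
    Nat.card_eq_fintype_card, div_self]
  exact_mod_cast Fintype.card_ne_zero

theorem le_prob_of_card_le {α : Type} [Fintype α] [Nonempty α] {A : α → Prop} {d : ℕ}
    (h : Set.ncard {a | ¬ A a} ≤ d) : 1 - (d : ℝ) / Fintype.card α ≤ prob A := by
  have hpos : (0 : ℝ) < Fintype.card α := by exact_mod_cast Fintype.card_pos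
  have h1 := Set.ncard_add_ncard_compl {a | A a}
  rw [Nat.card_eq_fintype_card, show {a | A a}ᶜ = {a | ¬ A a} from rfl] at h1
  rw [prob, one_sub_div hpos.ne']
  refine div_le_div_of_nonneg_right ?_ hpos.le
  have : (Fintype.card α : ℝ) = (Set.ncard {a | A a} : ℝ) + (Set.ncard {a | ¬ A a} : ℝ) := by
    exact_mod_cast h1.symm
  have h2 : (Set.ncard {a | ¬ A a} : ℝ) ≤ d := by exact_mod_cast h
  linarith

theorem prob_mono {α : Type} [Fintype α] {A B : α → Prop} (h : ∀ a, A a → B a) : prob A ≤ prob B := by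
  refine div_le_div_of_nonneg_right ?_ (Nat.cast_nonneg _)
  exact_mod_cast Set.ncard_le_ncard (fun a ha => h a ha) (Set.toFinite _)

theorem digitsValue_append (l : List Bool) (b : Bool) :
    digitsValue (l ++ [b]) = 2 * digitsValue l + b.toNat := by
  rw [digitsValue, List.foldl_append]; rfl

/-- Distinct coin strings yield distinct points, so the number of roots bounds the number of bad
coin strings. -/
theorem digitsValue_inj {l l' : List Bool} (hlen : l.length = l'.length)
    (h : digitsValue l = digitsValue l') : l = l' := by
  induction l using List.reverseRecOn generalizing l' with
  | nil => exact (List.length_eq_zero_iff.1 hlen.symm).symm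
  | append_singleton l b ih =>
    induction l' using List.reverseRecOn with
    | nil => simp at hlen
    | append_singleton l' b' _ =>
      rw [digitsValue_append, digitsValue_append] at h
      have hb := Bool.toNat_le b
      have hb' := Bool.toNat_le b'
      have hbb : b.toNat = b'.toNat := by omega
      have : b = b' := by cases b <;> cases b' <;> simp_all
      rw [ih (by simpa using hlen) (by omega), this]

/-- A nonzero polynomial has few roots among the values of the coins. -/
theorem card_eval_eq_le {p : ℕ} [hp : Fact p.Prime] {N d : ℕ} (hN : 2 ^ N < p) {F G : (ZMod p)[X]}
    (hF : F.natDegree ≤ d) (hG : G.natDegree ≤ d) (hne : F ≠ G) :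
    Set.ncard {c : Fin N → Bool | F.eval (digitsValue (List.ofFn c) : ZMod p) =
      G.eval (digitsValue (List.ofFn c) : ZMod p)} ≤ d := by
  have hlt : ∀ c : Fin N → Bool, digitsValue (List.ofFn c) < p := fun c => by
    have := digitsValue_take_lt (List.ofFn c) N
    rw [List.take_of_length_le (by simp)] at this
    omega
  refine (Set.ncard_le_ncard_of_injOn (t := ((F - G).roots.toFinset : Set (ZMod p)))
    (fun c => ((digitsValue (List.ofFn c) : ℕ) : ZMod p)) ?_ ?_).trans ?_
  · intro c hc
    rw [Finset.mem_coe, Multiset.mem_toFinset, mem_roots (sub_ne_zero.2 hne), IsRoot, eval_sub,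
      sub_eq_zero]
    exact hc
  · intro c _ c' _ h
    simp only [ZMod.natCast_eq_natCast_iff', Nat.mod_eq_of_lt (hlt _)] at h
    exact List.ofFn_injective (digitsValue_inj (by simp) h)
  · rw [Set.ncard_coe_finset]
    exact (Multiset.toFinset_card_le _).trans ((card_roots' _).trans
      ((natDegree_sub_le _ _).trans (max_le hF hG)))

/-! ### Error probabilities, proof length and correctness of the verifier -/

section
variable {m n k s w : ℕ} {δ : ℝ} {κ b : ℕ}

/-- The input size `bulk` includes twice the rounded inverse of `δ`, so one factor `2 ^ (-ell)` is
worth an error of `δ / 2`. -/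
theorem inv_bulk_le (h : Regular m n k s w δ κ b) :
    1 / 2 ^ bulkLevel (params m n k s w δ) < δ / 2 := by
  have h1 : (1 : ℝ) / δ ≤ ⌈1 / δ⌉₊ := Nat.le_ceil _
  have h2 : ((2 * (m + n + ⌈1 / δ⌉₊) : ℕ) : ℝ) < 2 ^ bulkLevel (params m n k s w δ) := by
    exact_mod_cast Regular.bulk_lt
  have h3 := h.δ_pos
  push_cast at h2
  have h4 : 2 * (1 / δ) < 2 ^ bulkLevel (params m n k s w δ) := by
    have := Nat.cast_nonneg (α := ℝ) m
    have := Nat.cast_nonneg (α := ℝ) n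
    linarith
  rw [div_lt_div_iff₀ (by positivity) (by norm_num)]
  rw [mul_one_div, div_lt_iff₀ h3] at h4
  linarith

/-- Union bound over the `n * k` pairs of a letter and a clause. The hypothesis `k < m` is what
bounds `k` by `2 ^ ell`. -/
theorem prob_detects (h : Regular m n k s w δ κ b) {ell : ℕ}
    (hell : bulkLevel (params m n k s w δ) = ell) (hk : k < m) (C : Fin k → Clause m)
    (σ : Stream m n) :
    1 - δ / 2 ≤ prob fun r : Fin (24 * ell * (ell * (ell + 1))) → Bool =>
      Detects C σ (24 * ell * (ell + 1)) (Survives ell (bitSeq r)) := by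
  have hb : 2 * (m + n + ⌈1 / δ⌉₊) < 2 ^ ell := hell ▸ Regular.bulk_lt
  refine (prob_isolates (ι := Fin n × Fin k) (24 * ell)
    (fun a => satisfied (C a.2) (indicator σ a.1)) (fun a i hi => ?_) (fun a => ?_) ?_).trans
    (prob_mono fun r hr j t hjt => hr (j, t) hjt)
  · have := mem_satisfied_lt hi; omega
  · have := card_satisfied_le (C a.2) (indicator σ a.1)
    have := h.n_pos
    omega
  · have h1 := inv_bulk_le h
    rw [hell] at h1
    -- As `(7 / 8) ^ 24 ≤ 1 / 8`, the `24 * ell` blocks give `2 ^ (-3 * ell)`: two of these powers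
    -- pay for the pairs, and the third for `δ / 2`.
    have h2 : ((7 : ℝ) / 8) ^ (24 * ell) ≤ (1 / 2 ^ ell) ^ 3 := by
      calc ((7 : ℝ) / 8) ^ (24 * ell) = ((7 / 8) ^ 24) ^ ell := pow_mul _ _ _
        _ ≤ ((1 / 2) ^ 3) ^ ell := pow_le_pow_left₀ (by norm_num) (by norm_num) _
        _ = _ := by rw [← pow_mul, mul_comm, pow_mul, one_div_pow]
    have hn : (n : ℝ) ≤ 2 ^ ell := by exact_mod_cast (by omega : n ≤ 2 ^ ell)
    have hk' : (k : ℝ) ≤ 2 ^ ell := by exact_mod_cast (by omega : k ≤ 2 ^ ell)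
    have hpos : (0 : ℝ) < 2 ^ ell := by positivity
    calc _ ≤ (2 ^ ell * 2 ^ ell : ℝ) * (1 / 2 ^ ell) ^ 3 := by
          rw [Fintype.card_prod, Fintype.card_fin, Fintype.card_fin, Nat.cast_mul]
          exact mul_le_mul (mul_le_mul hn hk' (by positivity) hpos.le) h2 (by positivity)
            (by positivity)
      _ = 1 / 2 ^ ell := by field_simp
      _ ≤ δ / 2 := h1.le

/-- The degree is at most `2 ^ (10 * ell)`, and one more factor `2 ^ ell` pays for `δ / 2`. Hence `κ
≥ 11` would do here. -/
theorem degree_lt (h : Regular m n k s w δ κ b) {ell : ℕ}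
    (hell : bulkLevel (params m n k s w δ) = ell) (hk : k < m) :
    (((k * (24 * ell * (ell + 1)) + 1) * (n / min s n + 1) : ℕ) : ℝ) / 2 ^ (κ * ell) < δ / 2 := by
  refine lt_of_le_of_lt ?_ (hell ▸ inv_bulk_le h)
  have h3 : 3 ≤ ell := hell ▸ h.three_le_level
  have hb : 2 * (m + n + ⌈1 / δ⌉₊) < 2 ^ ell := hell ▸ Regular.bulk_lt
  rw [div_le_div_iff₀ (by positivity) (by positivity), one_mul]
  have h1 : (k * (24 * ell * (ell + 1)) + 1) * (n / min s n + 1) * 2 ^ ell ≤ 2 ^ (κ * ell) := by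
    have e1 : k * (24 * ell * (ell + 1)) + 1 ≤ 2 ^ (9 * ell) := by
      have a1 : ell + 1 ≤ 2 ^ ell := Nat.lt_two_pow_self
      have a2 : 24 ≤ 2 ^ (5 * ell) :=
        le_trans (by norm_num : 24 ≤ 2 ^ 5) (Nat.pow_le_pow_right (by norm_num) (by omega))
      calc _ ≤ (k + 1) * (24 * ell * (ell + 1)) := by nlinarith
        _ ≤ 2 ^ ell * (2 ^ (5 * ell) * 2 ^ ell * 2 ^ ell) := by
            gcongr <;> omega
        _ = 2 ^ (8 * ell) := by ring
        _ ≤ _ := Nat.pow_le_pow_right (by norm_num) (by omega)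
    have e2 : n / min s n + 1 ≤ 2 ^ ell := by
      have := Nat.div_le_self n (min s n); omega
    calc _ ≤ 2 ^ (9 * ell) * 2 ^ ell * 2 ^ ell :=
          Nat.mul_le_mul_right _ (Nat.mul_le_mul e1 e2)
      _ = 2 ^ (11 * ell) := by ring
      _ ≤ _ := Nat.pow_le_pow_right (by norm_num)
        (Nat.mul_le_mul_right _ (by have := h.κ_large; omega))
  exact_mod_cast h1

theorem proofLength_gridOf_le (h : Regular m n k s w δ κ b) {ell : ℕ} (h3 : 3 ≤ ell)
    (C : Fin k → Clause m) (ψ : (Fin k → Bool) → ℤ) (σ : Stream m n) {N : ℕ} (r : Fin N → Bool) :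
    (gridOf C ψ σ s ell r).proofLength κ ell ≤ w * k * (99 * (κ + 1) * ell ^ 3) := by
  have hwk : 1 ≤ w * k := Nat.mul_pos h.w_pos h.k_pos
  have hkp := h.k_pos
  show ((k * (24 * ell * (ell + 1)) + 1) * (n / min s n + 1) + 1) * (κ * ell + 1) ≤ _
  have e1 : k * (24 * ell * (ell + 1)) + 1 ≤ k * (49 * ell ^ 2) :=
    calc _ ≤ k * (24 * ell * (ell + 1)) + k * 1 := by omega
      _ = k * (24 * ell * (ell + 1) + 1) := by ring
      _ ≤ _ := Nat.mul_le_mul_left _ (by nlinarith)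
  have e2 : (k * (24 * ell * (ell + 1)) + 1) * (n / min s n + 1) ≤ 98 * (w * k * ell ^ 2) :=
    (Nat.mul_le_mul e1 h.rows_le).trans (by ring_nf; rfl)
  have e3 : 1 ≤ w * k * ell ^ 2 := Nat.mul_pos hwk (by positivity)
  calc _ ≤ (99 * (w * k * ell ^ 2)) * ((κ + 1) * ell) := by
        refine Nat.mul_le_mul (by omega) ?_
        rw [add_mul]; omega
    _ = _ := by ring

/-- This is the range condition that allows the answer, possibly negative, to be recovered from its
residue. -/
theorem abs_sum_lt (h : Regular m n k s w δ κ b) {ell : ℕ}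
    (hell : bulkLevel (params m n k s w δ) = ell) {g : Fin n → ℤ} (hg : ∀ j, |g j| ≤ b) :
    2 * |∑ j, g j| < modulus κ ell := by
  have h1 : |∑ j, g j| ≤ n * b :=
    (Finset.abs_sum_le_sum_abs _ _).trans
      ((Finset.sum_le_card_nsmul _ _ (b : ℤ) fun j _ => hg j).trans (by simp))
  have h2 := h.bound
  rw [hell] at h2
  have h3 := lt_modulus κ ell
  have h4 : (((2 * n * b : ℕ)) : ℤ) < modulus κ ell := by exact_mod_cast h2.trans_lt h3
  push_cast at h4
  linarith

/-- The only failure over the common string is an undetected clause. For a good string, completeness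
holds with certainty and soundness loses only the chance of hitting a common value of two distinct
polynomials. -/
theorem exists_isAM {κ : ℕ} (hκ : 20 ≤ κ) : ∃ A, ∀ (m n k s w : ℕ) (δ : ℝ) (b : ℕ),
    Regular m n k s w δ κ b →
    ∀ (C : Fin k → Clause m) (ψ : (Fin k → Bool) → ℤ), (∀ x, |ψ x| ≤ b) →
    ∀ (f : Stream m n → ℝ) (ε : ℝ),
    (∀ σ, |((∑ j : Fin n, ψ fun t => (C t).value (indicator σ j) : ℤ) : ℝ) - f σ| ≤ ε * |f σ|) →
    (verifier κ).IsAM (params m n k s w δ) C ψ f ε δ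
      (s * k * (A * bulkLevel (params m n k s w δ) ^ 3))
      (w * k * (99 * (κ + 1) * bulkLevel (params m n k s w δ) ^ 3)) := by
  obtain ⟨A, hA⟩ := exists_run hκ
  refine ⟨A, fun m n k s w δ b h C ψ hψ f ε hf => ?_⟩
  obtain ⟨ell, hell⟩ : ∃ ell, bulkLevel (params m n k s w δ) = ell := ⟨_, rfl⟩
  have hrun := hA m n k s w δ b h ell hell C ψ hψ
  have h3 : 3 ≤ ell := hell ▸ h.three_le_level
  have hδ := h.δ_pos
  subst hell
  set ell := bulkLevel (params m n k s w δ)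
  set S := s * k * (A * ell ^ 3)
  let T : Stream m n → ℤ := fun σ => ∑ j : Fin n, ψ fun t => (C t).value (indicator σ j)
  have hone : 1 - δ / 2 < 1 := by linarith
  refine ⟨fun σ ω r c => ?_, fun σ => ?_⟩
  · obtain ⟨st, c', hr, ho, -⟩ := hrun _ r σ ω c
    exact ⟨_, st, hr, rfl⟩
  by_cases hk : k < m
  · have hgood : ∀ (r : Fin (24 * ell * (ell * (ell + 1))) → Bool) ω (c : Fin (κ * ell) → Bool),
        ∀ o, (open Classical in o = if ω.length ≤ (gridOf C ψ σ s ell r).proofLength κ ell ∧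
          ((gridOf C ψ σ s ell r).total (modulus κ ell)).eval
            (digitsValue (List.ofFn c) : ZMod (modulus κ ell)) =
          ((gridOf C ψ σ s ell r).proof κ ell ω).eval
            (digitsValue (List.ofFn c) : ZMod (modulus κ ell)) then
          some ((signedLift (modulus κ ell) ((gridOf C ψ σ s ell r).answer κ ell ω) : ℤ) : ℚ)
          else none) →
        (verifier κ).Outputs (params m n k s w δ) C ψ S σ ω r c o := by
      rintro r ω c o rfl
      obtain ⟨st, c', hr, ho, hv, -⟩ := hrun _ r σ ω c
      exact ⟨st, hr, by rw [ho, (hv hk).output_eq]⟩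
    refine (prob_detects h rfl hk C σ).trans (prob_mono fun r hr => ?_)
    set I := gridOf C ψ σ s ell r
    have hdeg : (I.total (modulus κ ell)).natDegree ≤ (I.k * I.D + 1) * I.w :=
      I.natDegree_total_le _
    have hpdeg : ∀ ω, (I.proof κ ell ω).natDegree ≤ (I.k * I.D + 1) * I.w := fun ω =>
      natDegree_proofPoly_le _ _ _ _
    -- The valid proofs are all encodings of the true polynomial. They depend on the common string
    -- through the tests, but not on the private point.
    refine ⟨{ω | ω.length ≤ I.proofLength κ ell ∧ I.proof κ ell ω = I.total (modulus κ ell)}, ?_,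
      fun ω hω => hω.1.trans (proofLength_gridOf_le h h3 C ψ σ r), fun ω hω => ?_, fun ω hω => ?_⟩
    · obtain ⟨ω, hlen, hω⟩ := exists_proofPoly_eq (modulus_le κ ell) hdeg
      exact ⟨ω, hlen.le, hω⟩
    -- An honest proof passes the check at every point, so the private coins cannot cause an error.
    · refine hone.trans_eq (prob_eq_one fun c => ⟨((T σ : ℤ) : ℚ), hgood r ω c _ ?_, ?_⟩).symm
      · rw [if_pos ⟨hω.1, by rw [hω.2]⟩, Grid.answer, hω.2]
        have hw : n / min s n + 1 ≤ modulus κ ell := by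
          have h1 := lt_modulus κ ell
          have h2 := Nat.div_le_self n (min s n)
          have h4 : 2 * (m + n + ⌈1 / δ⌉₊) < 2 ^ ell := Regular.bulk_lt
          have h5 : 2 ^ ell ≤ 2 ^ (κ * ell) := Nat.pow_le_pow_right (by norm_num)
            (Nat.le_mul_of_pos_left _ (by omega))
          omega
        have hsum : ∑ b ∈ Finset.range I.w, (I.total (modulus κ ell)).eval (b : ZMod (modulus κ ell)) =
            ((T σ : ℤ) : ZMod (modulus κ ell)) :=
          sum_eval_total C ψ σ (min s n) (n / min s n + 1) (24 * ell * (ell + 1))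
            (Survives ell (bitSeq r)) (modulus κ ell) hw h.n_le hr
        rw [hsum, signedLift_val (modulus_prime κ ell).pos (abs_sum_lt h rfl fun j => hψ _)]
      · rw [Rat.cast_intCast]; exact hf σ
    · by_cases hlen : ω.length ≤ I.proofLength κ ell
      · have hne : I.total (modulus κ ell) ≠ I.proof κ ell ω := fun he => hω ⟨hlen, he.symm⟩
        have hcard := card_eval_eq_le (lt_modulus κ ell) hdeg (hpdeg ω) hne
        have h1 : 1 - δ / 2 < 1 - (((I.k * I.D + 1) * I.w : ℕ) : ℝ) /
            Fintype.card (Fin (κ * ell) → Bool) := by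
          have := degree_lt h rfl hk
          rw [Fintype.card_fun, Fintype.card_fin, Fintype.card_bool, Nat.cast_pow, Nat.cast_two]
          exact sub_lt_sub_left this 1
        refine h1.trans_le ((le_prob_of_card_le (A := fun c : Fin (κ * ell) → Bool =>
          ¬ (I.total (modulus κ ell)).eval (digitsValue (List.ofFn c) : ZMod (modulus κ ell)) =
            (I.proof κ ell ω).eval (digitsValue (List.ofFn c) : ZMod (modulus κ ell))) ?_).trans
          (prob_mono fun c hc => hgood r ω c _ ?_))
        · simpa only [not_not] using hcard
        · rw [if_neg fun hh => hc hh.2]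
      · refine hone.trans_eq (prob_eq_one fun c => hgood r ω c _ ?_).symm
        rw [if_neg fun hh => hlen hh.1]
  · have hgood : ∀ (r : Fin (24 * ell * (ell * (ell + 1))) → Bool) ω (c : Fin (κ * ell) → Bool),
        (verifier κ).Outputs (params m n k s w δ) C ψ S σ ω r c
          (if ω = [] then some ((T σ : ℤ) : ℚ) else none) := by
      intro r ω c
      obtain ⟨st, c', hr, ho, -, hv⟩ := hrun _ r σ ω c
      exact ⟨st, hr, by rw [ho, (hv hk).output_eq]⟩
    refine (show 1 - δ / 2 ≤ 1 by linarith).trans_eq (prob_eq_one fun r => ?_).symm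
    -- With many clauses no proof is needed; the empty one is declared the only valid proof.
    refine ⟨{[]}, Set.singleton_nonempty _, ?_, ?_, ?_⟩
    · rintro ω rfl; simp
    · rintro ω rfl
      refine hone.trans_eq (prob_eq_one fun c => ⟨((T σ : ℤ) : ℚ), hgood r [] c, ?_⟩).symm
      rw [Rat.cast_intCast]; exact hf σ
    · intro ω hω
      refine hone.trans_eq (prob_eq_one fun c => ?_).symm
      have := hgood r ω c
      rwa [if_neg (by simpa using hω)] at this

/-- Polynomials in the level are polylogarithmic. -/
theorem level_pow_le_polylog (h : Regular m n k s w δ κ b) {A e K : ℕ} (hK : A * 5 ^ e + e ≤ K) :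
    ((A * bulkLevel (params m n k s w δ) ^ e : ℕ) : ℝ) ≤ polylog K m n δ := by
  set ell := bulkLevel (params m n k s w δ) with hell
  set x : ℝ := (m : ℝ) + n + 1 / δ with hx
  have hδ := h.δ_pos
  have hinv : 1 ≤ 1 / δ := by rw [le_div_iff₀ hδ]; linarith [h.δ_le]
  have hm : (1 : ℝ) ≤ m := by exact_mod_cast h.m_pos
  have hn : (1 : ℝ) ≤ n := by exact_mod_cast h.n_pos
  have hx3 : 3 ≤ x := by rw [hx]; linarith
  have hlog : 1 ≤ Real.log x := by
    rw [Real.le_log_iff_exp_le (by linarith)]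
    have := Real.exp_one_lt_d9
    linarith
  -- From `2 ^ ell ≤ 8 * x` the level is at most `3 + log x / log 2`, and `1 ≤ log x` absorbs the
  -- summand `3`.
  have h5 : (ell : ℝ) ≤ 5 * Real.log x := by
    have hpos : 0 < 2 * (m + n + ⌈1 / δ⌉₊) := by have := h.m_pos; omega
    -- A power of two at the bit length of a number is at most twice that number; rounding `1 / δ`
    -- up adds less than `1`, which is less than `x`.
    have hpow : (2 : ℝ) ^ ell ≤ 8 * x := by
      have h1 : 2 ^ ell ≤ 2 * (2 * (m + n + ⌈1 / δ⌉₊)) :=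
        Term.two_pow_size_le hpos
      have h2 : ((2 ^ ell : ℕ) : ℝ) ≤ ((2 * (2 * (m + n + ⌈1 / δ⌉₊)) : ℕ) : ℝ) := by exact_mod_cast h1
      push_cast at h2
      have h3 := Nat.ceil_lt_add_one (show 0 ≤ 1 / δ by positivity)
      linarith
    have h1 := Real.log_le_log (by positivity) hpow
    rw [Real.log_pow, Real.log_mul (by norm_num) (by linarith),
      show (8 : ℝ) = 2 ^ 3 by norm_num, Real.log_pow] at h1
    have h2 := Real.log_two_gt_d9
    push_cast at h1
    nlinarith
  have hL : 0 ≤ Real.log x := by linarith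
  rw [polylog, ← hx]
  push_cast
  calc (A : ℝ) * ell ^ e ≤ A * (5 * Real.log x) ^ e := by gcongr
    _ = (A * 5 ^ e : ℕ) * Real.log x ^ e := by push_cast; ring
    _ ≤ K * Real.log x ^ K := by
      refine mul_le_mul ?_ (pow_le_pow_right₀ hlog (by omega)) (by positivity) (by positivity)
      exact_mod_cast (by omega : A * 5 ^ e ≤ K)

end

/-- Both the coefficient and the power in the polynomial bound are at most `2 ^ (c * ell)`, and `2 *
n` is at most `2 ^ ell`. -/
theorem bound_of_poly {m n c κ ell v B : ℕ} (hell : 2 * (m + n + v) < 2 ^ ell) (h1 : 1 ≤ ell)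
    (hB : B ≤ c * (m + n) ^ c) (hκ : 2 * c + 1 ≤ κ) : 2 * n * B ≤ 2 ^ (κ * ell) := by
  have e1 : c ≤ 2 ^ (c * ell) :=
    (Nat.lt_two_pow_self (n := c)).le.trans (Nat.pow_le_pow_right (by norm_num)
      (Nat.le_mul_of_pos_right _ h1))
  have e2 : (m + n) ^ c ≤ 2 ^ (c * ell) := by
    rw [mul_comm, pow_mul]; exact Nat.pow_le_pow_left (by omega) _
  calc 2 * n * B ≤ 2 ^ ell * (2 ^ (c * ell) * 2 ^ (c * ell)) :=
        Nat.mul_le_mul (by omega) (hB.trans (Nat.mul_le_mul e1 e2))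
    _ = 2 ^ ((2 * c + 1) * ell) := by ring
    _ ≤ _ := Nat.pow_le_pow_right (by norm_num) (Nat.mul_le_mul_right _ hκ)

/-- The verifier outputs the integer sum exactly; the whole relative error comes from the assumed
approximation. -/
theorem abs_sub_le_of_approx {ε T F : ℝ} (h0 : 0 ≤ ε) (h1 : (1 - ε) * F ≤ T)
    (h2 : T ≤ (1 + ε) * F) : |T - F| ≤ ε * |F| := by
  have h3 : ε * F ≤ ε * |F| := mul_le_mul_of_nonneg_left (le_abs_self F) h0
  rw [abs_le]
  constructor <;> linarith

end AMStream

/-! ### Choice of the constants and assembly -/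

theorem theorem1 (ε : ℝ) (hε₀ : 0 ≤ ε) (hε : ε < 1 / 2)
    (P : AMStream.StreamProblem) (k : ℕ → ℕ → ℕ) (hk : ∀ m n, 0 < m → 0 < n → 0 < k m n)
    (C : ∀ m n, Fin (k m n) → AMStream.Clause m) (ψ : ∀ m n, (Fin (k m n) → Bool) → ℤ)
    (hP : ∀ m n, 0 < m → 0 < n → ∀ σ : AMStream.Stream m n,
      (1 - ε) * P m n σ ≤
        ((∑ j : Fin n, ψ m n (fun t => (C m n t).value (AMStream.indicator σ j)) : ℤ) : ℝ) ∧
      ((∑ j : Fin n, ψ m n (fun t => (C m n t).value (AMStream.indicator σ j)) : ℤ) : ℝ) ≤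
        (1 + ε) * P m n σ)
    (B : ℕ → ℕ → ℕ)
    (hB : ∃ c : ℕ, ∀ m n, 0 < m → 0 < n → B m n ≤ c * (m + n) ^ c)
    (hψ : ∀ m n, 0 < m → 0 < n → ∀ x, |ψ m n x| < (B m n : ℤ)) :
    ∃ (V : AMStream.Verifier) (K : ℕ), ∀ m n : ℕ, 0 < m → 0 < n →
      ∀ δ : ℝ, 0 < δ → δ ≤ 1 → ∀ s w : ℕ, n ≤ s * w →
        ∃ S W : ℕ,
          V.IsAM (AMStream.params m n (k m n) s w δ) (C m n) (ψ m n) (P m n) ε δ S W ∧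
          (S : ℝ) ≤ (s : ℝ) * (k m n : ℝ) * AMStream.polylog K m n δ ∧
          (W : ℝ) ≤ (w : ℝ) * (k m n : ℝ) * AMStream.polylog K m n δ ∧
          (V.randomness (AMStream.params m n (k m n) s w δ) : ℝ) ≤
            AMStream.polylog K m n δ := by
  obtain ⟨c, hc⟩ := hB
  -- The part `2 * c` makes the prime exceed the range of the sums, and `20` leaves room for the
  -- soundness error.
  obtain ⟨κ, hκ⟩ : ∃ κ, κ = 2 * c + 20 := ⟨_, rfl⟩
  obtain ⟨A, hA⟩ := AMStream.exists_isAM (κ := κ) (by omega)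
  -- Space, proof length and randomness are each a constant times `ell ^ 3`, with constants `A`, `99
  -- * (κ + 1)` and `48 + κ`. The factor `5 ^ 3` comes from `ell ≤ 5 * log x`, and the final `3`
  -- covers the exponent.
  refine ⟨AMStream.verifier κ, (A + 99 * (κ + 1) + (48 + κ)) * 5 ^ 3 + 3,
    fun m n hm hn δ hδ hδ1 s w hsw => ?_⟩
  have hreg : AMStream.Regular m n (k m n) s w δ κ (B m n) := by
    refine ⟨hm, hn, hk m n hm hn, hsw, hδ, hδ1, by omega, ?_⟩
    refine AMStream.bound_of_poly AMStream.Regular.bulk_lt (Nat.size_pos.2 ?_) (hc m n hm hn) (by omega)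
    simp only [AMStream.params]
    omega
  refine ⟨_, _, hA m n (k m n) s w δ (B m n) hreg (C m n) (ψ m n)
    (fun x => (hψ m n hm hn x).le) (P m n) ε (fun σ =>
      AMStream.abs_sub_le_of_approx hε₀ (hP m n hm hn σ).1 (hP m n hm hn σ).2), ?_, ?_, ?_⟩
  · rw [Nat.cast_mul, Nat.cast_mul]
    exact mul_le_mul_of_nonneg_left (AMStream.level_pow_le_polylog hreg (by omega)) (by positivity)
  · rw [Nat.cast_mul, Nat.cast_mul]
    exact mul_le_mul_of_nonneg_left (AMStream.level_pow_le_polylog hreg (by omega)) (by positivity)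
  · refine le_trans ?_ (AMStream.level_pow_le_polylog hreg (A := 48 + κ) (e := 3) (by omega))
    have h3 := hreg.three_le_level
    rw [AMStream.Verifier.randomness, AMStream.verifier]
    simp only
    generalize AMStream.bulkLevel (AMStream.params m n (k m n) s w δ) = ell at *
    have h1 : 24 * ell * (ell * (ell + 1)) ≤ 48 * ell ^ 3 := by nlinarith [Nat.mul_le_mul h3 h3, sq_nonneg ell]
    have h2 : κ * ell ≤ κ * ell ^ 3 := Nat.mul_le_mul_left _ (Nat.le_self_pow (by norm_num) _)
    rw [add_mul]
    exact_mod_cast add_le_add h1 h2
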